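/- **Theorem 2.1.** Let $\mathbf H$ be a complex Hilbert space and let $A$ be a densely defined, closed linear operator on $\mathbf H$ with domain $D(A)$ and range $R(A)$, such that $-A$ generates a bounded analytic semigroup $\{e^{-zA}:|\arg z|<\delta\}$ for some $0<\delta<\pi/2$. For $\alpha\in\mathbb R$ write $\mathfrak H_\alpha=L^2((0,\infty),t^\alpha\,dt;\mathbf H)$. Define $$\mathcal M_+(f)(t)=\int_0^t Ae^{-(t-s)A}f(s)\,ds,\qquad \mathcal M_-(f)(t)=\int_t^\infty Ae^{-(s-t)A}f(s)\,ds\qquad(t>0),$$ these being weak limits in $\mathbf H$ of the integrals over $(a,t-\varepsilon)$ as $a,\varepsilon\to0^+$, respectively over $(t+\varepsilon,R)$ as $\varepsilon\to0^+$, $R\to\infty$. Say that $(Q)_A$ holds if there is a constant $C$ with $\int_0^\infty\|sAe^{-sA}h\|^2\,\frac{ds}{s}\le C^2\|h\|^2$ for all $h\in\mathbf H$; $(Q)_{A^*}$ is the same condition for $A^*$ and $e^{-sA^*}=(e^{-sA})^*$. Let $N\ge1$ be an integer. (i) (Evolution formulae) Suppose $(Q)_A$ holds and let $f_0\in\mathbf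 H$. Then $$\mathcal M_+\big((sA)^Ne^{-sA}f_0\big)(t)=\tfrac1{N+1}(tA)^{N+1}e^{-tA}f_0,\tag{2.4}$$ $$\mathcal M_-\big(Ae^{-NsA}f_0\big)(t)=\tfrac1{N+1}Ae^{-NtA}f_0,\tag{2.5}$$ where the defining integrals converge and the identities hold for every $t>0$, and the arguments of $\mathcal M_\pm$ and both sides belong to $\mathfrak H_{-1}$ in (2.4) and to $\mathfrak H_1$ in (2.5). (ii) (Balayage formulae) Suppose $(Q)_{A^*}$ holds. If $f\in\mathfrak H_{-1}$, then $\mathcal M_+(f)(t)$ exists for a.e. $t>0$, $\mathcal M_+(f)\in\mathfrak H_{-1}$ and $$\int_0^\infty Ae^{-NtA}\mathcal M_+(f)(t)\,dt=\tfrac1{N+1}\int_0^\infty Ae^{-NsA}f(s)\,ds.\tag{2.6}$$ If $f\in\mathfrak H_1$, then $\mathcal M_-(f)(t)$ exists for a.e. $t>0$, $\mathcal M_-(f)\in\mathfrak H_1$ and $$\int_0^\infty (tA)^Ne^{-tA}\mathcal M_-(f)(t)\,dt=\tfrac1{N+1}\int_0^\infty (sA)^{N+1}e^{-sA}f(s)\,ds.\tag{2.7}$$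 (iii) (Endpoint balayage formulae) Suppose $(Q)_{A^*}$ holds. If $f\in\mathfrak H_1$ and $\int_0^\infty e^{-sA}f(s)\,ds$ converges weakly in $\mathbf H$ (as the limit of the integrals over $(a,R)$ as $a\to0^+$, $R\to\infty$) to an element of $\overline{R(A)}$ (this membership being automatic when $A$ is injective), then $\mathcal M_+(f)(t)$ exists for a.e. $t>0$ and $$\int_0^\infty e^{-NtA}\mathcal M_+(f)(t)\,dt=\tfrac1{N+1}\int_0^\infty e^{-NsA}f(s)\,ds,\tag{2.8}$$ both integrals converging weakly in the same improper sense. If $f\in\mathfrak H_{-1}$ and $\int_0^\infty Ae^{-sA}f(s)\,ds=0$ (weakly, in the same improper sense), then $\mathcal M_-(f)(t)$ exists for a.e. $t>0$, $\mathcal M_-(f)\in\mathfrak H_{-1}$ and $$\int_0^\infty t^{N-1}A^Ne^{-tA}\mathcal M_-(f)(t)\,dt=\tfrac1N\int_0^\infty s^NA^{N+1}e^{-sA}f(s)\,ds.\tag{2.9}$$ The integrals in (2.6), (2.7) and (2.9) are weak integrals in $\mathbf H$: the pairings of the integrands with every $h\in\mathbf H$ are Lebesgue integrable on $(0,\infty)$,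 and each integral is the element of $\mathbf H$ representing the resulting functional. -/

import Mathlib

open MeasureTheory Filter Topology Set

namespace MaxReg

variable {H : Type*} [NormedAddCommGroup H] [InnerProductSpace ℂ H] [CompleteSpace H]

/-- The open sector `{z ≠ 0 : |arg z| < δ}`. -/
def sector (δ : ℝ) : Set ℂ := {z | z ≠ 0 ∧ |Complex.arg z| < δ}

/-- `S z = e^{-zA}` is a bounded analytic semigroup on the open sector of half-angle `δ`, and its
generator is `-A`. As usual, boundedness and strong continuity at `0` are required on every
smaller sector. These conditions determine `S` on the sector uniquely in terms of `A`. -/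
structure IsBoundedAnalyticSemigroup (A : H →ₗ.[ℂ] H) (δ : ℝ) (S : ℂ → H →L[ℂ] H) : Prop where
  zero : S 0 = 1
  add : ∀ z ∈ sector δ, ∀ w ∈ sector δ, S (z + w) = S z * S w
  analytic : DifferentiableOn ℂ S (sector δ)
  bounded : ∀ δ' : ℝ, 0 < δ' → δ' < δ → ∃ M : ℝ, ∀ z ∈ sector δ', ‖S z‖ ≤ M
  strongly_continuous : ∀ δ' : ℝ, 0 < δ' → δ' < δ → ∀ x : H,
    Tendsto (fun z => S z x) (𝓝[sector δ'] 0) (𝓝 x)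
  generator : ∀ x y : H, (x, y) ∈ A.graph ↔
    Tendsto (fun t : ℝ => ((t : ℂ)⁻¹) • (x - S (t : ℂ) x)) (𝓝[>] 0) (𝓝 y)

open Classical in
/-- `A x` as a total function: it is `A x` for `x ∈ D(A)` (and the default value `0` otherwise).
Below, it is applied only to elements of the ranges of `e^{-tA}`, `t > 0` (or of powers of `A`
applied to those), which lie in the domain of every power of `A`. -/
noncomputable def app (A : H →ₗ.[ℂ] H) (x : H) : H :=
  if hx : x ∈ A.domain then A ⟨x, hx⟩ else 0

/-- `A ^ n e^{-tA} x`. -/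
noncomputable def powExp (A : H →ₗ.[ℂ] H) (S : ℂ → H →L[ℂ] H) (n : ℕ) (t : ℝ) (x : H) : H :=
  (app A)^[n] (S (t : ℂ) x)

/-- The measure `t ^ α dt` on `(0, ∞)`. -/
noncomputable def wMeasure (α : ℝ) : Measure ℝ :=
  (volume.restrict (Ioi 0)).withDensity (fun t => ENNReal.ofReal (t ^ α))

/-- Membership in `L²((0, ∞), t ^ α dt; H)`. -/
def MemW (α : ℝ) (f : ℝ → H) : Prop := MemLp f 2 (wMeasure α)

/-- The quadratic estimate for an operator `A` with semigroup `S z = e^{-zA}`: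
`‖s A e^{-sA} h‖_{L²(ds/s; H)} ≤ C ‖h‖` for all `h`. -/
def QuadraticEstimate (A : H →ₗ.[ℂ] H) (S : ℂ → H →L[ℂ] H) : Prop :=
  ∃ C : NNReal, ∀ h : H,
    eLpNorm (fun s : ℝ => (s : ℂ) • powExp A S 1 s h) 2 (wMeasure (-1)) ≤ C * ‖h‖ₑ

/-- The semigroup `e^{-zA*} = (e^{-z̄A})*` generated by `-A*`. -/
noncomputable def adjSemigroup (S : ℂ → H →L[ℂ] H) (z : ℂ) : H →L[ℂ] H :=
  ContinuousLinearMap.adjoint (S (starRingEnd ℂ z))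

/-- `y` is the value at `t` of the (singular, improper) integral
`∫₀ᵗ A e^{-(t-s)A} f(s) ds`: the truncated integrals over `(a, t - ε)` converge weakly to `y`
as `a → 0+` and `ε → 0+`. -/
def IsForwardValue (A : H →ₗ.[ℂ] H) (S : ℂ → H →L[ℂ] H) (f : ℝ → H) (t : ℝ) (y : H) : Prop :=
  ∀ h : H, Tendsto
    (fun p : ℝ × ℝ => inner ℂ h (∫ s in p.1..(t - p.2), powExp A S 1 (t - s) (f s)))
    (𝓝[>] 0 ×ˢ 𝓝[>] 0) (𝓝 (inner ℂ h y))

/-- `y` is the value at `t` of the (singular, improper) integral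
`∫ₜ^∞ A e^{-(s-t)A} f(s) ds`: the truncated integrals over `(t + ε, R)` converge weakly to `y`
as `ε → 0+` and `R → ∞`. -/
def IsBackwardValue (A : H →ₗ.[ℂ] H) (S : ℂ → H →L[ℂ] H) (f : ℝ → H) (t : ℝ) (y : H) : Prop :=
  ∀ h : H, Tendsto
    (fun p : ℝ × ℝ => inner ℂ h (∫ s in (t + p.1)..p.2, powExp A S 1 (s - t) (f s)))
    (𝓝[>] 0 ×ˢ atTop) (𝓝 (inner ℂ h y))

/-- The integral defining the forward maximal regularity operator converges at `t`. -/
def ForwardConverges (A : H →ₗ.[ℂ] H) (S : ℂ → H →L[ℂ] H) (f : ℝ → H) (t : ℝ) : Prop :=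
  ∃ y : H, IsForwardValue A S f t y

/-- The integral defining the backward maximal regularity operator converges at `t`. -/
def BackwardConverges (A : H →ₗ.[ℂ] H) (S : ℂ → H →L[ℂ] H) (f : ℝ → H) (t : ℝ) : Prop :=
  ∃ y : H, IsBackwardValue A S f t y

open Classical in
/-- The forward maximal regularity operator (with value `0` where the integral diverges). -/
noncomputable def forwardMR (A : H →ₗ.[ℂ] H) (S : ℂ → H →L[ℂ] H) (f : ℝ → H) (t : ℝ) : H :=
  if ht : ForwardConverges A S f t then ht.choose else 0

open Classical in
/-- The backward maximal regularity operator (with value `0` where the integral diverges). -/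
noncomputable def backwardMR (A : H →ₗ.[ℂ] H) (S : ℂ → H →L[ℂ] H) (f : ℝ → H) (t : ℝ) : H :=
  if ht : BackwardConverges A S f t then ht.choose else 0

/-- `∫₀^∞ F(t) dt = v` weakly, with absolute convergence of every scalar integral
`∫₀^∞ ⟨h, F(t)⟩ dt`. -/
def HasWeakIntegral (F : ℝ → H) (v : H) : Prop :=
  ∀ h : H, IntegrableOn (fun t => inner ℂ h (F t)) (Ioi 0) ∧
    ∫ t in Ioi (0 : ℝ), inner ℂ h (F t) = inner ℂ h v

/-- `∫₀^∞ F(t) dt` converges weakly to `v` as an improper integral: `F` is integrable on compact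
subintervals of `(0, ∞)`, and `∫ₐᴿ F(t) dt → v` weakly as `a → 0+` and `R → ∞`. -/
def HasImproperWeakIntegral (F : ℝ → H) (v : H) : Prop :=
  (∀ a b : ℝ, 0 < a → a ≤ b → IntegrableOn F (Icc a b)) ∧
  ∀ h : H, Tendsto (fun p : ℝ × ℝ => inner ℂ h (∫ t in p.1..p.2, F t))
    (𝓝[>] 0 ×ˢ atTop) (𝓝 (inner ℂ h v))

end MaxReg

/-! The whole argument runs on the operators `K n t` = A^n e^{-tA}, t > 0, and on four facts
collected in `ExpFamily`: the semigroup law, K n' = -K (n+1), the bound C/t^n (Cauchy's estimate in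
the sector) and strong continuity at 0.

The algebra is short. In the forward evolution formula the exponentials combine to s^N A^{N+1}
e^{-tA} f₀, so only the scalar s^N is integrated (`forwardValue_pow_smul`); in the backward one A²
e^{-((N+1)s-t)A} f₀ is an exact derivative (`backwardValue_comp_mul`). The balayage formulae are
dual: Fubini's theorem followed by the same computations. The analysis lies in the existence of the
singular integrals and in the use of Fubini's theorem.

Existence. On unweighted L² this is de Simon's theorem. The Laplace transform of A e^{-tA} is
bounded on the right half plane, so Plancherel's theorem in the Hilbert space H bounds the
regularised operators with kernel A e^{-(t-s+ε)A} uniformly in ε, and they converge to some G in L².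
For the mild solution u one has u' = f - G, and a first order expansion of u at a Lebesgue point
shows that the truncated integrals converge to G(t) for almost every t
(`exists_maximalRegularity_of_integrable`). Conjugation by a power t^{±1/2} of the weight perturbs
the kernel by a term of size C/max(t,s), which Hardy's inequalities control. At the two endpoint
weights this perturbation would be too large, and the reflected kernel A e^{-(t+s)A} is subtracted
first. Its contribution is explicit: it is governed by the integral of A e^{-sA} f(s), respectively
e^{-sA} f(s), on which the endpoint statements make their assumption.

Fubini. After pairing with h, part of the exponential is moved onto h. The quadratic estimate for A*
says that √s (A e^{-sA})* h lies in L²(ds), and Cauchy–Schwarz with Hardy's inequalities gives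
absolute convergence. Only the endpoint formula for the forward operator lacks it: there the
identity is proved on [a, R] with boundary terms (`integral_inner_zero_forwardValue`). The term at a
vanishes because the partial integrals of e^{-sA} f(s) tend weakly to 0; the term at R vanishes
because e^{-tA} F → 0 for F in the closure of the range of A. -/

namespace MaxReg

set_option linter.unusedSectionVars false

variable {H : Type*} [NormedAddCommGroup H] [InnerProductSpace ℂ H] [CompleteSpace H]

/-! ### The operators A^n e^{-tA} and their identification with derivatives of the semigroup -/

/-- The properties of the operators `K n t = Aⁿ e^{-tA}`, `t > 0`, on which the theory of maximal
regularity rests. -/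
structure ExpFamily (K : ℕ → ℝ → H →L[ℂ] H) : Prop where
  mul : ∀ m n s t, 0 < s → 0 < t → K m s * K n t = K (m + n) (s + t)
  deriv : ∀ n t, 0 < t → HasDerivAt (K n) (-K (n + 1) t) t
  bound : ∀ n, ∃ C, 0 ≤ C ∧ ∀ t, 0 < t → ‖K n t‖ ≤ C / t ^ n
  tendsto_zero : ∀ x, Tendsto (fun t => K 0 t x) (𝓝[>] 0) (𝓝 x)

/-- The operators `Aⁿ e^{-tA}`, `t > 0`, obtained as derivatives of the semigroup. -/
noncomputable def powOp (S : ℂ → H →L[ℂ] H) (n : ℕ) (t : ℝ) : H →L[ℂ] H :=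
  (-1 : ℂ) ^ n • iteratedDeriv n S (t : ℂ)

theorem isOpen_sector {δ : ℝ} (hδ : δ < Real.pi) : IsOpen (sector δ) := by
  -- The argument is continuous only off the negative axis, which the sector avoids because δ < π.
  have h : sector δ = Complex.slitPlane ∩ Complex.arg ⁻¹' (Ioo (-δ) δ) := by
    ext z
    simp only [sector, mem_ofPred_eq, mem_inter_iff, Complex.mem_slitPlane_iff_arg, mem_preimage,
      mem_Ioo, abs_lt]
    constructor
    · rintro ⟨h0, h1, h2⟩
      exact ⟨⟨fun h => by linarith, h0⟩, h1, h2⟩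
    · rintro ⟨⟨-, h0⟩, h1⟩
      exact ⟨h0, h1⟩
  rw [h]
  exact ContinuousOn.isOpen_inter_preimage
    (fun z hz => (Complex.continuousAt_arg hz).continuousWithinAt) Complex.isOpen_slitPlane
    isOpen_Ioo

theorem ofReal_mem_sector {δ t : ℝ} (hδ : 0 < δ) (ht : 0 < t) : (t : ℂ) ∈ sector δ :=
  ⟨by exact_mod_cast ht.ne', by rw [Complex.arg_ofReal_of_nonneg ht.le]; simpa using hδ⟩

/-- Sectors are invariant under positive dilations, so one ball about 1 yields balls about every t
with radius proportional to t. This is what produces the power t^{-n} in Cauchy's estimate. -/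
theorem exists_closedBall_subset_sector {δ : ℝ} (hδ : 0 < δ) (hδ' : δ < Real.pi) :
    ∃ r, 0 < r ∧ ∀ t : ℝ, 0 < t → Metric.closedBall (t : ℂ) (r * t) ⊆ sector δ := by
  obtain ⟨r, hr, hsub⟩ := Metric.nhds_basis_closedBall.mem_iff.1
    ((isOpen_sector hδ').mem_nhds (x := 1) (by simpa using ofReal_mem_sector hδ one_pos))
  refine ⟨r, hr, fun t ht z hz => ?_⟩
  have htc : (t : ℂ) ≠ 0 := by exact_mod_cast ht.ne'
  have h1 : (t⁻¹ : ℝ) * z ∈ sector δ := by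
    apply hsub
    rw [Metric.mem_closedBall, dist_eq_norm] at hz ⊢
    have : ((t⁻¹ : ℝ) : ℂ) * z - 1 = ((t⁻¹ : ℝ) : ℂ) * (z - t) := by
      push_cast; field_simp
    rw [this, norm_mul, Complex.norm_real, Real.norm_of_nonneg (by positivity)]
    calc t⁻¹ * ‖z - t‖ ≤ t⁻¹ * (r * t) := by gcongr
      _ = r := by field_simp
  rw [sector, mem_ofPred_eq, Complex.arg_real_mul _ (inv_pos.2 ht)] at h1
  exact ⟨fun h => h1.1 (by simp [h]), h1.2⟩

theorem hasDerivAt_iteratedDeriv {S : ℂ → H →L[ℂ] H} {U : Set ℂ} (hU : IsOpen U)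
    (hS : DifferentiableOn ℂ S U) (n : ℕ) {z : ℂ} (hz : z ∈ U) :
    HasDerivAt (iteratedDeriv n S) (iteratedDeriv (n + 1) S z) z := by
  have h := ((hS.analyticOnNhd hU).iterated_deriv n z hz).differentiableAt.hasDerivAt
  rw [iteratedDeriv_succ, iteratedDeriv_eq_iterate]
  exact h

theorem hasDerivAt_powOp {A : H →ₗ.[ℂ] H} {δ : ℝ} (hδ₀ : 0 < δ) (hδ₁ : δ < Real.pi / 2)
    {S : ℂ → H →L[ℂ] H} (hS : IsBoundedAnalyticSemigroup A δ S) (n : ℕ) {t : ℝ} (ht : 0 < t) :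
    HasDerivAt (powOp S n) (-powOp S (n + 1) t) t := by
  have h := hasDerivAt_iteratedDeriv (isOpen_sector (by linarith [Real.pi_pos])) hS.analytic n
    (ofReal_mem_sector hδ₀ ht)
  have h2 : HasDerivAt (powOp S n) _ t :=
    (h.scomp t (Complex.ofRealCLM.hasDerivAt (x := t))).const_smul ((-1 : ℂ) ^ n)
  convert h2 using 1
  rw [powOp, pow_succ, mul_neg_one, neg_smul, neg_neg, Complex.ofRealCLM_apply,
    Complex.ofReal_one, one_smul]

theorem expFamily_powOp {A : H →ₗ.[ℂ] H} {δ : ℝ} (hδ₀ : 0 < δ) (hδ₁ : δ < Real.pi / 2)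
    {S : ℂ → H →L[ℂ] H} (hS : IsBoundedAnalyticSemigroup A δ S) : ExpFamily (powOp S) where
  deriv n t ht := hasDerivAt_powOp hδ₀ hδ₁ hS n ht
  -- Differentiating the semigroup law in t, then in s, raises the indices one at a time by
  -- uniqueness of derivatives.
  mul := by
    have hd := fun n t (ht : 0 < t) => hasDerivAt_powOp hδ₀ hδ₁ hS n ht
    have h0 : ∀ n s t, 0 < s → 0 < t → powOp S 0 s * powOp S n t = powOp S n (s + t) := by
      intro n
      induction n with
      | zero =>
        intro s t hs ht
        simp only [powOp, pow_zero, iteratedDeriv_zero, one_smul, Complex.ofReal_add]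
        exact (hS.add _ (ofReal_mem_sector hδ₀ hs) _ (ofReal_mem_sector hδ₀ ht)).symm
      | succ n ih =>
        intro s t hs ht
        have h1 : HasDerivAt (fun t => powOp S 0 s * powOp S n t)
            (powOp S 0 s * (-powOp S (n + 1) t)) t := (hd n t ht).const_mul _
        have h2 : HasDerivAt (fun t => powOp S n (s + t)) (-powOp S (n + 1) (s + t)) t :=
          (hd n (s + t) (by positivity)).comp_const_add s t
        have h3 := h1.unique (h2.congr_of_eventuallyEq
          ((eventually_gt_nhds ht).mono fun t' ht' => ih s t' hs ht'))
        rw [mul_neg] at h3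
        exact neg_injective h3
    intro m n
    induction m with
    | zero => simpa using h0 n
    | succ m ih =>
      intro s t hs ht
      have h1 : HasDerivAt (fun s => powOp S m s * powOp S n t)
          ((-powOp S (m + 1) s) * powOp S n t) s := (hd m s hs).mul_const _
      have h2 : HasDerivAt (fun s => powOp S (m + n) (s + t))
          (-powOp S (m + n + 1) (s + t)) s :=
        (hd (m + n) (s + t) (by positivity)).comp_add_const s t
      have h3 := h1.unique (h2.congr_of_eventuallyEq
        ((eventually_gt_nhds hs).mono fun s' hs' => ih s' t hs' ht))
      rw [neg_mul] at h3
      rw [add_right_comm]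
      exact neg_injective h3
  -- Cauchy's estimate on the circle of radius r t, which stays in the sector of half-angle δ/2
  -- where S is bounded by M, gives n! M / (r t)^n.
  bound n := by
    obtain ⟨r, hr, hsub⟩ := exists_closedBall_subset_sector (half_pos hδ₀)
      (by linarith [Real.pi_pos])
    obtain ⟨M, hM⟩ := hS.bounded (δ / 2) (half_pos hδ₀) (half_lt_self hδ₀)
    have hM0 : 0 ≤ M := (norm_nonneg _).trans (hM _ (ofReal_mem_sector (half_pos hδ₀) one_pos))
    refine ⟨n.factorial * M / r ^ n, by positivity, fun t ht => ?_⟩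
    have hd : DiffContOnCl ℂ S (Metric.ball (t : ℂ) (r * t)) := by
      apply DifferentiableOn.diffContOnCl
      apply hS.analytic.mono
      refine Metric.closure_ball_subset_closedBall.trans ((hsub t ht).trans fun z hz => ?_)
      exact ⟨hz.1, hz.2.trans (half_lt_self hδ₀)⟩
    have h := Complex.norm_iteratedDeriv_le_of_forall_mem_sphere_norm_le n (by positivity) hd
      (fun z hz => hM z (hsub t ht (Metric.sphere_subset_closedBall hz)))
    rw [powOp, norm_smul]
    simp only [norm_pow, norm_neg, norm_one, one_pow, one_mul]
    refine h.trans (le_of_eq ?_)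
    rw [mul_pow, div_div]
  tendsto_zero x := by
    have h := hS.strongly_continuous (δ / 2) (half_pos hδ₀) (half_lt_self hδ₀) x
    have h2 : Tendsto (fun t : ℝ => (t : ℂ)) (𝓝[>] 0) (𝓝[sector (δ / 2)] 0) := by
      refine tendsto_nhdsWithin_iff.2 ⟨?_, ?_⟩
      · exact (Complex.continuous_ofReal.tendsto' 0 0 (by simp)).mono_left nhdsWithin_le_nhds
      · filter_upwards [self_mem_nhdsWithin] with t ht
        exact ofReal_mem_sector (half_pos hδ₀) ht
    simpa [powOp, Function.comp_def] using h.comp h2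

theorem powOp_zero (S : ℂ → H →L[ℂ] H) (t : ℝ) : powOp S 0 t = S (t : ℂ) := by
  simp [powOp]

theorem app_eq_of_mem_graph {A : H →ₗ.[ℂ] H} {x y : H} (h : (x, y) ∈ A.graph) : app A x = y := by
  obtain ⟨z, hz1, hz2⟩ := (LinearPMap.mem_graph_iff A).1 h
  simp only at hz1 hz2
  subst hz1
  simp [app, hz2]

/-- The difference quotient defining A at `powOp S n t x` is, by the semigroup law, a difference
quotient of `powOp S n` at t. -/
theorem mem_graph_powOp {A : H →ₗ.[ℂ] H} {δ : ℝ} (hδ₀ : 0 < δ) (hδ₁ : δ < Real.pi / 2)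
    {S : ℂ → H →L[ℂ] H} (hS : IsBoundedAnalyticSemigroup A δ S) (n : ℕ) {t : ℝ} (ht : 0 < t)
    (x : H) : (powOp S n t x, powOp S (n + 1) t x) ∈ A.graph := by
  have hK := expFamily_powOp hδ₀ hδ₁ hS
  rw [hS.generator]
  have h := (hasDerivAt_iff_tendsto_slope_zero.1 (hK.deriv n t ht)).mono_left
    (nhdsWithin_mono 0 (fun s (hs : 0 < s) => hs.ne') : 𝓝[>] (0 : ℝ) ≤ _)
  have h2 := (((ContinuousLinearMap.apply ℂ H x).continuous.tendsto _).comp h).neg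
  simp only [ContinuousLinearMap.apply_apply, neg_apply, neg_neg] at h2
  refine h2.congr' ?_
  filter_upwards [self_mem_nhdsWithin] with s (hs : 0 < s)
  have h3 : S (s : ℂ) (powOp S n t x) = powOp S n (t + s) x := by
    rw [← powOp_zero S, add_comm t s, ← Nat.zero_add n, ← hK.mul 0 n s t hs ht]
    simp
  rw [h3]
  simp only [Function.comp_apply, ContinuousLinearMap.apply_apply,
    smul_apply, sub_apply]
  rw [← smul_neg, neg_sub, ← Complex.ofReal_inv, Complex.coe_smul]

/-- The default value in `app` is never met for t > 0, so the iterated unbounded operator may be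
replaced by bounded operators throughout. -/
theorem powExp_eq_powOp {A : H →ₗ.[ℂ] H} {δ : ℝ} (hδ₀ : 0 < δ) (hδ₁ : δ < Real.pi / 2)
    {S : ℂ → H →L[ℂ] H} (hS : IsBoundedAnalyticSemigroup A δ S) (n : ℕ) {t : ℝ} (ht : 0 < t)
    (x : H) : powExp A S n t x = powOp S n t x := by
  unfold powExp
  induction n with
  | zero => simp [powOp]
  | succ n ih =>
    rw [Function.iterate_succ_apply', ih]
    exact app_eq_of_mem_graph (mem_graph_powOp hδ₀ hδ₁ hS n ht x)

theorem powOp_zero_apply_of_mem_graph {A : H →ₗ.[ℂ] H} {δ : ℝ} (hδ₀ : 0 < δ)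
    (hδ₁ : δ < Real.pi / 2) {S : ℂ → H →L[ℂ] H} (hS : IsBoundedAnalyticSemigroup A δ S)
    {t : ℝ} (ht : 0 < t) {x y : H} (hxy : (x, y) ∈ A.graph) :
    powOp S 0 t y = powOp S 1 t x := by
  have hK := expFamily_powOp hδ₀ hδ₁ hS
  have h1 := ((powOp S 0 t).continuous.tendsto _).comp ((hS.generator x y).1 hxy)
  have h2 := ((hS.generator _ _).1 (mem_graph_powOp hδ₀ hδ₁ hS 0 ht x))
  refine tendsto_nhds_unique h1 (h2.congr' ?_)
  filter_upwards [self_mem_nhdsWithin] with s (hs : 0 < s)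
  have h3 : powOp S 0 s * powOp S 0 t = powOp S 0 t * powOp S 0 s := by
    rw [hK.mul 0 0 s t hs ht, hK.mul 0 0 t s ht hs, add_comm s t]
  have h4 := congrArg (fun T => T x) h3
  simp only [mul_apply_eq_comp] at h4
  simp only [Function.comp_apply, map_smul, map_sub, ← powOp_zero, h4]

/-- On the range itself e^{-tA} A x = A e^{-tA} x is O(1/t), and uniform boundedness of the
semigroup extends the decay to the closure. This is the only role of the range condition. -/
theorem tendsto_powOp_zero_atTop {A : H →ₗ.[ℂ] H} {δ : ℝ} (hδ₀ : 0 < δ)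
    (hδ₁ : δ < Real.pi / 2) {S : ℂ → H →L[ℂ] H} (hS : IsBoundedAnalyticSemigroup A δ S)
    {F : H} (hF : F ∈ closure (Set.range (fun x : A.domain => A x))) :
    Tendsto (fun t => powOp S 0 t F) atTop (𝓝 0) := by
  have hK := expFamily_powOp hδ₀ hδ₁ hS
  obtain ⟨C, hC0, hC⟩ := hK.bound 0
  obtain ⟨C₁, hC₁0, hC₁⟩ := hK.bound 1
  rw [Metric.tendsto_nhds]
  intro ε hε
  obtain ⟨_, ⟨x, rfl⟩, hx⟩ := Metric.mem_closure_iff.1 hF (ε / (2 * (C + 1))) (by positivity)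
  have h1 : Tendsto (fun t : ℝ => C₁ / t ^ 1 * ‖(x : H)‖) atTop (𝓝 0) := by
    simpa using ((tendsto_const_nhds (x := C₁)).div_atTop tendsto_id).mul_const ‖(x : H)‖
  filter_upwards [h1.eventually (gt_mem_nhds (half_pos hε)), eventually_gt_atTop 0] with t ht ht0
  rw [dist_zero_right]
  have h2 : powOp S 0 t F = powOp S 0 t (F - A x) + powOp S 1 t x := by
    rw [← powOp_zero_apply_of_mem_graph hδ₀ hδ₁ hS ht0 (A.mem_graph x), map_sub]
    simp
  have h3 : ‖powOp S 0 t (F - A x)‖ ≤ C * (ε / (2 * (C + 1))) := by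
    refine (ContinuousLinearMap.le_opNorm _ _).trans ?_
    have := hC t ht0
    rw [dist_eq_norm] at hx
    simp only [pow_zero, div_one] at this
    gcongr
  have h4 : C * (ε / (2 * (C + 1))) ≤ ε / 2 := by
    rw [mul_div_assoc', div_le_iff₀ (by positivity)]
    nlinarith
  have h5 : ‖powOp S 1 t x‖ ≤ C₁ / t ^ 1 * ‖(x : H)‖ :=
    ContinuousLinearMap.le_of_opNorm_le _ (hC₁ t ht0) _
  rw [h2]
  exact (norm_add_le _ _).trans_lt (by linarith)

/-- For x in the domain, ⟨(A e^{-tA})* h, x⟩ = ⟨(e^{-tA})* h, A x⟩, which exhibits (A e^{-tA})* h as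
A* applied to (e^{-tA})* h. It converts the quadratic estimate for A* into one for adjoints of
bounded operators. -/
theorem powExp_adjoint {A : H →ₗ.[ℂ] H} (hdense : Dense (A.domain : Set H)) {δ : ℝ} (hδ₀ : 0 < δ)
    (hδ₁ : δ < Real.pi / 2) {S : ℂ → H →L[ℂ] H} (hS : IsBoundedAnalyticSemigroup A δ S)
    {t : ℝ} (ht : 0 < t) (h : H) :
    powExp A.adjoint (adjSemigroup S) 1 t h = ContinuousLinearMap.adjoint (powOp S 1 t) h := by
  have key : ∀ x : A.domain, inner ℂ (ContinuousLinearMap.adjoint (powOp S 1 t) h) (x : H) =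
      inner ℂ (adjSemigroup S t h) (A x) := by
    intro x
    rw [adjSemigroup, Complex.conj_ofReal, ContinuousLinearMap.adjoint_inner_left,
      ContinuousLinearMap.adjoint_inner_left,
      ← powOp_zero_apply_of_mem_graph hδ₀ hδ₁ hS ht (A.mem_graph x), powOp_zero]
  have hmem := LinearPMap.mem_adjoint_domain_of_exists (T := A) _ ⟨_, key⟩
  have := LinearPMap.adjoint_apply_eq hdense ⟨_, hmem⟩ key
  simp only [powExp, Function.iterate_one, app]
  rw [dif_pos hmem, this]

/-! ### Semigroup laws and strong continuity of the adjoint semigroup -/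

namespace ExpFamily

variable {K : ℕ → ℝ → H →L[ℂ] H}

theorem mul_apply (hK : ExpFamily K) (m n : ℕ) {s t : ℝ} (hs : 0 < s) (ht : 0 < t) (x : H) :
    K m s (K n t x) = K (m + n) (s + t) x := by
  rw [← hK.mul m n s t hs ht]; rfl

theorem continuousOn (hK : ExpFamily K) (n : ℕ) : ContinuousOn (K n) (Ioi 0) :=
  fun t ht => (hK.deriv n t ht).continuousAt.continuousWithinAt

theorem adjoint_apply (hK : ExpFamily K) (m n : ℕ) {s t : ℝ} (hs : 0 < s) (ht : 0 < t) (x : H) :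
    ContinuousLinearMap.adjoint (K m s) (ContinuousLinearMap.adjoint (K n t) x) =
      ContinuousLinearMap.adjoint (K (m + n) (s + t)) x := by
  rw [add_comm m n, add_comm s t, ← hK.mul n m t s ht hs, ContinuousLinearMap.mul_def,
    ContinuousLinearMap.adjoint_comp]
  rfl

/-- On the range of each (K 0 τ)* the claim follows from norm continuity of K 0 at τ > 0. These
ranges span a dense subspace: a vector x orthogonal to all of them has K 0 t x = 0 for every t > 0,
hence x = 0. The uniform bound does the rest. -/
theorem tendsto_adjoint_zero (hK : ExpFamily K) (h : H) :
    Tendsto (fun t => ContinuousLinearMap.adjoint (K 0 t) h) (𝓝[>] 0) (𝓝 h) := by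
  obtain ⟨C, hC0, hC⟩ := hK.bound 0
  let V : Submodule ℂ H :=
    ⨆ τ : Ioi (0 : ℝ), LinearMap.range (ContinuousLinearMap.adjoint (K 0 τ) : H →ₗ[ℂ] H)
  have hV : Dense (V : Set H) := by
    rw [Submodule.dense_iff_topologicalClosure_eq_top, Submodule.topologicalClosure_eq_top_iff,
      Submodule.eq_bot_iff]
    intro x hx
    refine tendsto_nhds_unique (hK.tendsto_zero x) (tendsto_const_nhds.congr' ?_)
    filter_upwards [self_mem_nhdsWithin] with t ht
    refine (inner_self_eq_zero (𝕜 := ℂ).1 ?_).symm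
    rw [← ContinuousLinearMap.adjoint_inner_left]
    refine (Submodule.mem_orthogonal V x).1 hx _ ?_
    exact Submodule.mem_iSup_of_mem (⟨t, ht⟩ : Ioi (0 : ℝ)) ⟨_, rfl⟩
  have hVt : ∀ y ∈ V, Tendsto (fun t => ContinuousLinearMap.adjoint (K 0 t) y) (𝓝[>] 0)
      (𝓝 y) := by
    intro y hy
    induction hy using Submodule.iSup_induction' with
    | mem τ y hy =>
      obtain ⟨z, rfl⟩ := hy
      have hτ : (0 : ℝ) < τ := τ.2
      have h1 : Tendsto (fun t : ℝ => ContinuousLinearMap.adjoint (K 0 (t + τ)) z) (𝓝[>] 0)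
          (𝓝 (ContinuousLinearMap.adjoint (K 0 τ) z)) := by
        have h2 : ContinuousAt (K 0) (τ : ℝ) := (hK.deriv 0 τ hτ).continuousAt
        have h3 : Tendsto (fun t : ℝ => t + (τ : ℝ)) (𝓝[>] 0) (𝓝 (τ : ℝ)) :=
          (Continuous.tendsto' (by fun_prop) _ _ (by simp)).mono_left nhdsWithin_le_nhds
        exact ((ContinuousLinearMap.apply ℂ H z).continuous.tendsto _).comp
          (((ContinuousLinearMap.adjoint (𝕜 := ℂ) (E := H) (F := H)).continuous.tendsto _).comp
            (h2.tendsto.comp h3))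
      refine h1.congr' ?_
      filter_upwards [self_mem_nhdsWithin] with t ht
      exact (hK.adjoint_apply 0 0 ht hτ z).symm
    | zero => simp
    | add x y _ _ hx hy => simpa using hx.add hy
  rw [Metric.tendsto_nhds]
  intro ε hε
  obtain ⟨y, hy, hyd⟩ := Metric.mem_closure_iff.1 (hV h) (ε / (2 * (C + 2))) (by positivity)
  have h1 := Metric.tendsto_nhds.1 (hVt y hy) (ε / 2) (by positivity)
  filter_upwards [h1, self_mem_nhdsWithin] with t ht ht0
  rw [dist_eq_norm] at *
  have h2 : ContinuousLinearMap.adjoint (K 0 t) h - h =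
      ContinuousLinearMap.adjoint (K 0 t) (h - y) + (ContinuousLinearMap.adjoint (K 0 t) y - y)
        - (h - y) := by rw [map_sub]; abel
  have h3 : ‖ContinuousLinearMap.adjoint (K 0 t) (h - y)‖ ≤ C * ‖h - y‖ := by
    refine ContinuousLinearMap.le_of_opNorm_le _ ?_ _
    simpa using hC t ht0
  have h4 : (C + 1) * ‖h - y‖ ≤ ε / 2 := by
    have : (C + 1) * ‖h - y‖ ≤ (C + 1) * (ε / (2 * (C + 2))) := by gcongr
    refine this.trans ?_
    rw [mul_div_assoc', div_le_iff₀ (by positivity)]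
    nlinarith
  rw [h2]
  calc _ ≤ ‖ContinuousLinearMap.adjoint (K 0 t) (h - y)‖
        + ‖ContinuousLinearMap.adjoint (K 0 t) y - y‖ + ‖h - y‖ :=
        (norm_sub_le _ _).trans (by gcongr; exact norm_add_le _ _)
    _ < ε := by nlinarith

end ExpFamily

/-! ### Plancherel's theorem and bounded Laplace transforms -/

section

open scoped FourierTransform Convolution SchwartzMap

/-- The Plancherel theorem on `L¹ ∩ L²`: the `L²` Fourier transform is given by the integral. -/
theorem fourier_toLp_ae_eq {f : ℝ → H} (h1 : Integrable f) (h2 : MemLp f 2 volume) :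
    (𝓕 (h2.toLp f) : Lp H 2 (volume : Measure ℝ)) =ᵐ[volume] 𝓕 f := by
  have hc : Continuous (𝓕 f) :=
    VectorFourier.fourierIntegral_continuous Real.continuous_fourierChar (by fun_prop) h1
  -- Both sides are tested against smooth compactly supported functions. The L² transform passes to
  -- the test function by its definition on tempered distributions, the integral transform by
  -- Fubini's theorem.
  refine ae_eq_of_integral_contDiff_smul_eq
    ((Lp.memLp _).locallyIntegrable (by norm_num)) hc.locallyIntegrable ?_
  intro g hg hgs
  let g' : ℝ → ℂ := fun x => (g x : ℂ)
  have hg' : ContDiff ℝ (⊤ : ℕ∞) g' := Complex.ofRealCLM.contDiff.comp hg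
  have hgs' : HasCompactSupport g' := hgs.comp_left Complex.ofReal_zero
  let φ : 𝓢(ℝ, ℂ) := hgs'.toSchwartzMap hg'
  have hφ : ∀ x, φ x = (g x : ℂ) := fun x => rfl
  have e1 := congrArg (fun T : 𝓢'(ℝ, H) => T φ)
    (Lp.fourier_toTemperedDistribution_eq (h2.toLp f))
  simp only [TemperedDistribution.fourier_apply, Lp.toTemperedDistribution_apply] at e1
  have e2 : ∫ x, (𝓕 φ) x • (h2.toLp f : ℝ → H) x = ∫ x, (𝓕 φ) x • f x := by
    apply integral_congr_ae
    filter_upwards [h2.coeFn_toLp] with x hx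
    rw [hx]
  have e3 : ∫ x, (𝓕 φ) x • f x = ∫ x, φ x • 𝓕 f x := by
    have := VectorFourier.integral_fourierIntegral_smul_eq_flip (μ := (volume : Measure ℝ))
      (ν := (volume : Measure ℝ)) (L := innerₗ ℝ)
      Real.continuous_fourierChar (by fun_prop) (φ.integrable) h1
    rw [flip_innerₗ] at this
    exact this
  have e4 := e1.symm.trans (e2.trans e3)
  simpa [hφ, Complex.coe_smul] using e4

theorem eLpNorm_fourier_eq {f : ℝ → H} (h1 : Integrable f) (h2 : MemLp f 2 volume) :
    eLpNorm (𝓕 f) 2 volume = eLpNorm f 2 volume := by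
  rw [← eLpNorm_congr_ae (fourier_toLp_ae_eq h1 h2), ← eLpNorm_congr_ae h2.coeFn_toLp]
  have := Lp.norm_fourier_eq (h2.toLp f)
  rw [Lp.norm_def, Lp.norm_def] at this
  exact (ENNReal.toReal_eq_toReal_iff' (Lp.eLpNorm_ne_top _) (Lp.eLpNorm_ne_top _)).1 this

theorem memLp_two_of_bounded {f : ℝ → H} (h1 : Integrable f) {C : ℝ} (hC : ∀ x, ‖f x‖ ≤ C) :
    MemLp f 2 volume := by
  rw [memLp_two_iff_integrable_sq_norm h1.aestronglyMeasurable]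
  refine (h1.norm.const_mul C).mono (h1.aestronglyMeasurable.norm.pow 2) (ae_of_all _ fun x => ?_)
  have := hC x
  have h0 := norm_nonneg (f x)
  rw [Real.norm_of_nonneg (by positivity), Real.norm_of_nonneg (mul_nonneg (h0.trans this) h0)]
  nlinarith

/-- An operator-valued Fourier multiplier estimate. -/
theorem eLpNorm_convolution_le {k : ℝ → H →L[ℂ] H} (hk : Integrable k) {B C : ℝ}
    (hB : ∀ x, ‖k x‖ ≤ B) (hC : ∀ ξ, ‖𝓕 k ξ‖ ≤ C) {f : ℝ → H} (h1 : Integrable f)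
    (h2 : MemLp f 2 volume) :
    eLpNorm (k ⋆[ContinuousLinearMap.id ℂ (H →L[ℂ] H)] f) 2 volume ≤
      ENNReal.ofReal C * eLpNorm f 2 volume := by
  set L := ContinuousLinearMap.id ℂ (H →L[ℂ] H)
  have hI : Integrable (k ⋆[L] f) := hk.integrable_convolution L h1
  -- The sup bound serves only to place the convolution in L², so that Plancherel's theorem applies
  -- to it; B does not enter the final constant.
  have hbd : ∀ x, ‖(k ⋆[L] f) x‖ ≤ B * ∫ y, ‖f y‖ := by
    intro x
    rw [← integral_sub_left_eq_self (fun y => ‖f y‖) volume x, ← integral_const_mul]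
    refine norm_integral_le_of_norm_le ((h1.norm.comp_sub_left x).const_mul B)
      (ae_of_all _ fun t => ?_)
    exact ((k t).le_opNorm _).trans (by gcongr; exact hB t)
  rw [← eLpNorm_fourier_eq hI (memLp_two_of_bounded hI hbd), ← eLpNorm_fourier_eq h1 h2]
  refine eLpNorm_le_mul_eLpNorm_of_ae_le_mul (ae_of_all _ fun ξ => ?_) 2
  rw [Real.fourier_bilin_convolution_eq L hk h1]
  exact ((𝓕 k ξ).le_opNorm _).trans (by gcongr; exact hC ξ)

namespace ExpFamily

variable {K : ℕ → ℝ → H →L[ℂ] H}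

theorem integrableOn_cexp_smul (hK : ExpFamily K) (n : ℕ) {ε : ℝ} (hε : 0 < ε) {ζ : ℂ}
    (hζ : 0 < ζ.re) : IntegrableOn (fun τ : ℝ => Complex.exp (-ζ * τ) • K n (τ + ε)) (Ioi 0) := by
  obtain ⟨C, hC0, hC⟩ := hK.bound n
  have hc : ContinuousOn (fun τ : ℝ => Complex.exp (-ζ * τ) • K n (τ + ε)) (Ioi 0) := by
    have hce : Continuous fun τ : ℝ => Complex.exp (-ζ * τ) := by fun_prop
    refine hce.continuousOn.smul ?_
    exact (hK.continuousOn n).comp (by fun_prop) (fun τ (hτ : 0 < τ) => by simp; linarith)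
  refine Integrable.mono' ((integrableOn_exp_mul_Ioi (neg_neg_of_pos hζ) 0).const_mul (C / ε ^ n))
    (hc.aestronglyMeasurable measurableSet_Ioi) ?_
  filter_upwards [ae_restrict_mem measurableSet_Ioi] with τ (hτ : 0 < τ)
  rw [norm_smul, Complex.norm_exp, mul_comm]
  have : (-ζ * τ).re = -ζ.re * τ := by simp
  rw [this]
  gcongr
  refine (hC _ (by linarith)).trans ?_
  gcongr
  linarith

theorem hasDerivAt_cexp_smul (hK : ExpFamily K) (n : ℕ) {ε : ℝ} (ζ : ℂ) {τ : ℝ}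
    (hτ : 0 < τ + ε) :
    HasDerivAt (fun τ : ℝ => Complex.exp (-ζ * τ) • K n (τ + ε))
      (-(ζ • Complex.exp (-ζ * τ) • K n (τ + ε)) - Complex.exp (-ζ * τ) • K (n + 1) (τ + ε)) τ := by
  have h1 : HasDerivAt (fun τ : ℝ => Complex.exp (-ζ * τ)) (Complex.exp (-ζ * τ) * -ζ) τ := by
    have := ((hasDerivAt_id τ).ofReal_comp.const_mul (-ζ)).cexp
    simpa using this
  have h2 : HasDerivAt (fun τ : ℝ => K n (τ + ε)) (-K (n + 1) (τ + ε)) τ :=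
    (hK.deriv n _ hτ).comp_add_const τ ε
  refine (h1.smul h2).congr_deriv ?_
  simp only [smul_neg, mul_neg, neg_smul, smul_smul, mul_comm ζ]
  abel

theorem norm_cexp_le_one {ζ : ℂ} (hζ : 0 < ζ.re) {τ : ℝ} (hτ : 0 ≤ τ) :
    ‖Complex.exp (-ζ * τ)‖ ≤ 1 := by
  rw [Complex.norm_exp]
  have : (-ζ * τ).re = -(ζ.re * τ) := by simp
  rw [this]
  exact Real.exp_le_one_iff.2 (by nlinarith)

/-- The Laplace transform of `A e^{-(· + ε)A}` is bounded on the right half plane, uniformly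
in `ε`. -/
theorem exists_norm_laplace_le (hK : ExpFamily K) : ∃ C, 0 ≤ C ∧ ∀ ε : ℝ, 0 < ε → ∀ ζ : ℂ,
    0 < ζ.re → ‖∫ τ in Ioi (0 : ℝ), Complex.exp (-ζ * τ) • K 1 (τ + ε)‖ ≤ C := by
  obtain ⟨C₀, hC₀0, hC₀⟩ := hK.bound 0
  obtain ⟨C₁, hC₁0, hC₁⟩ := hK.bound 1
  obtain ⟨C₂, hC₂0, hC₂⟩ := hK.bound 2
  refine ⟨3 * C₀ + (C₁ + C₂), by positivity, fun ε hε ζ hζ => ?_⟩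
  have hζ0 : 0 < ‖ζ‖ := norm_pos_iff.2 fun h => by simp [h] at hζ
  -- Two integrations by parts balance at T = 1/|ζ|. On (0, T) the factor K 1 is integrated, and the
  -- remaining integral costs |ζ| T C₀ = C₀. On (T, ∞) the exponential is integrated, and the tail
  -- of C₂ τ^{-2} gives C₂/T = C₂ |ζ|, which is divided by |ζ|. The real part of ζ is never used
  -- quantitatively.
  set T : ℝ := ‖ζ‖⁻¹ with hT
  have hT0 : 0 < T := inv_pos.2 hζ0
  have hζT : ‖ζ‖ * T = 1 := mul_inv_cancel₀ hζ0.ne'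
  have hint := fun n => hK.integrableOn_cexp_smul n hε hζ
  have hexp : ∀ n : ℕ, ∀ τ : ℝ, 0 ≤ τ → ‖Complex.exp (-ζ * τ) • K n (τ + ε)‖ ≤ ‖K n (τ + ε)‖ :=
    fun n τ hτ => by
      rw [norm_smul]
      exact mul_le_of_le_one_left (norm_nonneg _) (norm_cexp_le_one hζ hτ)
  have hii : ∀ n, IntervalIntegrable (fun τ : ℝ => Complex.exp (-ζ * τ) • K n (τ + ε))
      volume 0 T := fun n =>
    (intervalIntegrable_iff_integrableOn_Ioc_of_le hT0.le).2
      ((hint n).mono_set Ioc_subset_Ioi_self)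
  have hsplit : ∫ τ in Ioi (0 : ℝ), Complex.exp (-ζ * τ) • K 1 (τ + ε) =
      (∫ τ in (0 : ℝ)..T, Complex.exp (-ζ * τ) • K 1 (τ + ε)) +
        ∫ τ in Ioi T, Complex.exp (-ζ * τ) • K 1 (τ + ε) := by
    rw [intervalIntegral.integral_of_le hT0.le, ← setIntegral_union (by
      rw [Set.disjoint_left]; intro x hx hx'; exact absurd hx.2 (not_le.2 hx'))
      measurableSet_Ioi ((hint 1).mono_set Ioc_subset_Ioi_self)
      ((hint 1).mono_set (Ioi_subset_Ioi hT0.le)), Ioc_union_Ioi_eq_Ioi hT0.le]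
  have hA : ‖∫ τ in (0 : ℝ)..T, Complex.exp (-ζ * τ) • K 1 (τ + ε)‖ ≤ 3 * C₀ := by
    have hneg : IntervalIntegrable (fun τ : ℝ => -(ζ • Complex.exp (-ζ * τ) • K 0 (τ + ε)))
        volume 0 T := ((hii 0).smul ζ).neg
    have h := intervalIntegral.integral_eq_sub_of_hasDerivAt (a := 0) (b := T)
      (fun τ hτ => hK.hasDerivAt_cexp_smul 0 (ε := ε) ζ (τ := τ) (by
        rw [uIcc_of_le hT0.le] at hτ; linarith [hτ.1]))
      (hneg.sub (hii 1))
    have h0 : ∫ τ in (0 : ℝ)..T, Complex.exp (-ζ * τ) • K 1 (τ + ε) =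
        K 0 ε - Complex.exp (-ζ * T) • K 0 (T + ε) -
          ζ • ∫ τ in (0 : ℝ)..T, Complex.exp (-ζ * τ) • K 0 (τ + ε) := by
      rw [intervalIntegral.integral_sub hneg (hii 1),
        intervalIntegral.integral_neg, intervalIntegral.integral_smul] at h
      simp only [Complex.ofReal_zero, mul_zero, Complex.exp_zero, one_smul, zero_add] at h ⊢
      rw [sub_eq_iff_eq_add] at h
      rw [sub_sub, eq_sub_iff_add_eq, ← sub_eq_zero]
      rw [neg_eq_iff_eq_neg] at h
      rw [h]
      abel
    have hb : ‖∫ τ in (0 : ℝ)..T, Complex.exp (-ζ * τ) • K 0 (τ + ε)‖ ≤ C₀ * T := by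
      refine (intervalIntegral.norm_integral_le_of_norm_le_const (C := C₀) fun τ hτ => ?_).trans
        (by rw [sub_zero, abs_of_pos hT0])
      rw [uIoc_of_le hT0.le] at hτ
      exact (hexp 0 τ hτ.1.le).trans (by simpa using hC₀ (τ + ε) (by linarith [hτ.1]))
    have h1 : ‖K 0 ε‖ ≤ C₀ := by simpa using hC₀ ε hε
    have h2 : ‖Complex.exp (-ζ * T) • K 0 (T + ε)‖ ≤ C₀ :=
      (hexp 0 T hT0.le).trans (by simpa using hC₀ (T + ε) (by linarith))
    have h3 : ‖ζ • ∫ τ in (0 : ℝ)..T, Complex.exp (-ζ * τ) • K 0 (τ + ε)‖ ≤ C₀ := by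
      rw [norm_smul]
      calc _ ≤ ‖ζ‖ * (C₀ * T) := by gcongr
        _ = C₀ := by linear_combination C₀ * hζT
    rw [h0]
    refine (norm_sub_le _ _).trans ?_
    have := norm_sub_le (K 0 ε) (Complex.exp (-ζ * T) • K 0 (T + ε))
    linarith
  have hB : ‖∫ τ in Ioi T, Complex.exp (-ζ * τ) • K 1 (τ + ε)‖ ≤ C₁ + C₂ := by
    have hI := fun n => (hint n).mono_set (Ioi_subset_Ioi hT0.le)
    have hlim : Tendsto (fun τ : ℝ => Complex.exp (-ζ * τ) • K 1 (τ + ε)) atTop (𝓝 0) := by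
      refine squeeze_zero_norm' (a := fun τ => C₁ / τ) ?_
        ((tendsto_const_nhds (x := C₁)).div_atTop tendsto_id)
      filter_upwards [eventually_gt_atTop 0] with τ hτ
      refine (hexp 1 τ hτ.le).trans ((hC₁ _ (by linarith)).trans ?_)
      rw [pow_one]
      gcongr
      linarith
    have hneg : IntegrableOn (fun τ : ℝ => -(ζ • Complex.exp (-ζ * τ) • K 1 (τ + ε)))
        (Ioi T) := ((hI 1).smul ζ).neg
    have h := integral_Ioi_of_hasDerivAt_of_tendsto' (a := T)
      (fun τ (hτ : T ≤ τ) => hK.hasDerivAt_cexp_smul 1 (ε := ε) ζ (τ := τ) (by linarith))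
      (hneg.sub (hI 2)) hlim
    have h0 : ζ • ∫ τ in Ioi T, Complex.exp (-ζ * τ) • K 1 (τ + ε) =
        Complex.exp (-ζ * T) • K 1 (T + ε) -
          ∫ τ in Ioi T, Complex.exp (-ζ * τ) • K 2 (τ + ε) := by
      have h' := h
      rw [integral_sub hneg (hI 2)] at h'
      rw [integral_neg, integral_smul] at h'
      rw [zero_sub, sub_eq_iff_eq_add, neg_eq_iff_eq_neg] at h'
      rw [h']
      abel
    have hb : ‖∫ τ in Ioi T, Complex.exp (-ζ * τ) • K 2 (τ + ε)‖ ≤ C₂ * ‖ζ‖ := by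
      have hpow : IntegrableOn (fun τ : ℝ => C₂ * τ ^ (-2 : ℝ)) (Ioi T) :=
        (integrableOn_Ioi_rpow_of_lt (by norm_num) hT0).const_mul C₂
      refine (norm_integral_le_of_norm_le hpow ?_).trans (le_of_eq ?_)
      · filter_upwards [ae_restrict_mem measurableSet_Ioi] with τ (hτ : T < τ)
        have hτ0 : 0 < τ := hT0.trans hτ
        refine (hexp 2 τ hτ0.le).trans ((hC₂ _ (by linarith)).trans ?_)
        rw [Real.rpow_neg hτ0.le, ← div_eq_mul_inv]
        norm_cast
        gcongr
        linarith
      · rw [integral_const_mul, integral_Ioi_rpow_of_lt (by norm_num) hT0]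
        norm_num
        rw [Real.rpow_neg_one, hT, inv_inv]
        tauto
    have h1 : ‖Complex.exp (-ζ * T) • K 1 (T + ε)‖ ≤ C₁ * ‖ζ‖ := by
      refine (hexp 1 T hT0.le).trans ((hC₁ _ (by linarith)).trans ?_)
      rw [pow_one]
      calc C₁ / (T + ε) ≤ C₁ / T := by gcongr; linarith
        _ = C₁ * ‖ζ‖ := by rw [hT, div_inv_eq_mul]
    have h2 : ‖ζ‖ * ‖∫ τ in Ioi T, Complex.exp (-ζ * τ) • K 1 (τ + ε)‖ ≤ ‖ζ‖ * (C₁ + C₂) := by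
      rw [← norm_smul, h0]
      refine (norm_sub_le _ _).trans ?_
      linarith
    exact le_of_mul_le_mul_left h2 hζ0
  rw [hsplit]
  exact (norm_add_le _ _).trans (add_le_add hA hB)

/-- The damped and regularised maximal regularity operator is bounded on `L²`, uniformly in the
parameters. -/
theorem exists_eLpNorm_damped_le (hK : ExpFamily K) : ∃ C : NNReal, ∀ ε η : ℝ, 0 < ε → 0 < η →
    ∀ f : ℝ → H, Integrable f → MemLp f 2 volume →
    eLpNorm (fun t => ∫ s in Iio t, Real.exp (-η * (t - s)) • K 1 (t - s + ε) (f s)) 2 volume ≤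
      C * eLpNorm f 2 volume := by
  obtain ⟨C, hC0, hC⟩ := hK.exists_norm_laplace_le
  obtain ⟨C₁, hC₁0, hC₁⟩ := hK.bound 1
  refine ⟨C.toNNReal, fun ε η hε hη f h1 h2 => ?_⟩
  -- The damping makes the kernel integrable. Its Fourier transform at ξ is the Laplace transform at
  -- η + 2πiξ, whose bound depends on neither ε nor η.
  let k : ℝ → H →L[ℂ] H :=
    (Ioi (0 : ℝ)).indicator fun τ => Complex.exp (-(η : ℂ) * τ) • K 1 (τ + ε)
  have hk : Integrable k := (integrable_indicator_iff measurableSet_Ioi).2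
    (hK.integrableOn_cexp_smul 1 hε (by simpa using hη))
  have hB : ∀ x, ‖k x‖ ≤ C₁ / ε := by
    intro x
    by_cases hx : x ∈ Ioi (0 : ℝ)
    · simp only [k, indicator_of_mem hx, norm_smul]
      have hx0 : 0 < x := hx
      refine (mul_le_of_le_one_left (norm_nonneg _)
        (norm_cexp_le_one (by simpa using hη) hx0.le)).trans ((hC₁ _ (by linarith)).trans ?_)
      rw [pow_one]
      gcongr
      linarith
    · simp only [k, indicator_of_notMem hx, norm_zero]
      positivity
  have hF : ∀ ξ, ‖𝓕 k ξ‖ ≤ C := by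
    intro ξ
    have : 𝓕 k ξ = ∫ τ in Ioi (0 : ℝ),
        Complex.exp (-((η : ℂ) + 2 * Real.pi * ξ * Complex.I) * τ) • K 1 (τ + ε) := by
      rw [Real.fourier_real_eq_integral_exp_smul, ← integral_indicator measurableSet_Ioi]
      congr 1
      ext1 τ
      by_cases hτ : τ ∈ Ioi (0 : ℝ)
      · simp only [k, indicator_of_mem hτ, smul_smul, ← Complex.exp_add]
        congr 2
        push_cast
        ring
      · simp only [k, indicator_of_notMem hτ, smul_zero]
    rw [this]
    exact hC ε hε _ (by simpa using hη)
  have h := eLpNorm_convolution_le hk hB hF h1 h2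
  refine le_of_eq_of_le (congrArg (fun g => eLpNorm g 2 volume) ?_) h
  ext1 t
  rw [convolution_eq_swap, ← integral_indicator measurableSet_Iio]
  congr 1
  ext1 s
  by_cases hs : s ∈ Iio t
  · have hs' : t - s ∈ Ioi (0 : ℝ) := by simpa using hs
    simp only [k, indicator_of_mem hs, indicator_of_mem hs', ContinuousLinearMap.id_apply,
      smul_apply]
    rw [← Complex.ofReal_neg, ← Complex.ofReal_mul, ← Complex.ofReal_exp, Complex.coe_smul]
  · have hs' : t - s ∉ Ioi (0 : ℝ) := by simpa using hs
    simp [k, indicator_of_notMem hs, indicator_of_notMem hs']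

end ExpFamily

end

/-! ### Measurability and integrability of operator kernels -/

theorem aestronglyMeasurable_clm_apply {α : Type*} [MeasurableSpace α] {μ : Measure α}
    {Φ : α → H →L[ℂ] H} {f : α → H} (hΦ : AEStronglyMeasurable Φ μ)
    (hf : AEStronglyMeasurable f μ) : AEStronglyMeasurable (fun s => Φ s (f s)) μ :=
  (ContinuousLinearMap.id ℂ (H →L[ℂ] H)).aestronglyMeasurable_comp₂ hΦ hf

theorem hasDerivAt_clm_apply_const {Φ : ℝ → H →L[ℂ] H} {Φ' : H →L[ℂ] H} {t : ℝ}
    (h : HasDerivAt Φ Φ' t) (x : H) : HasDerivAt (fun t => Φ t x) (Φ' x) t :=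
  ((ContinuousLinearMap.apply ℂ H x).restrictScalars ℝ).hasFDerivAt.comp_hasDerivAt t h

theorem integrableOn_clm_apply {U : Set ℝ} (hU : MeasurableSet U) {Φ : ℝ → H →L[ℂ] H}
    (hΦ : ContinuousOn Φ U) {B : ℝ} (hB : ∀ s ∈ U, ‖Φ s‖ ≤ B) {f : ℝ → H}
    (hf : IntegrableOn f U) : IntegrableOn (fun s => Φ s (f s)) U := by
  refine (hf.norm.const_mul B).mono' (aestronglyMeasurable_clm_apply
    (hΦ.aestronglyMeasurable hU) hf.aestronglyMeasurable) ?_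
  filter_upwards [ae_restrict_mem hU] with s hs
  exact ContinuousLinearMap.le_of_opNorm_le _ (hB s hs) _

theorem aestronglyMeasurable_indicator_clm_apply {Φ : ℝ × ℝ → H →L[ℂ] H} {U : Set (ℝ × ℝ)}
    (hU : MeasurableSet U) (hΦ : ContinuousOn Φ U) {f : ℝ → H} {μ ν : Measure ℝ} [SFinite μ]
    [SFinite ν] (hf : AEStronglyMeasurable f ν) :
    AEStronglyMeasurable (U.indicator fun p => Φ p (f p.2)) (μ.prod ν) := by
  rw [aestronglyMeasurable_indicator_iff hU]
  exact aestronglyMeasurable_clm_apply (hΦ.aestronglyMeasurable hU) hf.comp_snd.restrict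

theorem aestronglyMeasurable_integral_indicator {Φ : ℝ × ℝ → H →L[ℂ] H} {U : Set (ℝ × ℝ)}
    (hU : MeasurableSet U) (hΦ : ContinuousOn Φ U) {f : ℝ → H} {μ ν : Measure ℝ} [SFinite μ]
    [SFinite ν] (hf : AEStronglyMeasurable f ν) :
    AEStronglyMeasurable (fun t => ∫ s, U.indicator (fun p => Φ p (f p.2)) (t, s) ∂ν) μ :=
  (aestronglyMeasurable_indicator_clm_apply hU hΦ hf).integral_prod_right'

theorem tendsto_eLpNorm_two_of_dominated {α ι E : Type*} [MeasurableSpace α] {μ : Measure α}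
    [NormedAddCommGroup E] {l : Filter ι} [l.IsCountablyGenerated] {F : ι → α → E}
    (hF : ∀ᶠ i in l, AEStronglyMeasurable (F i) μ) {g : α → ℝ} (hg : MemLp g 2 μ)
    (hb : ∀ᶠ i in l, ∀ᵐ x ∂μ, ‖F i x‖ ≤ g x)
    (hlim : ∀ᵐ x ∂μ, Tendsto (fun i => F i x) l (𝓝 0)) :
    Tendsto (fun i => eLpNorm (F i) 2 μ) l (𝓝 0) := by
  have h1 : Tendsto (fun i => ∫ x, ‖F i x‖ ^ (2 : ℝ) ∂μ) l (𝓝 (∫ _, (0 : ℝ) ∂μ)) := by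
    refine tendsto_integral_filter_of_dominated_convergence (fun x => ‖g x‖ ^ (2 : ℝ)) ?_ ?_ ?_ ?_
    · exact hF.mono fun i hi => (hi.norm.aemeasurable.pow_const (2 : ℝ)).aestronglyMeasurable
    · filter_upwards [hb] with i hi
      filter_upwards [hi] with x hx
      rw [Real.norm_of_nonneg (by positivity)]
      gcongr
      exact hx.trans (Real.le_norm_self _)
    · simpa using hg.integrable_norm_rpow two_ne_zero ENNReal.ofNat_ne_top
    · filter_upwards [hlim] with x hx
      have := (Real.continuous_rpow_const (q := 2) (by norm_num)).tendsto _ |>.comp hx.norm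
      rw [norm_zero, Real.zero_rpow (by norm_num)] at this
      exact this
  rw [integral_zero] at h1
  have h2 := (ENNReal.continuous_ofReal.comp
    (Real.continuous_rpow_const (q := 2⁻¹) (by norm_num))).tendsto _ |>.comp h1
  rw [Function.comp_apply, Real.zero_rpow (by norm_num), ENNReal.ofReal_zero] at h2
  refine h2.congr' ?_
  filter_upwards [hF, hb] with i hi hbi
  have hm : MemLp (F i) 2 μ := hg.mono' hi hbi
  rw [hm.eLpNorm_eq_integral_rpow_norm two_ne_zero ENNReal.ofNat_ne_top]
  simp [Function.comp_def]

/-! ### De Simon's theorem: regularised operators, mild solution, pointwise limits -/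

namespace ExpFamily

variable {K : ℕ → ℝ → H →L[ℂ] H}

theorem integrableOn_shift (hK : ExpFamily K) (n : ℕ) {e : ℝ} (he : 0 < e) {f : ℝ → H} {t : ℝ}
    (hf : IntegrableOn f (Iio t)) : IntegrableOn (fun s => K n (t - s + e) (f s)) (Iio t) := by
  obtain ⟨C, hC0, hC⟩ := hK.bound n
  refine integrableOn_clm_apply (Φ := fun s => K n (t - s + e)) (B := C / e ^ n)
    measurableSet_Iio ?_ ?_ hf
  · exact (hK.continuousOn n).comp (by fun_prop) fun s (hs : s < t) => by simp; linarith
  · intro s (hs : s < t)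
    refine (hC _ (by linarith)).trans ?_
    gcongr
    linarith

theorem integrableOn_mild (hK : ExpFamily K) {f : ℝ → H} {t : ℝ}
    (hf : IntegrableOn f (Iio t)) : IntegrableOn (fun s => K 0 (t - s) (f s)) (Iio t) := by
  obtain ⟨C, hC0, hC⟩ := hK.bound 0
  refine integrableOn_clm_apply (Φ := fun s => K 0 (t - s)) (B := C) measurableSet_Iio ?_ ?_ hf
  · exact (hK.continuousOn 0).comp (by fun_prop) fun s (hs : s < t) => by simpa using hs
  · intro s (hs : s < t)
    simpa using hC (t - s) (by linarith)

theorem continuousOn_shift_prod (hK : ExpFamily K) (n : ℕ) {c e : ℝ} {U : Set (ℝ × ℝ)}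
    (hU : ∀ p ∈ U, 0 < c * p.1 - p.2 + e) :
    ContinuousOn (fun p : ℝ × ℝ => K n (c * p.1 - p.2 + e)) U :=
  (hK.continuousOn n).comp (Continuous.continuousOn (by fun_prop)) hU

/-- Fubini's theorem for `∫ₜ ∫_{σ < t} A e^{-(ct - σ + e)A} f(σ)`. -/
theorem integral_integral_shift (hK : ExpFamily K) {c e r T : ℝ} (hc : 1 ≤ c)
    (hd : 0 < (c - 1) * r + e) (hrT : r ≤ T) {f : ℝ → H} (hf : Integrable f) :
    ∫ t in Ioc r T, ∫ σ in Iio t, K 1 (c * t - σ + e) (f σ) =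
      c⁻¹ • ((∫ σ in Iio T, K 0 (c * max r σ - σ + e) (f σ)) -
        ∫ σ in Iio T, K 0 (c * T - σ + e) (f σ)) := by
  obtain ⟨C₀, hC₀0, hC₀⟩ := hK.bound 0
  obtain ⟨C₁, hC₁0, hC₁⟩ := hK.bound 1
  -- The argument is (c-1) t + (t-σ) + e, so the kernel is bounded on the region of integration. For
  -- c = 1 this positivity comes from e, for e = 0 from c > 1 and r > 0; both regimes are used
  -- below.
  have hpos : ∀ t σ, r ≤ t → σ ≤ t → (c - 1) * r + e ≤ c * t - σ + e := by
    intro t σ h1 h2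
    nlinarith
  let U : Set (ℝ × ℝ) := {p | r < p.1 ∧ p.2 < p.1}
  have hU : MeasurableSet U :=
    (measurableSet_lt measurable_const measurable_fst).inter
      (measurableSet_lt measurable_snd measurable_fst)
  let Φ : ℝ × ℝ → H := U.indicator fun p => K 1 (c * p.1 - p.2 + e) (f p.2)
  have hΦm : AEStronglyMeasurable Φ ((volume.restrict (Ioc r T)).prod volume) :=
    aestronglyMeasurable_indicator_clm_apply hU (hK.continuousOn_shift_prod 1
      fun p hp => hd.trans_le (hpos _ _ hp.1.le hp.2.le)) hf.aestronglyMeasurable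
  have hΦi : Integrable Φ ((volume.restrict (Ioc r T)).prod volume) := by
    have hdom : Integrable (fun p : ℝ × ℝ => (1 : ℝ) * (C₁ / ((c - 1) * r + e) * ‖f p.2‖))
        ((volume.restrict (Ioc r T)).prod volume) :=
      (integrable_const (1 : ℝ)).mul_prod (hf.norm.const_mul _)
    refine hdom.mono' hΦm (ae_of_all _ fun p => ?_)
    by_cases hp : p ∈ U
    · simp only [Φ, indicator_of_mem hp, one_mul]
      have := hpos _ _ hp.1.le hp.2.le
      refine ContinuousLinearMap.le_of_opNorm_le _ ((hC₁ _ (hd.trans_le this)).trans ?_) _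
      rw [pow_one]
      gcongr
    · simp only [Φ, indicator_of_notMem hp, norm_zero]
      positivity
  have h1 : ∫ t in Ioc r T, ∫ σ in Iio t, K 1 (c * t - σ + e) (f σ) =
      ∫ t in Ioc r T, ∫ σ, Φ (t, σ) := by
    refine setIntegral_congr_fun measurableSet_Ioc fun t ht => ?_
    rw [← integral_indicator measurableSet_Iio]
    congr 1
    ext1 σ
    simp only [Φ, U, indicator_apply, mem_Iio, mem_ofPred_eq, ht.1, true_and]
  rw [h1, integral_integral_swap (f := fun t σ => Φ (t, σ)) hΦi]
  -- For fixed σ the variable t runs over (max r σ, T], where the kernel is the derivative of -c⁻¹ K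
  -- 0 (c t - σ + e).
  have h2 : ∀ σ, ∫ t in Ioc r T, Φ (t, σ) = (Iio T).indicator (fun σ =>
      c⁻¹ • (K 0 (c * max r σ - σ + e) (f σ) - K 0 (c * T - σ + e) (f σ))) σ := by
    intro σ
    have h3 : ∫ t in Ioc r T, Φ (t, σ) =
        ∫ t in Ioc (max r σ) T, K 1 (c * t - σ + e) (f σ) := by
      rw [← integral_indicator measurableSet_Ioc, ← integral_indicator measurableSet_Ioc]
      congr 1
      ext1 t
      simp only [Φ, U, indicator_apply, mem_Ioc, mem_ofPred_eq, max_lt_iff]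
      split_ifs <;> first | rfl | (exfalso; tauto)
    rw [h3]
    by_cases hσ : σ ∈ Iio T
    · rw [indicator_of_mem hσ]
      have hmT : max r σ ≤ T := max_le hrT (le_of_lt hσ)
      have hd1 : ∀ t ∈ uIcc (max r σ) T, HasDerivAt (fun t => K 0 (c * t - σ + e) (f σ))
          (-(c • K 1 (c * t - σ + e) (f σ))) t := by
        intro t ht
        rw [uIcc_of_le hmT] at ht
        have hp := hd.trans_le (hpos t σ ((le_max_left _ _).trans ht.1)
          ((le_max_right _ _).trans ht.1))
        have ha : HasDerivAt (fun t : ℝ => c * t - σ + e) c t := by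
          simpa using (((hasDerivAt_id t).const_mul c).sub_const σ).add_const e
        have hb := ((hK.deriv 0 _ hp).scomp t ha)
        simpa using hasDerivAt_clm_apply_const hb (f σ)
      have hcont : ContinuousOn (fun t => K 1 (c * t - σ + e) (f σ)) (uIcc (max r σ) T) := by
        refine ContinuousOn.clm_apply ((hK.continuousOn 1).comp
          (Continuous.continuousOn (by fun_prop)) ?_) continuousOn_const
        intro t ht
        rw [uIcc_of_le hmT] at ht
        exact hd.trans_le (hpos t σ ((le_max_left _ _).trans ht.1)
          ((le_max_right _ _).trans ht.1))
      have h4 := intervalIntegral.integral_eq_sub_of_hasDerivAt hd1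
        ((hcont.const_smul c).neg.intervalIntegrable)
      rw [intervalIntegral.integral_neg, intervalIntegral.integral_smul,
        intervalIntegral.integral_of_le hmT] at h4
      rw [neg_eq_iff_eq_neg, neg_sub] at h4
      rw [← h4, smul_smul, inv_mul_cancel₀ (by linarith), one_smul]
    · rw [indicator_of_notMem hσ, Ioc_eq_empty, Measure.restrict_empty, integral_zero_measure]
      exact not_lt.2 ((not_lt.1 hσ).trans (le_max_right _ _))
  simp only [h2]
  rw [integral_indicator measurableSet_Iio, integral_smul, integral_sub]
  · refine integrableOn_clm_apply (Φ := fun σ => K 0 (c * max r σ - σ + e)) measurableSet_Iio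
      (B := C₀) ?_ ?_ hf.integrableOn
    · exact (hK.continuousOn 0).comp (Continuous.continuousOn (by fun_prop))
        fun σ _ => hd.trans_le (hpos _ σ (le_max_left _ _) (le_max_right _ _))
    · intro σ _
      simpa using hC₀ _ (hd.trans_le (hpos _ σ (le_max_left r σ) (le_max_right _ _)))
  · refine integrableOn_clm_apply (Φ := fun σ => K 0 (c * T - σ + e)) measurableSet_Iio
      (B := C₀) ?_ ?_ hf.integrableOn
    · exact (hK.continuousOn 0).comp (Continuous.continuousOn (by fun_prop))
        fun σ hσ => hd.trans_le (hpos _ σ hrT (le_of_lt hσ))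
    · intro σ hσ
      simpa using hC₀ _ (hd.trans_le (hpos _ σ hrT (le_of_lt hσ)))

/-- The regularised maximal regularity operator `∫_{-∞}^t A e^{-(t - s + ε)A} f(s) ds`. -/
noncomputable def reg (K : ℕ → ℝ → H →L[ℂ] H) (ε : ℝ) (f : ℝ → H) (t : ℝ) : H :=
  ∫ s in Iio t, K 1 (t - s + ε) (f s)

/-- The mild solution `∫_{-∞}^t e^{-(t - s)A} f(s) ds`. -/
noncomputable def mild (K : ℕ → ℝ → H →L[ℂ] H) (f : ℝ → H) (t : ℝ) : H :=
  ∫ s in Iio t, K 0 (t - s) (f s)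

theorem aestronglyMeasurable_reg (hK : ExpFamily K) {ε : ℝ} (hε : 0 < ε) {f : ℝ → H}
    (hf : AEStronglyMeasurable f volume) : AEStronglyMeasurable (reg K ε f) volume := by
  have hU : MeasurableSet {p : ℝ × ℝ | p.2 < p.1} := measurableSet_lt measurable_snd measurable_fst
  have h := aestronglyMeasurable_integral_indicator (μ := volume) hU
    (hK.continuousOn_shift_prod 1 (c := 1) (e := ε) (U := {p : ℝ × ℝ | p.2 < p.1})
      fun p (hp : p.2 < p.1) => by linarith) hf
  refine h.congr (ae_of_all _ fun t => ?_)
  simp only [reg]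
  rw [← integral_indicator measurableSet_Iio]
  congr 1
  ext1 s
  simp [indicator_apply]

/-- The regularised maximal regularity operators are uniformly bounded on `L²`. -/
theorem exists_eLpNorm_reg_le (hK : ExpFamily K) : ∃ C : NNReal, ∀ ε : ℝ, 0 < ε →
    ∀ f : ℝ → H, Integrable f → MemLp f 2 volume →
    eLpNorm (reg K ε f) 2 volume ≤ C * eLpNorm f 2 volume := by
  obtain ⟨C, hC⟩ := hK.exists_eLpNorm_damped_le
  refine ⟨C, fun ε hε f h1 h2 => ?_⟩
  -- The damping is removed pointwise by dominated convergence, and Fatou's lemma in L² preserves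
  -- the uniform bound.
  let η : ℕ → ℝ := fun n => 1 / ((n : ℝ) + 1)
  have hη : ∀ n, 0 < η n := fun n => by positivity
  have hη0 : Tendsto η atTop (𝓝 0) := tendsto_one_div_add_atTop_nhds_zero_nat
  let F : ℕ → ℝ → H := fun n t =>
    ∫ s in Iio t, Real.exp (-η n * (t - s)) • K 1 (t - s + ε) (f s)
  have hFm : ∀ n, AEStronglyMeasurable (F n) volume := by
    intro n
    have hU : MeasurableSet {p : ℝ × ℝ | p.2 < p.1} :=
      measurableSet_lt measurable_snd measurable_fst
    have hce : Continuous fun p : ℝ × ℝ => Real.exp (-η n * (p.1 - p.2)) := by fun_prop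
    have h := aestronglyMeasurable_integral_indicator (μ := volume) hU
      (Φ := fun p => Real.exp (-η n * (p.1 - p.2)) • K 1 (1 * p.1 - p.2 + ε))
      (ContinuousOn.smul hce.continuousOn
        (hK.continuousOn_shift_prod 1 (c := 1) (e := ε) (U := {p : ℝ × ℝ | p.2 < p.1})
        fun p (hp : p.2 < p.1) => by linarith)) h1.aestronglyMeasurable
    refine h.congr (ae_of_all _ fun t => ?_)
    simp only [F]
    rw [← integral_indicator measurableSet_Iio]
    congr 1
    ext1 s
    simp [indicator_apply]
  have hlim : ∀ t, Tendsto (fun n => F n t) atTop (𝓝 (reg K ε f t)) := by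
    intro t
    have hi := hK.integrableOn_shift 1 hε (h1.integrableOn (s := Iio t))
    refine tendsto_integral_of_dominated_convergence (fun s => ‖K 1 (t - s + ε) (f s)‖) ?_
      hi.norm ?_ ?_
    · intro n
      have hce : Continuous fun s : ℝ => Real.exp (-η n * (t - s)) := by fun_prop
      exact hce.aestronglyMeasurable.smul hi.1
    · intro n
      filter_upwards [ae_restrict_mem measurableSet_Iio] with s (hs : s < t)
      rw [norm_smul, Real.norm_of_nonneg (Real.exp_pos _).le]
      refine mul_le_of_le_one_left (norm_nonneg _) (Real.exp_le_one_iff.2 ?_)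
      nlinarith [hη n]
    · refine ae_of_all _ fun s => ?_
      have h3 : Tendsto (fun n => Real.exp (-η n * (t - s))) atTop (𝓝 1) := by
        have := (Real.continuous_exp.tendsto _).comp ((hη0.neg).mul_const (t - s))
        simpa [Function.comp_def] using this
      simpa using h3.smul_const (K 1 (t - s + ε) (f s))
  refine (Lp.eLpNorm_lim_le_liminf_eLpNorm hFm _ (ae_of_all _ hlim)).trans ?_
  refine (liminf_le_liminf (Eventually.of_forall fun n => hC ε (η n) hε (hη n) f h1 h2)).trans ?_
  simp

theorem memLp_reg (hK : ExpFamily K) {ε : ℝ} (hε : 0 < ε) {f : ℝ → H} (h1 : Integrable f)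
    (h2 : MemLp f 2 volume) : MemLp (reg K ε f) 2 volume := by
  obtain ⟨C, hC⟩ := hK.exists_eLpNorm_reg_le
  exact ⟨hK.aestronglyMeasurable_reg hε h1.aestronglyMeasurable,
    (hC ε hε f h1 h2).trans_lt (ENNReal.mul_lt_top ENNReal.coe_lt_top h2.2)⟩

theorem norm_zero_apply_le (hK : ExpFamily K) : ∃ C, 0 ≤ C ∧ ∀ t x, 0 < t →
    ‖K 0 t x‖ ≤ C * ‖x‖ := by
  obtain ⟨C, hC0, hC⟩ := hK.bound 0
  exact ⟨C, hC0, fun t x ht =>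
    ContinuousLinearMap.le_of_opNorm_le _ (by simpa using hC t ht) _⟩

theorem memLp_sub_clm_apply (T : H →L[ℂ] H) {f : ℝ → H} {p : ENNReal}
    (hf : MemLp f p volume) : MemLp (fun s => f s - T (f s)) p volume :=
  hf.sub (T.comp_memLp' hf)

/-- Since K 1 (t-s+ε') = K 1 (t-s+ε) K 0 (ε'-ε), a change of the regularisation is a change of the
datum. With the uniform bound this makes the regularised operators Cauchy as ε → 0. -/
theorem reg_sub_reg (hK : ExpFamily K) {ε ε' : ℝ} (hε : 0 < ε) (hεε' : ε < ε') {f : ℝ → H}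
    (hf : Integrable f) (t : ℝ) :
    reg K ε f t - reg K ε' f t = reg K ε (fun s => f s - K 0 (ε' - ε) (f s)) t := by
  unfold reg
  rw [← integral_sub (hK.integrableOn_shift 1 hε hf.integrableOn)
    (hK.integrableOn_shift 1 (hε.trans hεε') hf.integrableOn)]
  refine setIntegral_congr_fun measurableSet_Iio fun s (hs : s < t) => ?_
  rw [map_sub, hK.mul_apply 1 0 (by linarith) (by linarith)]
  congr 3
  ring

theorem tendsto_eLpNorm_sub_zero_apply (hK : ExpFamily K) {f : ℝ → H} (hf : MemLp f 2 volume) :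
    Tendsto (fun δ => eLpNorm (fun s => f s - K 0 δ (f s)) 2 volume) (𝓝[>] 0) (𝓝 0) := by
  obtain ⟨C, hC0, hC⟩ := hK.norm_zero_apply_le
  refine tendsto_eLpNorm_two_of_dominated (g := fun s => (1 + C) * ‖f s‖) ?_
    (hf.norm.const_mul _) ?_ ?_
  · filter_upwards [self_mem_nhdsWithin] with δ hδ
    exact (memLp_sub_clm_apply _ hf).1
  · filter_upwards [self_mem_nhdsWithin] with δ hδ
    refine ae_of_all _ fun s => (norm_sub_le _ _).trans ?_
    linarith [hC δ (f s) hδ]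
  · refine ae_of_all _ fun s => ?_
    simpa using (tendsto_const_nhds (x := f s)).sub (hK.tendsto_zero (f s))

/-- The regularised operators converge in `L²`. -/
theorem exists_tendsto_reg (hK : ExpFamily K) {C : NNReal} (hC : ∀ ε : ℝ, 0 < ε →
    ∀ f : ℝ → H, Integrable f → MemLp f 2 volume →
    eLpNorm (reg K ε f) 2 volume ≤ C * eLpNorm f 2 volume) {f : ℝ → H} (h1 : Integrable f)
    (h2 : MemLp f 2 volume) : ∃ G : ℝ → H, MemLp G 2 volume ∧
      eLpNorm G 2 volume ≤ C * eLpNorm f 2 volume ∧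
      Tendsto (fun n : ℕ => eLpNorm (reg K (1 / ((n : ℝ) + 1)) f - G) 2 volume) atTop (𝓝 0) := by
  set η : ℕ → ℝ := fun n => 1 / ((n : ℝ) + 1) with hηdef
  have hη : ∀ n, 0 < η n := fun n => by positivity
  have hη0 : Tendsto η atTop (𝓝 0) := tendsto_one_div_add_atTop_nhds_zero_nat
  have hm : ∀ n, MemLp (reg K (η n) f) 2 volume := fun n => hK.memLp_reg (hη n) h1 h2
  let F : ℕ → Lp H 2 (volume : Measure ℝ) := fun n => (hm n).toLp
  have hcau : CauchySeq F := by
    rw [Lp.cauchySeq_Lp_iff_cauchySeq_eLpNorm, ENNReal.tendsto_nhds_zero]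
    intro e he
    have hω : Tendsto (fun δ => C * eLpNorm (fun s => f s - K 0 δ (f s)) 2 volume) (𝓝[>] 0)
        (𝓝 0) := by
      simpa using ENNReal.Tendsto.const_mul (hK.tendsto_eLpNorm_sub_zero_apply h2)
        (Or.inr ENNReal.coe_ne_top)
    obtain ⟨d, hd, hdω⟩ := mem_nhdsGT_iff_exists_Ioo_subset.1
      (ENNReal.tendsto_nhds_zero.1 hω e he)
    have hd0 : (0 : ℝ) < d := hd
    have key : ∀ n m, η n < η m → η m < d →
        eLpNorm (reg K (η n) f - reg K (η m) f) 2 volume ≤ e := by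
      intro n m hnm hmd
      have : reg K (η n) f - reg K (η m) f =
          reg K (η n) (fun s => f s - K 0 (η m - η n) (f s)) :=
        funext fun t => hK.reg_sub_reg (hη n) hnm h1 t
      rw [this]
      have hδ : 0 < η m - η n := by linarith
      refine (hC _ (hη n) _ (memLp_one_iff_integrable.1
        (memLp_sub_clm_apply _ (memLp_one_iff_integrable.2 h1)))
        (memLp_sub_clm_apply _ h2)).trans ?_
      exact hdω ⟨hδ, by linarith [hη n]⟩
    have hsmall := (hη0.eventually (gt_mem_nhds hd0))
    have hsm2 := (tendsto_fst (f := (atTop : Filter ℕ)) (g := (atTop : Filter ℕ))).eventually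
      hsmall |>.and ((tendsto_snd (f := (atTop : Filter ℕ)) (g := (atTop : Filter ℕ))).eventually
      hsmall)
    rw [prod_atTop_atTop_eq] at hsm2
    filter_upwards [hsm2] with ⟨n, m⟩ ⟨hn, hm'⟩
    have hcong : eLpNorm (⇑(F n) - ⇑(F m)) 2 volume =
        eLpNorm (reg K (η n) f - reg K (η m) f) 2 volume :=
      eLpNorm_congr_ae ((hm n).coeFn_toLp.sub (hm m).coeFn_toLp)
    simp only
    rw [hcong]
    rcases lt_trichotomy (η n) (η m) with h | h | h
    · exact key n m h hm'
    · rw [h, sub_self]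
      simp
    · rw [eLpNorm_sub_comm]
      exact key m n h hn
  obtain ⟨G, hG⟩ := cauchySeq_tendsto_of_complete hcau
  rw [Lp.tendsto_Lp_iff_tendsto_eLpNorm'] at hG
  have hG' : Tendsto (fun n : ℕ => eLpNorm (reg K (η n) f - (G : ℝ → H)) 2 volume) atTop
      (𝓝 0) := by
    refine hG.congr fun n => eLpNorm_congr_ae ((hm n).coeFn_toLp.sub (ae_eq_refl _))
  refine ⟨G, Lp.memLp G, ?_, hG'⟩
  have hle : ∀ n, eLpNorm G 2 volume ≤ C * eLpNorm f 2 volume +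
      eLpNorm (reg K (η n) f - (G : ℝ → H)) 2 volume := by
    intro n
    have : (G : ℝ → H) = reg K (η n) f - (reg K (η n) f - (G : ℝ → H)) := by simp
    calc eLpNorm G 2 volume ≤ eLpNorm (reg K (η n) f) 2 volume +
          eLpNorm (reg K (η n) f - (G : ℝ → H)) 2 volume := by
          nth_rewrite 1 [this]
          exact eLpNorm_sub_le (hm n).1 ((hm n).1.sub (Lp.memLp G).1) (by norm_num)
      _ ≤ _ := by gcongr; exact hC _ (hη n) _ h1 h2
  have h3 := (tendsto_const_nhds (x := C * eLpNorm f 2 volume)).add hG'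
  rw [add_zero] at h3
  exact ge_of_tendsto' h3 hle

/-- For n = 1 this identifies the regularised operator with A e^{-εA} applied to the mild solution.
-/
theorem shift_apply_mild (hK : ExpFamily K) (n : ℕ) {ε : ℝ} (hε : 0 < ε) {f : ℝ → H}
    (hf : Integrable f) (t : ℝ) :
    K n ε (mild K f t) = ∫ s in Iio t, K n (t - s + ε) (f s) := by
  rw [mild, ← (K n ε).integral_comp_comm (hK.integrableOn_mild hf.integrableOn)]
  refine setIntegral_congr_fun measurableSet_Iio fun s (hs : s < t) => ?_
  rw [hK.mul_apply n 0 hε (by linarith), add_zero, add_comm]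

/-- This is the equation u' = f - A u smoothed by e^{-εA} and integrated. Fubini's theorem leaves
the kernel K 0 (max r σ - σ + ε): for σ ≤ r it rebuilds the term with u(r), for σ in (r, T] it is
constant and gives the integral of e^{-εA} f. -/
theorem apply_mild_sub (hK : ExpFamily K) {ε : ℝ} (hε : 0 < ε) {f : ℝ → H}
    (hf : Integrable f) {r T : ℝ} (hrT : r ≤ T) :
    K 0 ε (mild K f T) - K 0 ε (mild K f r) =
      (∫ s in Ioc r T, K 0 ε (f s)) - ∫ s in Ioc r T, reg K ε f s := by
  have h := hK.integral_integral_shift (c := 1) (e := ε) (r := r) (T := T) le_rfl (by simpa) hrT hf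
  simp only [one_mul, inv_one, one_smul] at h
  have h2 : ∫ s in Ioc r T, reg K ε f s =
      (∫ σ in Iio T, K 0 (max r σ - σ + ε) (f σ)) - K 0 ε (mild K f T) := by
    rw [hK.shift_apply_mild 0 hε hf]
    exact h
  obtain ⟨C₀, hC₀0, hC₀⟩ := hK.bound 0
  have hi : Integrable (fun σ => K 0 (max r σ - σ + ε) (f σ)) := by
    rw [← integrableOn_univ]
    have hp : ∀ σ, 0 < max r σ - σ + ε := fun σ => by linarith [le_max_right r σ]
    refine integrableOn_clm_apply (Φ := fun σ => K 0 (max r σ - σ + ε)) (B := C₀)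
      MeasurableSet.univ ?_ ?_ hf.integrableOn
    · exact (hK.continuousOn 0).comp (Continuous.continuousOn (by fun_prop)) fun σ _ => hp σ
    · intro σ _
      simpa using hC₀ _ (hp σ)
  have h3 : ∫ σ in Iio T, K 0 (max r σ - σ + ε) (f σ) =
      K 0 ε (mild K f r) + ∫ s in Ioc r T, K 0 ε (f s) := by
    rw [hK.shift_apply_mild 0 hε hf, ← integral_Iic_eq_integral_Iio,
      ← integral_Iic_eq_integral_Iio, ← Iic_union_Ioc_eq_Iic hrT,
      setIntegral_union (Iic_disjoint_Ioc le_rfl) measurableSet_Ioc hi.integrableOn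
      hi.integrableOn]
    congr 1
    · refine setIntegral_congr_fun measurableSet_Iic fun σ (hσ : σ ≤ r) => ?_
      simp only [max_eq_left hσ]
    · refine setIntegral_congr_fun measurableSet_Ioc fun σ hσ => ?_
      simp only [max_eq_right hσ.1.le, sub_self, zero_add]
  rw [h2, h3]
  abel

/-- The mild solution is an indefinite integral of `f - G`, with `G = A u` the maximal
regularity term. -/
theorem mild_sub_mild (hK : ExpFamily K) {f G : ℝ → H} (h1 : Integrable f)
    (h2 : MemLp f 2 volume) (hG : MemLp G 2 volume)
    (hlim : Tendsto (fun n : ℕ => eLpNorm (reg K (1 / ((n : ℝ) + 1)) f - G) 2 volume) atTop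
      (𝓝 0)) {r T : ℝ} (hrT : r ≤ T) :
    mild K f T - mild K f r = ∫ s in Ioc r T, (f s - G s) := by
  set η : ℕ → ℝ := fun n => 1 / ((n : ℝ) + 1) with hηdef
  have hη : ∀ n, 0 < η n := fun n => by positivity
  have hη0 : Tendsto η atTop (𝓝[>] 0) := tendsto_nhdsWithin_iff.2
    ⟨tendsto_one_div_add_atTop_nhds_zero_nat, Eventually.of_forall hη⟩
  have hm : ∀ n, MemLp (reg K (η n) f) 2 volume := fun n => hK.memLp_reg (hη n) h1 h2
  have hloc : ∀ {g : ℝ → H}, MemLp g 2 volume → IntegrableOn g (Ioc r T) := fun hg =>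
    (hg.restrict (Ioc r T)).integrable (by norm_num)
  have e1 : Tendsto (fun n => K 0 (η n) (mild K f T) - K 0 (η n) (mild K f r)) atTop
      (𝓝 (mild K f T - mild K f r)) :=
    ((hK.tendsto_zero _).comp hη0).sub ((hK.tendsto_zero _).comp hη0)
  obtain ⟨C, hC0, hC⟩ := hK.norm_zero_apply_le
  have e2 : Tendsto (fun n => ∫ s in Ioc r T, K 0 (η n) (f s)) atTop
      (𝓝 (∫ s in Ioc r T, f s)) := by
    refine tendsto_integral_of_dominated_convergence (fun s => C * ‖f s‖) ?_
      (h1.integrableOn.norm.const_mul C) ?_ ?_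
    · exact fun n => ((K 0 (η n)).integrable_comp h1.integrableOn).1
    · exact fun n => ae_of_all _ fun s => hC _ _ (hη n)
    · exact ae_of_all _ fun s => (hK.tendsto_zero _).comp hη0
  have e3 : Tendsto (fun n => ∫ s in Ioc r T, reg K (η n) f s) atTop
      (𝓝 (∫ s in Ioc r T, G s)) := by
    refine tendsto_integral_of_L1' _ (hloc hG).1 (Eventually.of_forall fun n => hloc (hm n)) ?_
    have hb : ∀ n, eLpNorm (reg K (η n) f - G) 1 (volume.restrict (Ioc r T)) ≤
        eLpNorm (reg K (η n) f - G) 2 volume *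
          (volume.restrict (Ioc r T)) univ ^ (1 / (2 : ℝ)) := by
      intro n
      have := eLpNorm_le_eLpNorm_mul_rpow_measure_univ (μ := volume.restrict (Ioc r T))
        (p := 1) (q := 2) (by norm_num) (((hm n).sub hG).1.restrict)
      refine this.trans ?_
      have h5 : 1 / (1 : ENNReal).toReal - 1 / (2 : ENNReal).toReal = 1 / (2 : ℝ) := by norm_num
      rw [h5]
      gcongr
      exact Measure.restrict_le_self
    refine tendsto_of_tendsto_of_tendsto_of_le_of_le tendsto_const_nhds ?_ (fun n => bot_le) hb
    have := ENNReal.Tendsto.mul_const (b := (volume.restrict (Ioc r T)) univ ^ (1 / (2 : ℝ)))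
      hlim (Or.inr (by simp))
    simpa only [zero_mul] using this
  rw [integral_sub h1.integrableOn (hloc hG)]
  refine tendsto_nhds_unique e1 ((e2.sub e3).congr fun n => ?_)
  exact (hK.apply_mild_sub (hη n) h1 hrT).symm

/-- The operators ε K 1 ε are uniformly bounded, and on a vector K 0 τ x they give ε K 1 (ε+τ) x =
O(ε). Such vectors approximate x. -/
theorem smul_one_apply_tendsto_zero (hK : ExpFamily K) (x : H) :
    Tendsto (fun ε : ℝ => ε • K 1 ε x) (𝓝[>] 0) (𝓝 0) := by
  obtain ⟨C, hC0, hC⟩ := hK.bound 1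
  rw [Metric.tendsto_nhds]
  intro e he
  have h1 := Metric.tendsto_nhds.1 (hK.tendsto_zero x) (e / (2 * (C + 1))) (by positivity)
  obtain ⟨τ, hτ, hτ0⟩ := (h1.and self_mem_nhdsWithin).exists
  have hτ0 : 0 < τ := hτ0
  have h2 : Tendsto (fun ε : ℝ => ε * (C / τ * ‖x‖)) (𝓝[>] 0) (𝓝 0) :=
    (Continuous.tendsto' (by fun_prop) 0 0 (by simp)).mono_left nhdsWithin_le_nhds
  filter_upwards [h2.eventually (gt_mem_nhds (half_pos he)), self_mem_nhdsWithin] with ε h3 hε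
  have hε : 0 < ε := hε
  have h4 : ε • K 1 ε x = ε • K 1 ε (x - K 0 τ x) + ε • K 1 (ε + τ) x := by
    rw [map_sub, hK.mul_apply 1 0 hε hτ0, ← smul_add, sub_add_cancel]
  have h5 : ‖ε • K 1 (ε + τ) x‖ ≤ ε * (C / τ * ‖x‖) := by
    rw [norm_smul, Real.norm_of_nonneg hε.le]
    gcongr
    refine ContinuousLinearMap.le_of_opNorm_le _ ((hC _ (by linarith)).trans ?_) _
    rw [pow_one]
    gcongr
    linarith
  have h6 : ‖ε • K 1 ε (x - K 0 τ x)‖ ≤ C * (e / (2 * (C + 1))) := by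
    rw [norm_smul, Real.norm_of_nonneg hε.le]
    rw [dist_comm, dist_eq_norm] at hτ
    calc ε * ‖K 1 ε (x - K 0 τ x)‖ ≤ ε * (C / ε ^ 1 * ‖x - K 0 τ x‖) := by
          gcongr
          exact ContinuousLinearMap.le_of_opNorm_le _ (hC ε hε) _
      _ = C * ‖x - K 0 τ x‖ := by field_simp
      _ ≤ _ := by gcongr
  have h7 : C * (e / (2 * (C + 1))) ≤ e / 2 := by
    rw [mul_div_assoc', div_le_iff₀ (by positivity)]
    nlinarith
  rw [dist_zero_right, h4]
  exact (norm_add_le _ _).trans_lt (by linarith)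

/-- De Simon's theorem for `f ∈ L¹ ∩ L²`, with convergence almost everywhere of the truncated
singular integrals. -/
theorem exists_maximalRegularity_of_integrable (hK : ExpFamily K) : ∃ C : NNReal,
    ∀ f : ℝ → H, Integrable f → MemLp f 2 volume → ∃ G : ℝ → H, MemLp G 2 volume ∧
      eLpNorm G 2 volume ≤ C * eLpNorm f 2 volume ∧
      ∀ᵐ t, Tendsto (fun ε => ∫ s in Iio (t - ε), K 1 (t - s) (f s)) (𝓝[>] 0) (𝓝 (G t)) := by
  obtain ⟨C, hC⟩ := hK.exists_eLpNorm_reg_le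
  refine ⟨C, fun f h1 h2 => ?_⟩
  obtain ⟨G, hG, hGn, hlim⟩ := hK.exists_tendsto_reg hC h1 h2
  refine ⟨G, hG, hGn, ?_⟩
  have hη : ∀ n : ℕ, 0 < 1 / ((n : ℝ) + 1) := fun n => by positivity
  obtain ⟨ns, hns, hae⟩ := (tendstoInMeasure_of_tendsto_eLpNorm two_ne_zero
    (fun n => (hK.memLp_reg (hη n) h1 h2).1) hG.1 hlim).exists_seq_tendsto_ae
  have hGi : LocallyIntegrable (fun s => f s - G s) volume :=
    (h2.sub hG).locallyIntegrable (by norm_num)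
  filter_upwards [hae, LocallyIntegrable.ae_hasDerivAt_integral hGi] with t ht hder
  have hη0 : Tendsto (fun n => 1 / ((ns n : ℝ) + 1)) atTop (𝓝 0) :=
    tendsto_one_div_add_atTop_nhds_zero_nat.comp hns.tendsto_atTop
  -- This is G(t) = A u(t) in smoothed form: reg equals A e^{-ηA} u(t), and reg tends to G(t) along
  -- the chosen subsequence.
  have hA : ∀ ε, 0 < ε → K 1 ε (mild K f t) = K 0 ε (G t) := by
    intro ε hε
    have e1 : Tendsto (fun n => K 0 ε (reg K (1 / ((ns n : ℝ) + 1)) f t)) atTop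
        (𝓝 (K 0 ε (G t))) := ((K 0 ε).continuous.tendsto _).comp ht
    have e2 : Tendsto (fun n => K 1 (ε + 1 / ((ns n : ℝ) + 1)) (mild K f t)) atTop
        (𝓝 (K 1 ε (mild K f t))) := by
      have := (hK.deriv 1 ε hε).continuousAt.tendsto.comp
        (show Tendsto (fun n => ε + 1 / ((ns n : ℝ) + 1)) atTop (𝓝 ε) by
          simpa using (tendsto_const_nhds (x := ε)).add hη0)
      exact ((ContinuousLinearMap.apply ℂ H (mild K f t)).continuous.tendsto _).comp this
    refine tendsto_nhds_unique e2 (e1.congr fun n => ?_)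
    rw [reg, ← hK.shift_apply_mild 1 (hη _) h1, hK.mul_apply 0 1 hε (hη _)]
  have hder' : HasDerivAt (mild K f) (f t - G t) t := by
    have h3 := (hder (t - 1)).const_add (mild K f (t - 1))
    refine h3.congr_of_eventuallyEq ?_
    filter_upwards [lt_mem_nhds (show t - 1 < t by linarith)] with x hx
    rw [intervalIntegral.integral_of_le hx.le, ← hK.mild_sub_mild h1 h2 hG hlim hx.le]
    abel
  -- The truncated integral is A e^{-εA} u(t-ε). In the expansion of u at t, the constant term gives
  -- e^{-εA} G(t) → G(t), the linear term tends to 0 by `smul_one_apply_tendsto_zero`, and the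
  -- remainder is o(ε) against the norm C₁/ε.
  have htr : ∀ ε, 0 < ε → ∫ s in Iio (t - ε), K 1 (t - s) (f s) =
      K 0 ε (G t) - ε • K 1 ε (f t - G t) +
        K 1 ε (mild K f (t - ε) - mild K f t + ε • (f t - G t)) := by
    intro ε hε
    have h3 : ∫ s in Iio (t - ε), K 1 (t - s) (f s) = K 1 ε (mild K f (t - ε)) := by
      rw [hK.shift_apply_mild 1 hε h1]
      refine setIntegral_congr_fun measurableSet_Iio fun s hs => ?_
      congr 2
      ring
    have h4 : K 1 ε (mild K f (t - ε) - mild K f t + ε • (f t - G t)) =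
        K 1 ε (mild K f (t - ε)) - K 0 ε (G t) + ε • K 1 ε (f t - G t) := by
      rw [map_add, map_sub, hA ε hε, ContinuousLinearMap.map_smul_of_tower]
    rw [h3, h4]
    abel
  have hlim1 : Tendsto (fun ε : ℝ => K 1 ε (mild K f (t - ε) - mild K f t + ε • (f t - G t)))
      (𝓝[>] 0) (𝓝 0) := by
    obtain ⟨C₁, hC₁0, hC₁⟩ := hK.bound 1
    have h3 : HasDerivAt (fun ε => mild K f (t - ε) + ε • (f t - G t))
        (-(f t - G t) + (f t - G t)) 0 := by
      have ha : HasDerivAt (fun ε => mild K f (t - ε)) (-(f t - G t)) 0 :=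
        HasDerivAt.comp_const_sub t 0 (by simpa using hder')
      refine (ha.add ((hasDerivAt_id (0 : ℝ)).smul_const (f t - G t))).congr_deriv ?_
      rw [one_smul]
    rw [neg_add_cancel] at h3
    have h4 := (hasDerivAt_iff_tendsto_slope_zero.1 h3).mono_left
      (nhdsWithin_mono 0 (fun s (hs : 0 < s) => hs.ne') : 𝓝[>] (0 : ℝ) ≤ _)
    have h5 := h4.norm.const_mul C₁
    rw [norm_zero, mul_zero] at h5
    refine squeeze_zero_norm' ?_ h5
    filter_upwards [self_mem_nhdsWithin] with ε hε
    have hε : 0 < ε := hε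
    refine (ContinuousLinearMap.le_of_opNorm_le _ (hC₁ ε hε) _).trans (le_of_eq ?_)
    rw [norm_smul, norm_inv, Real.norm_of_nonneg hε.le]
    simp only [zero_add, sub_zero, zero_smul, add_zero, pow_one]
    rw [div_eq_mul_inv, mul_assoc]
    congr 3
    abel
  have hlim2 := ((hK.tendsto_zero (G t)).sub (hK.smul_one_apply_tendsto_zero (f t - G t))).add hlim1
  rw [sub_zero, add_zero] at hlim2
  refine hlim2.congr' ?_
  filter_upwards [self_mem_nhdsWithin] with ε hε
  exact (htr ε hε).symm

end ExpFamily

theorem integrable_clm_apply_of_memLp {U : Set ℝ} (hU : MeasurableSet U) {Φ : ℝ → H →L[ℂ] H}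
    (hΦ : ContinuousOn Φ U) {p : ℝ → ℝ} (hp : MemLp p 2 (volume.restrict U))
    (hb : ∀ s ∈ U, ‖Φ s‖ ≤ p s) {f : ℝ → H} (hf : MemLp f 2 (volume.restrict U)) :
    IntegrableOn (fun s => Φ s (f s)) U := by
  refine (hp.integrable_mul hf.norm).mono' (aestronglyMeasurable_clm_apply
    (hΦ.aestronglyMeasurable hU) hf.1) ?_
  filter_upwards [ae_restrict_mem hU] with s hs
  exact ContinuousLinearMap.le_of_opNorm_le _ (hb s hs) _

/-! ### Extension of de Simon's theorem to all of L² -/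

namespace ExpFamily

variable {K : ℕ → ℝ → H →L[ℂ] H}

theorem integrableOn_truncated (hK : ExpFamily K) {g : ℝ → H} (hg : MemLp g 2 volume) (t : ℝ)
    {ε : ℝ} (hε : 0 < ε) : IntegrableOn (fun s => K 1 (t - s) (g s)) (Iio (t - ε)) := by
  obtain ⟨C, hC0, hC⟩ := hK.bound 1
  have hc : ContinuousOn (fun s : ℝ => C / (t - s)) (Iio (t - ε)) :=
    continuousOn_const.div (by fun_prop) fun s (hs : s < t - ε) => by linarith
  refine integrable_clm_apply_of_memLp (p := fun s => C / (t - s)) measurableSet_Iio ?_ ?_ ?_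
    (hg.restrict _)
  · exact (hK.continuousOn 1).comp (by fun_prop) fun s (hs : s < t - ε) => by
      simp; linarith
  · rw [memLp_two_iff_integrable_sq (hc.aestronglyMeasurable measurableSet_Iio)]
    have h1 : IntegrableOn (fun x : ℝ => C ^ 2 * x ^ (-2 : ℝ)) (Ioi ε) :=
      (integrableOn_Ioi_rpow_of_lt (by norm_num) hε).const_mul _
    have h2 := (Measure.measurePreserving_sub_left volume t).integrableOn_comp_preimage
      (Homeomorph.subLeft t).measurableEmbedding |>.2 h1
    have h3 : (fun x => t - x) ⁻¹' Ioi ε = Iio (t - ε) := by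
      ext x; simp [lt_sub_comm]
    rw [h3] at h2
    refine h2.congr_fun (fun s (hs : s < t - ε) => ?_) measurableSet_Iio
    simp only [Function.comp_apply]
    rw [Real.rpow_neg (by linarith), div_pow, ← div_eq_mul_inv]
    norm_cast
  · intro s (hs : s < t - ε)
    simpa using hC (t - s) (by linarith)

/-- De Simon's theorem on `L²(ℝ; H)` for the forward operator. -/
theorem exists_forward_maximalRegularity (hK : ExpFamily K) {g : ℝ → H} (hg : MemLp g 2 volume) :
    ∃ G : ℝ → H, MemLp G 2 volume ∧
      ∀ᵐ t, Tendsto (fun ε => ∫ s in Iio (t - ε), K 1 (t - s) (g s)) (𝓝[>] 0) (𝓝 (G t)) := by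
  obtain ⟨C, hC⟩ := hK.exists_maximalRegularity_of_integrable
  let I : ℕ → Set ℝ := fun n => Ioc (-(n : ℝ)) n
  let gn : ℕ → ℝ → H := fun n => (I n).indicator g
  have hgn : ∀ n, MemLp (gn n) 2 volume := fun n => hg.indicator measurableSet_Ioc
  have hgi : ∀ n, Integrable (gn n) := fun n =>
    (integrable_indicator_iff measurableSet_Ioc).2 ((hg.restrict (I n)).integrable (by norm_num))
  choose Gn hGn hGnC hGnt using fun n => hC (gn n) (hgi n) (hgn n)
  let tr : ℝ → ℝ → H := fun t ε => ∫ s in Iio (t - ε), K 1 (t - s) (g s)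
  -- For n > |t| + 1, cutting g off to (-n, n] changes the truncated integrals only by the tail R n
  -- over (-∞, -n], which does not depend on ε and tends to 0. Hence the limit exists for g itself
  -- and is the pointwise limit of the Gn.
  have key : ∀ᵐ t, ∃ L, Tendsto (tr t) (𝓝[>] 0) (𝓝 L) ∧
      Tendsto (fun n => Gn n t) atTop (𝓝 L) := by
    filter_upwards [ae_all_iff.2 hGnt] with t ht
    let R : ℕ → H := fun n => ∫ s in Iic (-(n : ℝ)), K 1 (t - s) (g s)
    have hsplit : ∀ n : ℕ, |t| + 1 < n → Tendsto (tr t) (𝓝[>] 0) (𝓝 (R n + Gn n t)) := by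
      intro n hn
      have ht1 : -|t| ≤ t := neg_abs_le t
      have ht2 : t ≤ |t| := le_abs_self t
      refine ((tendsto_const_nhds (x := R n)).add (ht n)).congr' ?_
      filter_upwards [self_mem_nhdsWithin, nhdsWithin_le_nhds (gt_mem_nhds one_pos)] with ε hε hε1
      have hε : 0 < ε := hε
      have hle : -(n : ℝ) ≤ t - ε := by linarith
      have hi := hK.integrableOn_truncated hg t hε
      have h1 : ∫ s in Iio (t - ε), K 1 (t - s) (gn n s) =
          ∫ s in Ioc (-(n : ℝ)) (t - ε), K 1 (t - s) (g s) := by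
        rw [← integral_Iic_eq_integral_Iio, ← integral_indicator measurableSet_Iic,
          ← integral_indicator measurableSet_Ioc]
        congr 1
        ext1 s
        simp only [gn, I, indicator_apply, mem_Iic, mem_Ioc]
        split_ifs with h1 h2 h3 h3
        · rfl
        · exact absurd ⟨h2.1, h1⟩ h3
        · exact absurd ⟨h3.1, by linarith⟩ h2
        · simp
        · tauto
        · rfl
      simp only [tr]
      rw [h1, ← integral_Iic_eq_integral_Iio, ← Iic_union_Ioc_eq_Iic hle,
        setIntegral_union (Iic_disjoint_Ioc le_rfl) measurableSet_Ioc]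
      · exact hi.mono_set (Iic_subset_Iio.2 (by linarith))
      · exact (integrableOn_Iic_iff_integrableOn_Iio (by finiteness) |>.2 hi).mono_set Ioc_subset_Iic_self
    have hR : Tendsto R atTop (𝓝 0) := by
      have hmeas : ∀ n : ℕ, MeasurableSet (Iic (-(n : ℝ))) := fun n => measurableSet_Iic
      obtain ⟨n₀, hn₀⟩ := exists_nat_gt (|t| + 1)
      have h1 := tendsto_setIntegral_of_antitone (f := fun s => K 1 (t - s) (g s)) (μ := volume)
        hmeas (fun n m hnm => Iic_subset_Iic.2 (by simpa using hnm))
        ⟨n₀, (hK.integrableOn_truncated hg t one_pos).mono_set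
          (Iic_subset_Iio.2 (by linarith [neg_abs_le t]))⟩
      have h2 : ⋂ n : ℕ, Iic (-(n : ℝ)) = ∅ := by
        ext x
        simp only [mem_iInter, mem_Iic, mem_empty_iff_false, iff_false, not_forall, not_le]
        obtain ⟨n, hn⟩ := exists_nat_gt (-x)
        exact ⟨n, by linarith⟩
      rw [h2, Measure.restrict_empty, integral_zero_measure] at h1
      exact h1
    obtain ⟨n₀, hn₀⟩ := exists_nat_gt (|t| + 1)
    refine ⟨R n₀ + Gn n₀ t, hsplit n₀ hn₀, ?_⟩
    have h3 : Tendsto (fun n => (R n₀ + Gn n₀ t) - R n) atTop (𝓝 (R n₀ + Gn n₀ t)) := by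
      simpa using (tendsto_const_nhds (x := R n₀ + Gn n₀ t)).sub hR
    refine h3.congr' ?_
    filter_upwards [eventually_ge_atTop n₀] with n hn
    have hn' : |t| + 1 < n := hn₀.trans_le (by exact_mod_cast hn)
    rw [tendsto_nhds_unique (hsplit n₀ hn₀) (hsplit n hn')]
    abel
  let G : ℝ → H := fun t => limUnder (𝓝[>] 0) (tr t)
  have hG1 : ∀ᵐ t, Tendsto (tr t) (𝓝[>] 0) (𝓝 (G t)) := by
    filter_upwards [key] with t ⟨L, hL, _⟩
    simpa only [G, hL.limUnder_eq] using hL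
  have hG2 : ∀ᵐ t, Tendsto (fun n => Gn n t) atTop (𝓝 (G t)) := by
    filter_upwards [key] with t ⟨L, hL, hL2⟩
    simpa only [G, hL.limUnder_eq] using hL2
  refine ⟨G, ⟨aestronglyMeasurable_of_tendsto_ae atTop (fun n => (hGn n).1) hG2, ?_⟩, hG1⟩
  refine (Lp.eLpNorm_lim_le_liminf_eLpNorm (fun n => (hGn n).1) G hG2).trans_lt ?_
  refine lt_of_le_of_lt (b := C * eLpNorm g 2 volume) ?_
    (ENNReal.mul_lt_top ENNReal.coe_lt_top hg.2)
  refine (liminf_le_liminf (Eventually.of_forall fun n => (hGnC n).trans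
    (mul_le_mul_right (eLpNorm_indicator_le g) _))).trans ?_
  simp

/-- De Simon's theorem on `L²(ℝ; H)` for the backward operator. -/
theorem exists_backward_maximalRegularity (hK : ExpFamily K) {g : ℝ → H}
    (hg : MemLp g 2 volume) : ∃ G : ℝ → H, MemLp G 2 volume ∧
      ∀ᵐ t, Tendsto (fun ε => ∫ s in Ioi (t + ε), K 1 (s - t) (g s)) (𝓝[>] 0) (𝓝 (G t)) := by
  have hneg := Measure.measurePreserving_neg (volume : Measure ℝ)
  obtain ⟨G, hG, hlim⟩ := hK.exists_forward_maximalRegularity (hg.comp_measurePreserving hneg)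
  refine ⟨G ∘ Neg.neg, hG.comp_measurePreserving hneg, ?_⟩
  filter_upwards [hneg.quasiMeasurePreserving.ae hlim] with t ht
  refine ht.congr fun ε => ?_
  have h := integral_comp_neg_Iic (-(t + ε)) (fun s => K 1 (s - t) (g s))
  rw [neg_neg] at h
  rw [← h, integral_Iic_eq_integral_Iio, neg_add, ← sub_eq_add_neg]
  refine setIntegral_congr_fun measurableSet_Iio fun s _ => ?_
  simp only [Function.comp_apply]
  congr 2
  ring

end ExpFamily

/-! ### Hardy's inequalities and limits of interval integrals -/

/-- The power s^{-1/2} is an eigenfunction of the kernel 1/max(t,s), with contributions 2 from (0,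
t] and 2 from (t, ∞). It is the test function for the Schur test. -/
theorem lintegral_kernel (t : ℝ) (ht : 0 < t) :
    ∫⁻ s in Ioi (0 : ℝ), ENNReal.ofReal (s ^ (-(1 / 2) : ℝ) / max t s) =
      ENNReal.ofReal (4 * t ^ (-(1 / 2) : ℝ)) := by
  have hi1 : IntegrableOn (fun s : ℝ => s ^ (-(1 / 2) : ℝ) * t⁻¹) (Ioc 0 t) :=
    ((intervalIntegrable_iff_integrableOn_Ioc_of_le ht.le).1
      (intervalIntegral.intervalIntegrable_rpow' (by norm_num))).mul_const _
  have hi2 : IntegrableOn (fun s : ℝ => s ^ (-(3 / 2) : ℝ)) (Ioi t) :=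
    integrableOn_Ioi_rpow_of_lt (by norm_num) ht
  rw [← Ioc_union_Ioi_eq_Ioi ht.le, lintegral_union measurableSet_Ioi
    (by rw [Set.disjoint_left]; intro x hx hx'; exact absurd hx.2 (not_le.2 hx'))]
  have e1 : ∫⁻ s in Ioc (0 : ℝ) t, ENNReal.ofReal (s ^ (-(1 / 2) : ℝ) / max t s) =
      ENNReal.ofReal (2 * t ^ (-(1 / 2) : ℝ)) := by
    rw [setLIntegral_congr_fun measurableSet_Ioc (g := fun s => ENNReal.ofReal
      (s ^ (-(1 / 2) : ℝ) * t⁻¹)) fun s hs => by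
        simp only [max_eq_left hs.2, div_eq_mul_inv],
      ← ofReal_integral_eq_lintegral_ofReal hi1]
    · congr 1
      rw [integral_mul_const, ← intervalIntegral.integral_of_le ht.le,
        integral_rpow (Or.inl (by norm_num)), Real.zero_rpow (by norm_num)]
      have : t ^ (-(1 / 2) + 1 : ℝ) * t⁻¹ = t ^ (-(1 / 2) : ℝ) := by
        rw [Real.rpow_add_one ht.ne']
        field_simp
      norm_num at this ⊢
      linarith
    · filter_upwards [ae_restrict_mem measurableSet_Ioc] with s hs
      have := hs.1
      positivity
  have e2 : ∫⁻ s in Ioi t, ENNReal.ofReal (s ^ (-(1 / 2) : ℝ) / max t s) =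
      ENNReal.ofReal (2 * t ^ (-(1 / 2) : ℝ)) := by
    rw [setLIntegral_congr_fun measurableSet_Ioi (g := fun s => ENNReal.ofReal
      (s ^ (-(3 / 2) : ℝ))) fun s (hs : t < s) => by
        have hs0 : 0 < s := ht.trans hs
        simp only [max_eq_right hs.le]
        rw [show (-(3 / 2) : ℝ) = -(1 / 2) - 1 by norm_num, Real.rpow_sub_one hs0.ne'],
      ← ofReal_integral_eq_lintegral_ofReal hi2]
    · congr 1
      rw [integral_Ioi_rpow_of_lt (by norm_num) ht]
      norm_num
      ring
    · filter_upwards [ae_restrict_mem measurableSet_Ioi] with s (hs : t < s)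
      have := ht.trans hs
      positivity
  rw [e1, e2, ← ENNReal.ofReal_add (by positivity) (by positivity)]
  congr 1
  ring

/-- The Schur test for the homogeneous kernel `1 / max t s` (Hardy's inequalities). -/
theorem lintegral_hardy_sq_le {g : ℝ → ENNReal} (hg : AEMeasurable g (volume.restrict (Ioi 0))) :
    ∫⁻ t in Ioi (0 : ℝ), (∫⁻ s in Ioi (0 : ℝ), ENNReal.ofReal (1 / max t s) * g s) ^ (2 : ℝ) ≤
      ENNReal.ofReal 16 * ∫⁻ s in Ioi (0 : ℝ), g s ^ (2 : ℝ) := by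
  set μ := (volume : Measure ℝ).restrict (Ioi 0)
  -- The kernel is split as a b with a² = s^{-1/2}/max(t,s) and b² = s^{1/2}/max(t,s).
  -- Cauchy–Schwarz and two uses of the eigenvalue 4 give the constant 16.
  let a : ℝ → ℝ → ENNReal := fun t s => ENNReal.ofReal ((s ^ (-(1 / 2) : ℝ) / max t s) ^ (1 / 2 : ℝ))
  let b : ℝ → ℝ → ENNReal := fun t s => ENNReal.ofReal ((s ^ (1 / 2 : ℝ) / max t s) ^ (1 / 2 : ℝ))
  have ham : ∀ t, Measurable (a t) := fun t => by fun_prop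
  have hbm : ∀ t, Measurable (b t) := fun t => by fun_prop
  have hab : ∀ t s : ℝ, 0 < s → 0 < t → ENNReal.ofReal (1 / max t s) = a t s * b t s := by
    intro t s hs ht
    have hm : 0 < max t s := lt_max_of_lt_left ht
    simp only [a, b]
    rw [← ENNReal.ofReal_mul (by positivity), ← Real.mul_rpow (by positivity) (by positivity)]
    congr 1
    have : s ^ (-(1 / 2) : ℝ) / max t s * (s ^ (1 / 2 : ℝ) / max t s) = (1 / max t s) ^ (2 : ℝ) := by
      rw [Real.rpow_neg hs.le]
      have := Real.rpow_pos_of_pos hs (1 / 2)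
      norm_cast
      field_simp
    rw [this, ← Real.rpow_mul (by positivity)]
    norm_num
  have hsq : ∀ x : ℝ, 0 ≤ x → (ENNReal.ofReal (x ^ (1 / 2 : ℝ))) ^ (2 : ℝ) = ENNReal.ofReal x := by
    intro x hx
    rw [ENNReal.ofReal_rpow_of_nonneg (by positivity) (by norm_num), ← Real.rpow_mul hx]
    norm_num
  have h1 : ∀ t : ℝ, 0 < t → (∫⁻ s, ENNReal.ofReal (1 / max t s) * g s ∂μ) ^ (2 : ℝ) ≤
      ENNReal.ofReal (4 * t ^ (-(1 / 2) : ℝ)) *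
        ∫⁻ s, ENNReal.ofReal (s ^ (1 / 2 : ℝ) / max t s) * g s ^ (2 : ℝ) ∂μ := by
    intro t ht
    have e1 : ∫⁻ s, ENNReal.ofReal (1 / max t s) * g s ∂μ =
        ∫⁻ s, (a t * fun s => b t s * g s) s ∂μ := by
      refine setLIntegral_congr_fun measurableSet_Ioi fun s hs => ?_
      simp only [Pi.mul_apply]
      rw [hab t s hs ht, mul_assoc]
    rw [e1]
    have hCS := ENNReal.lintegral_mul_le_Lp_mul_Lq μ Real.HolderConjugate.two_two
      (ham t).aemeasurable ((hbm t).aemeasurable.mul hg)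
    refine (ENNReal.rpow_le_rpow hCS (by norm_num : (0 : ℝ) ≤ 2)).trans (le_of_eq ?_)
    rw [ENNReal.mul_rpow_of_nonneg _ _ (by norm_num), ← ENNReal.rpow_mul, ← ENNReal.rpow_mul]
    rw [show (1 / 2 * 2 : ℝ) = 1 by norm_num, ENNReal.rpow_one, ENNReal.rpow_one,
      ← lintegral_kernel t ht]
    congr 1
    · exact setLIntegral_congr_fun measurableSet_Ioi fun s (hs : 0 < s) => hsq _ (by positivity)
    · refine setLIntegral_congr_fun measurableSet_Ioi fun s (hs : 0 < s) => ?_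
      simp only [Pi.mul_apply, b]
      rw [ENNReal.mul_rpow_of_nonneg _ _ (by norm_num), hsq _ (by positivity)]
  have h2 : ∫⁻ t, (∫⁻ s, ENNReal.ofReal (1 / max t s) * g s ∂μ) ^ (2 : ℝ) ∂μ ≤
      ∫⁻ t, ∫⁻ s, ENNReal.ofReal (4 * t ^ (-(1 / 2) : ℝ)) *
        (ENNReal.ofReal (s ^ (1 / 2 : ℝ) / max t s) * g s ^ (2 : ℝ)) ∂μ ∂μ := by
    refine lintegral_mono_ae ?_
    filter_upwards [ae_restrict_mem measurableSet_Ioi] with t ht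
    rw [lintegral_const_mul'' _ (by fun_prop)]
    exact h1 t ht
  refine h2.trans (le_of_eq ?_)
  rw [lintegral_lintegral_swap (by
    refine AEMeasurable.mul (by fun_prop) (AEMeasurable.mul (by fun_prop) ?_)
    exact (hg.comp_snd (μ := μ)).pow_const 2), ← lintegral_const_mul'' _ (by fun_prop)]
  refine setLIntegral_congr_fun measurableSet_Ioi fun s (hs : 0 < s) => ?_
  have e3 : ∫⁻ t, ENNReal.ofReal (4 * t ^ (-(1 / 2) : ℝ)) *
      (ENNReal.ofReal (s ^ (1 / 2 : ℝ) / max t s) * g s ^ (2 : ℝ)) ∂μ =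
      ∫⁻ t, ENNReal.ofReal (t ^ (-(1 / 2) : ℝ) / max s t) *
        (ENNReal.ofReal (4 * s ^ (1 / 2 : ℝ)) * g s ^ (2 : ℝ)) ∂μ := by
    refine setLIntegral_congr_fun measurableSet_Ioi fun t (ht : 0 < t) => ?_
    rw [← mul_assoc, ← mul_assoc, ← ENNReal.ofReal_mul (by positivity),
      ← ENNReal.ofReal_mul (by positivity), max_comm s t]
    congr 2
    ring
  rw [e3, lintegral_mul_const _ (by fun_prop), lintegral_kernel s hs, ← mul_assoc,
    ← ENNReal.ofReal_mul (by positivity), Real.rpow_neg hs.le]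
  have := Real.rpow_pos_of_pos hs (1 / 2)
  congr 2
  field_simp
  norm_num

theorem tendsto_intervalIntegral_Ioc {ι E : Type*} [NormedAddCommGroup E] [NormedSpace ℝ E]
    {l : Filter ι} [l.IsCountablyGenerated] {f : ℝ → E} {A B : ℝ} (hf : IntegrableOn f (Ioc A B))
    {a b : ι → ℝ} (ha : Tendsto a l (𝓝 A)) (hb : Tendsto b l (𝓝 B))
    (h : ∀ᶠ i in l, A ≤ a i ∧ a i ≤ b i ∧ b i ≤ B) :
    Tendsto (fun i => ∫ s in a i..b i, f s) l (𝓝 (∫ s in Ioc A B, f s)) := by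
  refine ((aecover_Ioc_of_Ioc (μ := volume) ha hb).integral_tendsto_of_countably_generated
    hf).congr' ?_
  filter_upwards [h] with i hi
  rw [intervalIntegral.integral_of_le hi.2.1, Measure.restrict_restrict measurableSet_Ioc,
    inter_eq_left.2 (Ioc_subset_Ioc hi.1 hi.2.2)]

theorem tendsto_intervalIntegral_Ioi {ι E : Type*} [NormedAddCommGroup E] [NormedSpace ℝ E]
    {l : Filter ι} [l.IsCountablyGenerated] {f : ℝ → E} {A : ℝ} (hf : IntegrableOn f (Ioi A))
    {a b : ι → ℝ} (ha : Tendsto a l (𝓝 A)) (hb : Tendsto b l atTop)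
    (h : ∀ᶠ i in l, A ≤ a i) :
    Tendsto (fun i => ∫ s in a i..b i, f s) l (𝓝 (∫ s in Ioi A, f s)) := by
  have hc : AECover (volume.restrict (Ioi A)) l (fun i => Ioi (a i) ∩ Iic (b i)) :=
    (aecover_Ioi_of_Ioi ha).inter (aecover_Iic hb)
  refine (hc.integral_tendsto_of_countably_generated hf).congr' ?_
  filter_upwards [h, ha.eventually (gt_mem_nhds (lt_add_one A)),
    hb.eventually_ge_atTop (A + 1)] with i h1 h2 h3
  rw [intervalIntegral.integral_of_le (by linarith), Ioi_inter_Iic,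
    Measure.restrict_restrict measurableSet_Ioc,
    inter_eq_left.2 (Ioc_subset_Ioi_self.trans (Ioi_subset_Ioi h1))]

/-! ### Weighted spaces -/

theorem ae_wMeasure_iff {α : ℝ} {p : ℝ → Prop} :
    (∀ᵐ t ∂wMeasure α, p t) ↔ ∀ᵐ t ∂volume.restrict (Ioi (0 : ℝ)), p t := by
  rw [wMeasure, ae_withDensity_iff (by fun_prop)]
  refine eventually_congr ?_
  filter_upwards [ae_restrict_mem measurableSet_Ioi] with t (ht : 0 < t)
  have : 0 < t ^ α := Real.rpow_pos_of_pos ht α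
  simp [this]

theorem memW_congr {α : ℝ} {f g : ℝ → H} (h : ∀ᵐ t ∂volume.restrict (Ioi (0 : ℝ)), f t = g t)
    (hf : MemW α f) : MemW α g :=
  MemLp.ae_eq (ae_wMeasure_iff.2 h) hf

/-- Absorbing the weight into the function moves all estimates to unweighted L²(0, ∞); the price is
a perturbed kernel. -/
theorem memW_iff {α : ℝ} {f : ℝ → H} :
    MemW α f ↔ MemLp (fun t => t ^ (α / 2) • f t) 2 (volume.restrict (Ioi (0 : ℝ))) := by
  have hm : AEStronglyMeasurable f (wMeasure α) ↔
      AEStronglyMeasurable (fun t => t ^ (α / 2) • f t) (volume.restrict (Ioi (0 : ℝ))) := by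
    have h1 : AEStronglyMeasurable f (wMeasure α) ↔ AEStronglyMeasurable
        (fun t : ℝ => ((t ^ α).toNNReal : ℝ) • f t) (volume.restrict (Ioi (0 : ℝ))) :=
      aestronglyMeasurable_withDensity_iff (f := fun t : ℝ => (t ^ α).toNNReal) (by fun_prop)
    have hsm : ∀ β : ℝ, AEStronglyMeasurable (fun t : ℝ => t ^ β) (volume.restrict (Ioi (0 : ℝ))) :=
      fun β => Measurable.aestronglyMeasurable (by fun_prop)
    rw [h1]
    constructor
    · intro h
      refine ((hsm (-(α / 2))).smul h).congr ?_
      filter_upwards [ae_restrict_mem measurableSet_Ioi] with t (ht : 0 < t)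
      rw [Pi.smul_apply', Real.coe_toNNReal _ (by positivity), smul_smul, ← Real.rpow_add ht]
      congr 2
      ring
    · intro h
      refine ((hsm (α / 2)).smul h).congr ?_
      filter_upwards [ae_restrict_mem measurableSet_Ioi] with t (ht : 0 < t)
      rw [Pi.smul_apply', Real.coe_toNNReal _ (by positivity), smul_smul, ← Real.rpow_add ht]
      congr 2
      ring
  have hl : ∫⁻ t, ‖f t‖ₑ ^ (2 : ℝ) ∂wMeasure α =
      ∫⁻ t in Ioi (0 : ℝ), ‖t ^ (α / 2) • f t‖ₑ ^ (2 : ℝ) := by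
    rw [wMeasure, lintegral_withDensity_eq_lintegral_mul_non_measurable _ (by fun_prop)
      (ae_of_all _ fun _ => ENNReal.ofReal_lt_top)]
    refine setLIntegral_congr_fun measurableSet_Ioi fun t (ht : 0 < t) => ?_
    rw [Pi.mul_apply, enorm_smul, ENNReal.mul_rpow_of_nonneg _ _ (by norm_num),
      Real.enorm_of_nonneg (by positivity), ENNReal.ofReal_rpow_of_nonneg (by positivity)
      (by norm_num), ← Real.rpow_mul ht.le]
    congr 3
    ring
  have hiff := fun (g : ℝ → H) (μ : Measure ℝ) =>
    eLpNorm_lt_top_iff_lintegral_rpow_enorm_lt_top (f := g) (μ := μ) two_ne_zero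
      ENNReal.ofNat_ne_top
  simp only [ENNReal.toReal_ofNat] at hiff
  rw [MemW, MemLp, MemLp, hm, hiff, hiff, hl]

theorem memW_one_iff {f : ℝ → H} :
    MemW 1 f ↔ MemLp (fun t => √t • f t) 2 (volume.restrict (Ioi (0 : ℝ))) := by
  simp only [memW_iff, Real.sqrt_eq_rpow]

theorem memW_neg_one_iff {f : ℝ → H} :
    MemW (-1) f ↔ MemLp (fun t => (√t)⁻¹ • f t) 2 (volume.restrict (Ioi (0 : ℝ))) := by
  rw [memW_iff]
  refine memLp_congr_ae ?_
  filter_upwards [ae_restrict_mem measurableSet_Ioi] with t (ht : 0 < t)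
  rw [Real.sqrt_eq_rpow, ← Real.rpow_neg ht.le]
  congr 2
  norm_num

/-! ### Kernels of Hardy type -/

/-- The integral is dominated by the Hardy operator applied to ‖g‖, whose L² bound yields both the
finiteness for almost every t and the membership in L². -/
theorem memLp_integral_kernel {E : ℝ × ℝ → H →L[ℂ] H} {U : Set (ℝ × ℝ)} (hU : MeasurableSet U)
    (hU0 : ∀ p ∈ U, 0 < p.1 ∧ 0 < p.2) (hE : ContinuousOn E U) {C : ℝ} (hC0 : 0 ≤ C)
    (hC : ∀ p ∈ U, ‖E p‖ ≤ C / max p.1 p.2) {g : ℝ → H}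
    (hg : MemLp g 2 (volume.restrict (Ioi 0))) :
    (∀ᵐ t ∂volume.restrict (Ioi (0 : ℝ)),
      IntegrableOn (fun s => U.indicator (fun p => E p (g p.2)) (t, s)) (Ioi 0)) ∧
    MemLp (fun t => ∫ s in Ioi (0 : ℝ), U.indicator (fun p => E p (g p.2)) (t, s)) 2
      (volume.restrict (Ioi 0)) := by
  set μ := (volume : Measure ℝ).restrict (Ioi 0)
  set Φ : ℝ × ℝ → H := U.indicator fun p => E p (g p.2) with hΦ
  have hΦm : AEStronglyMeasurable Φ (μ.prod μ) :=
    aestronglyMeasurable_indicator_clm_apply hU hE hg.1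
  let T : ℝ → ENNReal := fun t => ∫⁻ s, ENNReal.ofReal (1 / max t s) * ‖g s‖ₑ ∂μ
  have hTm : AEMeasurable T μ := by
    refine AEMeasurable.lintegral_prod_right' (f := fun p : ℝ × ℝ =>
      ENNReal.ofReal (1 / max p.1 p.2) * ‖g p.2‖ₑ) ?_
    exact AEMeasurable.mul (by fun_prop) (hg.1.enorm.comp_snd (μ := μ))
  have hT2 : ∫⁻ t, T t ^ (2 : ℝ) ∂μ < ⊤ := by
    refine (lintegral_hardy_sq_le hg.1.enorm).trans_lt (ENNReal.mul_lt_top ENNReal.ofReal_lt_top ?_)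
    have := lintegral_rpow_enorm_lt_top_of_eLpNorm_lt_top two_ne_zero ENNReal.ofNat_ne_top hg.2
    simpa using this
  have hb : ∀ t, ∫⁻ s, ‖Φ (t, s)‖ₑ ∂μ ≤ ENNReal.ofReal C * T t := by
    intro t
    rw [← lintegral_const_mul' _ _ ENNReal.ofReal_ne_top]
    refine lintegral_mono fun s => ?_
    by_cases hp : (t, s) ∈ U
    · simp only [Φ, indicator_of_mem hp]
      have h1 := hC _ hp
      have h2 : (0 : ℝ) < max t s := lt_max_of_lt_left (hU0 _ hp).1
      have h3 : ‖E (t, s) (g s)‖ ≤ C * (1 / max t s * ‖g s‖) := by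
        refine (ContinuousLinearMap.le_of_opNorm_le _ h1 _).trans (le_of_eq ?_)
        ring
      rw [← ofReal_norm, ← ofReal_norm, ← ENNReal.ofReal_mul (by positivity),
        ← ENNReal.ofReal_mul hC0]
      exact ENNReal.ofReal_le_ofReal h3
    · simp [Φ, indicator_of_notMem hp]
  refine ⟨?_, hΦm.integral_prod_right', ?_⟩
  · have h1 := ae_lt_top' (hTm.pow_const 2) hT2.ne
    filter_upwards [h1, hΦm.prodMk_left] with t ht hm
    refine ⟨hm, (hb t).trans_lt (ENNReal.mul_lt_top ENNReal.ofReal_lt_top ?_)⟩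
    exact lt_top_iff_ne_top.2 fun h => by simp [h] at ht
  · rw [eLpNorm_lt_top_iff_lintegral_rpow_enorm_lt_top two_ne_zero ENNReal.ofNat_ne_top]
    have h2 : ∀ t, ‖∫ s, Φ (t, s) ∂μ‖ₑ ^ (2 : ENNReal).toReal ≤
        ENNReal.ofReal C ^ (2 : ℝ) * T t ^ (2 : ℝ) := by
      intro t
      rw [← ENNReal.mul_rpow_of_nonneg _ _ (by norm_num), ENNReal.toReal_ofNat]
      gcongr
      exact (enorm_integral_le_lintegral_enorm _).trans (hb t)
    refine (lintegral_mono h2).trans_lt ?_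
    rw [lintegral_const_mul' _ _ (by finiteness)]
    exact ENNReal.mul_lt_top (by finiteness) hT2

/-- This bilinear form of the Schur test justifies Fubini's theorem in the balayage formula for the
forward operator. -/
theorem integrable_prod_of_kernel {Φ : ℝ × ℝ → ℂ}
    (hΦ : AEStronglyMeasurable Φ ((volume.restrict (Ioi 0)).prod (volume.restrict (Ioi 0))))
    {p q : ℝ → ℝ} (hp : MemLp p 2 (volume.restrict (Ioi 0)))
    (hq : MemLp q 2 (volume.restrict (Ioi 0)))
    (hb : ∀ t s, 0 < t → 0 < s → ‖Φ (t, s)‖ ≤ 1 / max t s * (p t * q s)) :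
    Integrable Φ ((volume.restrict (Ioi 0)).prod (volume.restrict (Ioi 0))) := by
  set μ := (volume : Measure ℝ).restrict (Ioi 0)
  let T : ℝ → ENNReal := fun t => ∫⁻ s, ENNReal.ofReal (1 / max t s) * ‖q s‖ₑ ∂μ
  have hTm : AEMeasurable T μ := by
    refine AEMeasurable.lintegral_prod_right' (f := fun p : ℝ × ℝ =>
      ENNReal.ofReal (1 / max p.1 p.2) * ‖q p.2‖ₑ) ?_
    exact AEMeasurable.mul (by fun_prop) (hq.1.enorm.comp_snd (μ := μ))
  have hT2 : ∫⁻ t, T t ^ (2 : ℝ) ∂μ < ⊤ := by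
    refine (lintegral_hardy_sq_le hq.1.enorm).trans_lt (ENNReal.mul_lt_top ENNReal.ofReal_lt_top ?_)
    have := lintegral_rpow_enorm_lt_top_of_eLpNorm_lt_top two_ne_zero ENNReal.ofNat_ne_top hq.2
    simpa using this
  have hp2 : ∫⁻ t, ‖p t‖ₑ ^ (2 : ℝ) ∂μ < ⊤ := by
    have := lintegral_rpow_enorm_lt_top_of_eLpNorm_lt_top two_ne_zero ENNReal.ofNat_ne_top hp.2
    simpa using this
  refine ⟨hΦ, ?_⟩
  have h1 : ∫⁻ z, ‖Φ z‖ₑ ∂(μ.prod μ) ≤ ∫⁻ t, ‖p t‖ₑ * T t ∂μ := by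
    rw [lintegral_prod _ hΦ.enorm]
    refine lintegral_mono_ae ?_
    filter_upwards [ae_restrict_mem measurableSet_Ioi] with t (ht : 0 < t)
    rw [← lintegral_const_mul' _ _ (by simp)]
    refine lintegral_mono_ae ?_
    filter_upwards [ae_restrict_mem measurableSet_Ioi] with s (hs : 0 < s)
    have h2 : (0 : ℝ) < max t s := lt_max_of_lt_left ht
    rw [← ofReal_norm, ← ofReal_norm, ← ofReal_norm, ← ENNReal.ofReal_mul (by positivity),
      ← ENNReal.ofReal_mul (by positivity)]
    refine ENNReal.ofReal_le_ofReal ((hb t s ht hs).trans ?_)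
    calc 1 / max t s * (p t * q s) ≤ 1 / max t s * (‖p t‖ * ‖q s‖) :=
          mul_le_mul_of_nonneg_left ((Real.le_norm_self _).trans_eq (norm_mul _ _)) (by positivity)
      _ = _ := by ring
  refine h1.trans_lt ?_
  refine (ENNReal.lintegral_mul_le_Lp_mul_Lq μ Real.HolderConjugate.two_two hp.1.enorm hTm).trans_lt
    (ENNReal.mul_lt_top ?_ ?_)
  · exact ENNReal.rpow_lt_top_of_nonneg (by norm_num) hp2.ne
  · exact ENNReal.rpow_lt_top_of_nonneg (by norm_num) hT2.ne

/-! ### Weak limits -/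

/-- The uniform boundedness principle makes the limit functional continuous, and the Riesz
representation supplies v. -/
theorem exists_weak_limit {ι : Type*} {l : Filter ι} [l.NeBot] [l.IsCountablyGenerated]
    {x : ι → H} (h : ∀ y : H, ∃ c : ℂ, Tendsto (fun i => inner ℂ y (x i)) l (𝓝 c)) :
    ∃ v : H, ∀ y : H, Tendsto (fun i => inner ℂ y (x i)) l (𝓝 (inner ℂ y v)) := by
  choose c hc using h
  have h1 : Tendsto (fun i y => innerSL ℂ (x i) y) l (𝓝 fun y => starRingEnd ℂ (c y)) := by
    rw [tendsto_pi_nhds]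
    intro y
    have := (Complex.continuous_conj.tendsto _).comp (hc y)
    refine this.congr fun i => ?_
    simp
  let T : H →L[ℂ] ℂ := continuousLinearMapOfTendsto (fun i => innerSL ℂ (x i)) h1
  refine ⟨(InnerProductSpace.toDual ℂ H).symm T, fun y => ?_⟩
  have h2 : inner ℂ y ((InnerProductSpace.toDual ℂ H).symm T) = c y := by
    rw [← inner_conj_symm, InnerProductSpace.toDual_symm_apply]
    change starRingEnd ℂ (starRingEnd ℂ (c y)) = c y
    simp
  rw [h2]
  exact hc y

theorem exists_norm_le_of_weak_tendsto {x : ℕ → H} {v : H}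
    (h : ∀ y : H, Tendsto (fun i => inner ℂ y (x i)) atTop (𝓝 (inner ℂ y v))) :
    ∃ C, ∀ n, ‖x n‖ ≤ C := by
  obtain ⟨C, hC⟩ := banach_steinhaus (g := fun n => innerSL ℂ (x n)) fun y => by
    obtain ⟨C, hC⟩ := (h y).norm.bddAbove_range
    refine ⟨C, fun n => ?_⟩
    rw [innerSL_apply_apply, norm_inner_symm]
    exact hC ⟨n, rfl⟩
  exact ⟨C, fun n => by simpa using hC n⟩

/-- Weakly convergent sequences are bounded, while functions along a general filter need not be;
hence the passage to sequences. -/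
theorem tendsto_inner_of_weak_of_strong {ι : Type*} {l : Filter ι} [l.IsCountablyGenerated]
    {x y : ι → H} {v w : H} (hx : ∀ z : H, Tendsto (fun i => inner ℂ z (x i)) l (𝓝 (inner ℂ z v)))
    (hy : Tendsto y l (𝓝 w)) : Tendsto (fun i => inner ℂ (y i) (x i)) l (𝓝 (inner ℂ w v)) := by
  refine tendsto_of_seq_tendsto fun u hu => ?_
  obtain ⟨C, hC⟩ := exists_norm_le_of_weak_tendsto (x := x ∘ u) fun z => (hx z).comp hu
  have h1 : Tendsto (fun n => inner ℂ (y (u n) - w) (x (u n))) atTop (𝓝 0) := by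
    have h2 : Tendsto (fun n => ‖y (u n) - w‖ * C) atTop (𝓝 0) := by
      have := ((hy.comp hu).sub_const w).norm.mul_const C
      simpa using this
    refine squeeze_zero_norm (fun n => ?_) h2
    exact (norm_inner_le_norm _ _).trans (by gcongr; exact hC n)
  have h3 := h1.add ((hx w).comp hu)
  rw [zero_add] at h3
  refine h3.congr fun n => ?_
  simp

theorem inner_intervalIntegral {f : ℝ → H} {a b : ℝ} (hf : IntervalIntegrable f volume a b)
    (h : H) : inner ℂ h (∫ t in a..b, f t) = ∫ t in a..b, inner ℂ h (f t) :=
  ((innerSL ℂ h).intervalIntegral_comp_comm hf).symm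

theorem tendsto_fst_nhdsGT_atTop : Tendsto (fun p : ℝ × ℝ => p.1) (𝓝[>] 0 ×ˢ atTop) (𝓝 0) :=
  tendsto_fst.mono_right nhdsWithin_le_nhds

theorem eventually_fst_nhdsGT {l : Filter ℝ} : ∀ᶠ p : ℝ × ℝ in 𝓝[>] 0 ×ˢ l, 0 < p.1 :=
  tendsto_fst.eventually self_mem_nhdsWithin

theorem intervalIntegrable_of_integrableOn_Icc {f : ℝ → H}
    (hf : ∀ a b : ℝ, 0 < a → a ≤ b → IntegrableOn f (Icc a b)) {a b : ℝ} (ha : 0 < a)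
    (hb : 0 < b) : IntervalIntegrable f volume a b := by
  refine intervalIntegrable_iff.2 ((hf (min a b) (max a b) (lt_min ha hb) min_le_max).mono_set ?_)
  exact Ioc_subset_Icc_self

/-- A locally integrable function whose pairings are integrable is weakly integrable. -/
theorem exists_hasWeakIntegral {F : ℝ → H}
    (hF : ∀ a b : ℝ, 0 < a → a ≤ b → IntegrableOn F (Icc a b))
    (hi : ∀ h : H, IntegrableOn (fun t => inner ℂ h (F t)) (Ioi 0)) :
    ∃ v : H, HasWeakIntegral F v ∧ HasImproperWeakIntegral F v := by
  have h1 : ∀ h : H, Tendsto (fun p : ℝ × ℝ => inner ℂ h (∫ t in p.1..p.2, F t))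
      (𝓝[>] 0 ×ˢ atTop) (𝓝 (∫ t in Ioi (0 : ℝ), inner ℂ h (F t))) := by
    intro h
    refine (tendsto_intervalIntegral_Ioi (hi h) tendsto_fst_nhdsGT_atTop tendsto_snd
      (eventually_fst_nhdsGT.mono fun p hp => hp.le)).congr' ?_
    filter_upwards [eventually_fst_nhdsGT, tendsto_snd.eventually (eventually_gt_atTop 0)]
      with p hp hp2
    exact (inner_intervalIntegral (intervalIntegrable_of_integrableOn_Icc hF hp hp2) h).symm
  obtain ⟨v, hv⟩ := exists_weak_limit fun h => ⟨_, h1 h⟩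
  exact ⟨v, fun h => ⟨hi h, tendsto_nhds_unique (h1 h) (hv h)⟩, hF, hv⟩

theorem ae_pos : ∀ᵐ t ∂volume.restrict (Ioi (0 : ℝ)), 0 < t := ae_restrict_mem measurableSet_Ioi

theorem eventually_forward {t : ℝ} (ht : 0 < t) :
    ∀ᶠ p : ℝ × ℝ in 𝓝[>] 0 ×ˢ 𝓝[>] 0, 0 < p.1 ∧ 0 < p.2 ∧ p.1 < t - p.2 := by
  have h1 := (tendsto_fst (f := 𝓝[>] (0 : ℝ)) (g := 𝓝[>] (0 : ℝ))).eventually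
    (Ioo_mem_nhdsGT (half_pos ht))
  have h2 := (tendsto_snd (f := 𝓝[>] (0 : ℝ)) (g := 𝓝[>] (0 : ℝ))).eventually
    (Ioo_mem_nhdsGT (half_pos ht))
  filter_upwards [h1, h2] with p ⟨h3, h4⟩ ⟨h5, h6⟩
  have h4 : p.1 < t / 2 := h4
  have h6 : p.2 < t / 2 := h6
  exact ⟨h3, h5, by linarith⟩

theorem eventually_backward (t : ℝ) :
    ∀ᶠ p : ℝ × ℝ in 𝓝[>] 0 ×ˢ atTop, 0 < p.1 ∧ p.1 < 1 ∧ t + p.1 < p.2 ∧ 1 < p.2 := by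
  have h1 := (tendsto_fst (f := 𝓝[>] (0 : ℝ)) (g := (atTop : Filter ℝ))).eventually
    (Ioo_mem_nhdsGT one_pos)
  have h2 := (tendsto_snd (f := 𝓝[>] (0 : ℝ)) (g := (atTop : Filter ℝ))).eventually
    ((eventually_gt_atTop (t + 1)).and (eventually_gt_atTop 1))
  filter_upwards [h1, h2] with p ⟨h3, h4⟩ ⟨h5, h6⟩
  have h4 : p.1 < 1 := h4
  exact ⟨h3, h4, by linarith, h6⟩

/-! ### Maximal regularity operators perturbed by Hardy kernels -/

namespace ExpFamily

variable {K : ℕ → ℝ → H →L[ℂ] H}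

theorem integrableOn_truncated_backward (hK : ExpFamily K) {g : ℝ → H} (hg : MemLp g 2 volume)
    (t : ℝ) {ε : ℝ} (hε : 0 < ε) : IntegrableOn (fun s => K 1 (s - t) (g s)) (Ioi (t + ε)) := by
  have hneg := Measure.measurePreserving_neg (volume : Measure ℝ)
  have h := hK.integrableOn_truncated (hg.comp_measurePreserving hneg) (-t) hε
  have h2 := (hneg.integrableOn_comp_preimage (Homeomorph.neg ℝ).measurableEmbedding).2 h
  have h3 : Neg.neg ⁻¹' Iio (-t - ε) = Ioi (t + ε) := by
    ext x
    simp only [mem_preimage, mem_Iio, mem_Ioi]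
    constructor <;> intro h <;> linarith
  rw [h3] at h2
  refine h2.congr_fun (fun s _ => ?_) measurableSet_Ioi
  simp only [Function.comp_apply, neg_neg]
  congr 2
  ring

/-- `L²` boundedness and almost everywhere convergence for forward maximal regularity operators
perturbed by a kernel of Hardy type. -/
theorem exists_forward_perturbed (hK : ExpFamily K) {E : ℝ × ℝ → H →L[ℂ] H}
    (hE : ContinuousOn E {p | 0 < p.2 ∧ p.2 < p.1}) {C : ℝ} (hC0 : 0 ≤ C)
    (hC : ∀ t s, 0 < s → s < t → ‖E (t, s)‖ ≤ C / t) {g : ℝ → H}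
    (hg : MemLp g 2 (volume.restrict (Ioi 0))) :
    ∃ Y : ℝ → H, MemLp Y 2 (volume.restrict (Ioi 0)) ∧
      ∀ᵐ t ∂volume.restrict (Ioi (0 : ℝ)), Tendsto (fun p : ℝ × ℝ =>
        ∫ s in p.1..(t - p.2), (K 1 (t - s) (g s) + E (t, s) (g s)))
        (𝓝[>] 0 ×ˢ 𝓝[>] 0) (𝓝 (Y t)) := by
  set U : Set (ℝ × ℝ) := {p | 0 < p.2 ∧ p.2 < p.1} with hUdef
  have hU : MeasurableSet U := (measurableSet_lt measurable_const measurable_snd).inter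
    (measurableSet_lt measurable_snd measurable_fst)
  obtain ⟨he1, he2⟩ := memLp_integral_kernel hU (fun p hp => ⟨hp.1.trans hp.2, hp.1⟩) hE hC0
    (fun p hp => by rw [max_eq_left hp.2.le]; exact hC _ _ hp.1 hp.2) hg
  let g' : ℝ → H := (Ioi 0).indicator g
  have hg' : MemLp g' 2 volume := (memLp_indicator_iff_restrict measurableSet_Ioi).2 hg
  obtain ⟨G, hG, hGt⟩ := hK.exists_forward_maximalRegularity hg'
  refine ⟨_, (hG.restrict (Ioi 0)).add he2, ?_⟩
  filter_upwards [ae_restrict_of_ae hGt, he1, ae_pos] with t h1 h2 ht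
  rw [Pi.add_apply]
  -- The two limits decouple at t/2: the singularity at t is covered by the one-parameter limit for
  -- the zero extension g', the end at 0 by integrability on (0, t/2].
  have hA : Tendsto (fun p : ℝ × ℝ => ∫ s in p.1..(t - p.2), K 1 (t - s) (g s))
      (𝓝[>] 0 ×ˢ 𝓝[>] 0) (𝓝 (G t)) := by
    have h3 : IntegrableOn (fun s => K 1 (t - s) (g' s)) (Ioc 0 (t / 2)) :=
      (hK.integrableOn_truncated hg' t (ε := t / 4) (by linarith)).mono_set fun s hs => by
        simp only [mem_Iio]; linarith [hs.2]
    have h4 : Tendsto (fun p : ℝ × ℝ => ∫ s in p.1..(t / 2), K 1 (t - s) (g' s))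
        (𝓝[>] 0 ×ˢ 𝓝[>] 0) (𝓝 (∫ s in Ioc 0 (t / 2), K 1 (t - s) (g' s))) := by
      refine tendsto_intervalIntegral_Ioc h3 (tendsto_fst.mono_right nhdsWithin_le_nhds)
        tendsto_const_nhds ?_
      have := (tendsto_fst (f := 𝓝[>] (0 : ℝ)) (g := 𝓝[>] (0 : ℝ))).eventually
        (Ioo_mem_nhdsGT (half_pos ht))
      filter_upwards [this] with p ⟨h5, h6⟩
      exact ⟨le_of_lt h5, le_of_lt h6, le_rfl⟩
    have h5 := ((h1.comp (tendsto_snd (f := 𝓝[>] (0 : ℝ)))).sub_const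
      (∫ s in Ioc 0 (t / 2), K 1 (t - s) (g' s))).add h4
    rw [sub_add_cancel] at h5
    refine h5.congr' ?_
    filter_upwards [eventually_forward ht] with p ⟨hp1, hp2, hp3⟩
    have hi := hK.integrableOn_truncated hg' t hp2
    have hii : ∀ a b, a ≤ t - p.2 → b ≤ t - p.2 →
        IntervalIntegrable (fun s => K 1 (t - s) (g' s)) volume a b := fun a b ha hb =>
      intervalIntegrable_iff.2 ((integrableOn_Iic_iff_integrableOn_Iio (by finiteness) |>.2
        hi).mono_set fun s hs => hs.2.trans (max_le ha hb))
    have e1 : ∫ s in Iio (t - p.2), K 1 (t - s) (g' s) =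
        ∫ s in Ioc 0 (t - p.2), K 1 (t - s) (g' s) := by
      rw [← integral_Iic_eq_integral_Iio]
      refine setIntegral_eq_of_subset_of_forall_sdiff_eq_zero measurableSet_Iic
        Ioc_subset_Iic_self fun s hs => ?_
      have : s ∉ Ioi (0 : ℝ) := fun h => hs.2 ⟨h, hs.1⟩
      simp only [g', indicator_of_notMem this, map_zero]
    have e2 : ∫ s in p.1..(t - p.2), K 1 (t - s) (g s) =
        ∫ s in p.1..(t - p.2), K 1 (t - s) (g' s) := by
      refine intervalIntegral.integral_congr fun s hs => ?_
      rw [uIcc_of_le hp3.le] at hs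
      have : s ∈ Ioi (0 : ℝ) := hp1.trans_le hs.1
      simp only [g', indicator_of_mem this]
    have h0 : (0 : ℝ) ≤ t - p.2 := by linarith
    simp only [Function.comp_apply]
    have hw : IntervalIntegrable (fun s => K 1 (t - s) (g' s)) volume 0 (t / 2) :=
      (intervalIntegrable_iff_integrableOn_Ioc_of_le (by linarith)).2 h3
    have e3 := intervalIntegral.integral_add_adjacent_intervals (hii 0 p.1 h0 hp3.le)
      (hii p.1 (t - p.2) hp3.le le_rfl)
    have e4 := intervalIntegral.integral_add_adjacent_intervals (hii 0 p.1 h0 hp3.le)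
      ((hii p.1 0 hp3.le h0).trans hw)
    rw [e1, e2, ← intervalIntegral.integral_of_le h0,
      ← intervalIntegral.integral_of_le (by linarith : (0 : ℝ) ≤ t / 2), ← e3, ← e4]
    abel
  have hB : Tendsto (fun p : ℝ × ℝ => ∫ s in p.1..(t - p.2), E (t, s) (g s))
      (𝓝[>] 0 ×ˢ 𝓝[>] 0)
      (𝓝 (∫ s in Ioi (0 : ℝ), U.indicator (fun p => E p (g p.2)) (t, s))) := by
    have e1 : ∫ s in Ioi (0 : ℝ), U.indicator (fun p => E p (g p.2)) (t, s) =
        ∫ s in Ioc 0 t, U.indicator (fun p => E p (g p.2)) (t, s) := by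
      refine setIntegral_eq_of_subset_of_forall_sdiff_eq_zero measurableSet_Ioi
        Ioc_subset_Ioi_self fun s hs => ?_
      exact indicator_of_notMem (fun h => hs.2 ⟨h.1, h.2.le⟩) _
    rw [e1]
    have hsnd : Tendsto (fun p : ℝ × ℝ => t - p.2) (𝓝[>] 0 ×ˢ 𝓝[>] 0) (𝓝 t) := by
      simpa using (tendsto_const_nhds (x := t)).sub
        ((tendsto_snd (f := 𝓝[>] (0 : ℝ)) (g := 𝓝[>] (0 : ℝ))).mono_right nhdsWithin_le_nhds)
    refine (tendsto_intervalIntegral_Ioc (h2.mono_set Ioc_subset_Ioi_self)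
      (tendsto_fst.mono_right nhdsWithin_le_nhds) hsnd ?_).congr' ?_
    · filter_upwards [eventually_forward ht] with p ⟨hp1, hp2, hp3⟩
      exact ⟨hp1.le, hp3.le, by linarith⟩
    · filter_upwards [eventually_forward ht] with p ⟨hp1, hp2, hp3⟩
      refine intervalIntegral.integral_congr fun s hs => ?_
      rw [uIcc_of_le hp3.le] at hs
      exact indicator_of_mem (s := U) (a := (t, s)) ⟨hp1.trans_le hs.1, by
        simp only; linarith [hs.2]⟩ _
  refine (hA.add hB).congr' ?_
  filter_upwards [eventually_forward ht] with p ⟨hp1, hp2, hp3⟩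
  refine (intervalIntegral.integral_add ?_ ?_).symm
  · refine (intervalIntegrable_iff_integrableOn_Ioc_of_le hp3.le).2 ?_
    refine ((integrableOn_Iic_iff_integrableOn_Iio (by finiteness) |>.2
        (hK.integrableOn_truncated hg' t hp2)).mono_set Ioc_subset_Iic_self).congr_fun
        (fun s hs => ?_) measurableSet_Ioc
    have : s ∈ Ioi (0 : ℝ) := hp1.trans hs.1
    simp only [g', indicator_of_mem this]
  · refine (intervalIntegrable_iff_integrableOn_Ioc_of_le hp3.le).2 ?_
    refine (h2.mono_set (Ioc_subset_Ioi_self.trans (Ioi_subset_Ioi hp1.le))).congr_fun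
      (fun s hs => ?_) measurableSet_Ioc
    exact indicator_of_mem (s := U) (a := (t, s)) ⟨hp1.trans hs.1, by
        simp only; linarith [hs.2]⟩ _

/-- `L²` boundedness and almost everywhere convergence for backward maximal regularity operators
perturbed by a kernel of Hardy type. -/
theorem exists_backward_perturbed (hK : ExpFamily K) {E : ℝ × ℝ → H →L[ℂ] H}
    (hE : ContinuousOn E {p | 0 < p.1 ∧ p.1 < p.2}) {C : ℝ} (hC0 : 0 ≤ C)
    (hC : ∀ t s, 0 < t → t < s → ‖E (t, s)‖ ≤ C / s) {g : ℝ → H}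
    (hg : MemLp g 2 (volume.restrict (Ioi 0))) :
    ∃ Y : ℝ → H, MemLp Y 2 (volume.restrict (Ioi 0)) ∧
      ∀ᵐ t ∂volume.restrict (Ioi (0 : ℝ)), Tendsto (fun p : ℝ × ℝ =>
        ∫ s in (t + p.1)..p.2, (K 1 (s - t) (g s) + E (t, s) (g s)))
        (𝓝[>] 0 ×ˢ atTop) (𝓝 (Y t)) := by
  set U : Set (ℝ × ℝ) := {p | 0 < p.1 ∧ p.1 < p.2} with hUdef
  have hU : MeasurableSet U := (measurableSet_lt measurable_const measurable_fst).inter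
    (measurableSet_lt measurable_fst measurable_snd)
  obtain ⟨he1, he2⟩ := memLp_integral_kernel hU (fun p hp => ⟨hp.1, hp.1.trans hp.2⟩) hE hC0
    (fun p hp => by rw [max_eq_right hp.2.le]; exact hC _ _ hp.1 hp.2) hg
  let g' : ℝ → H := (Ioi 0).indicator g
  have hg' : MemLp g' 2 volume := (memLp_indicator_iff_restrict measurableSet_Ioi).2 hg
  obtain ⟨G, hG, hGt⟩ := hK.exists_backward_maximalRegularity hg'
  refine ⟨_, (hG.restrict (Ioi 0)).add he2, ?_⟩
  filter_upwards [ae_restrict_of_ae hGt, he1, ae_pos] with t h1 h2 ht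
  rw [Pi.add_apply]
  have hfst : Tendsto (fun p : ℝ × ℝ => t + p.1) (𝓝[>] 0 ×ˢ atTop) (𝓝 t) := by
    simpa using (tendsto_const_nhds (x := t)).add tendsto_fst_nhdsGT_atTop
  have hcongr : ∀ p : ℝ × ℝ, 0 < p.1 → ∀ s, t + p.1 < s → K 1 (s - t) (g' s) =
      K 1 (s - t) (g s) := by
    intro p hp s hs
    have : s ∈ Ioi (0 : ℝ) := by simp only [mem_Ioi]; linarith
    simp only [g', indicator_of_mem this]
  have hii : ∀ p : ℝ × ℝ, 0 < p.1 → t + p.1 < p.2 →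
      IntervalIntegrable (fun s => K 1 (s - t) (g' s)) volume (t + p.1) p.2 := fun p hp hp2 =>
    (intervalIntegrable_iff_integrableOn_Ioc_of_le hp2.le).2
      ((hK.integrableOn_truncated_backward hg' t hp).mono_set Ioc_subset_Ioi_self)
  have hA : Tendsto (fun p : ℝ × ℝ => ∫ s in (t + p.1)..p.2, K 1 (s - t) (g s))
      (𝓝[>] 0 ×ˢ atTop) (𝓝 (G t)) := by
    have h3 := hK.integrableOn_truncated_backward hg' t one_pos
    have h4 : Tendsto (fun p : ℝ × ℝ => ∫ s in (t + 1)..p.2, K 1 (s - t) (g' s))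
        (𝓝[>] 0 ×ˢ atTop) (𝓝 (∫ s in Ioi (t + 1), K 1 (s - t) (g' s))) :=
      tendsto_intervalIntegral_Ioi h3 tendsto_const_nhds tendsto_snd
        (Eventually.of_forall fun _ => le_rfl)
    have h5 := ((h1.comp (tendsto_fst (g := (atTop : Filter ℝ)))).sub_const
      (∫ s in Ioi (t + 1), K 1 (s - t) (g' s))).add h4
    rw [sub_add_cancel] at h5
    refine h5.congr' ?_
    filter_upwards [eventually_backward (t + 1)] with p ⟨hp1, hp2, hp3, _⟩
    have e1 : ∫ s in (t + p.1)..p.2, K 1 (s - t) (g s) =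
        ∫ s in (t + p.1)..p.2, K 1 (s - t) (g' s) := by
      rw [intervalIntegral.integral_of_le (by linarith),
        intervalIntegral.integral_of_le (by linarith)]
      exact setIntegral_congr_fun measurableSet_Ioc fun s hs => (hcongr p hp1 s hs.1).symm
    have hI := hK.integrableOn_truncated_backward hg' t hp1
    have e2 : ∫ s in Ioi (t + p.1), K 1 (s - t) (g' s) =
        (∫ s in Ioc (t + p.1) (t + 1), K 1 (s - t) (g' s)) +
          ∫ s in Ioi (t + 1), K 1 (s - t) (g' s) := by
      rw [← setIntegral_union (by
        rw [Set.disjoint_left]; intro x hx hx'; exact absurd hx.2 (not_le.2 hx'))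
        measurableSet_Ioi (hI.mono_set Ioc_subset_Ioi_self) h3,
        Ioc_union_Ioi_eq_Ioi (by linarith)]
    have e3 := intervalIntegral.integral_add_adjacent_intervals
      (hii (p.1, t + 1) hp1 (by simp only; linarith)) (hii (1, p.2) one_pos (by simp only; linarith))
    simp only at e3
    simp only [Function.comp_apply]
    rw [e2, e1, ← e3, ← intervalIntegral.integral_of_le (by linarith)]
    abel
  have hB : Tendsto (fun p : ℝ × ℝ => ∫ s in (t + p.1)..p.2, E (t, s) (g s))
      (𝓝[>] 0 ×ˢ atTop)
      (𝓝 (∫ s in Ioi (0 : ℝ), U.indicator (fun p => E p (g p.2)) (t, s))) := by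
    have e1 : ∫ s in Ioi (0 : ℝ), U.indicator (fun p => E p (g p.2)) (t, s) =
        ∫ s in Ioi t, U.indicator (fun p => E p (g p.2)) (t, s) := by
      refine setIntegral_eq_of_subset_of_forall_sdiff_eq_zero measurableSet_Ioi
        (Ioi_subset_Ioi ht.le) fun s hs => ?_
      exact indicator_of_notMem (fun h => hs.2 h.2) _
    rw [e1]
    refine (tendsto_intervalIntegral_Ioi (h2.mono_set (Ioi_subset_Ioi ht.le)) hfst tendsto_snd
      ?_).congr' ?_
    · filter_upwards [eventually_backward t] with p hp
      linarith [hp.1]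
    · filter_upwards [eventually_backward t] with p ⟨hp1, hp2, hp3, _⟩
      refine intervalIntegral.integral_congr fun s hs => ?_
      rw [uIcc_of_le hp3.le] at hs
      exact indicator_of_mem (s := U) (a := (t, s)) ⟨ht, by simp only; linarith [hs.1]⟩ _
  refine (hA.add hB).congr' ?_
  filter_upwards [eventually_backward t] with p ⟨hp1, hp2, hp3, _⟩
  refine (intervalIntegral.integral_add ?_ ?_).symm
  · refine (intervalIntegrable_iff_integrableOn_Ioc_of_le hp3.le).2 ?_
    exact ((intervalIntegrable_iff_integrableOn_Ioc_of_le hp3.le).1 (hii p hp1 hp3)).congr_fun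
      (fun s hs => hcongr p hp1 s hs.1) measurableSet_Ioc
  · refine (intervalIntegrable_iff_integrableOn_Ioc_of_le hp3.le).2 ?_
    refine (h2.mono_set (Ioc_subset_Ioi_self.trans (Ioi_subset_Ioi (by linarith)))).congr_fun
      (fun s hs => ?_) measurableSet_Ioc
    exact indicator_of_mem (s := U) (a := (t, s)) ⟨ht, by simp only; linarith [hs.1]⟩ _

/-- `(√(a/b) - 1) A e^{-(b-a)A}` is of Hardy type. -/
theorem exists_norm_weightKernel_le (hK : ExpFamily K) : ∃ C, 0 ≤ C ∧ ∀ a b : ℝ, 0 < a → a < b →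
    ‖(√a / √b - 1) • K 1 (b - a)‖ ≤ C / b := by
  obtain ⟨C, hC0, hC⟩ := hK.bound 1
  refine ⟨C, hC0, fun a b ha hab => ?_⟩
  have hb : 0 < b := ha.trans hab
  have hsa := Real.sqrt_pos.2 ha
  have hsb := Real.sqrt_pos.2 hb
  have hle : √a ≤ √b := Real.sqrt_le_sqrt hab.le
  -- Since √x ≥ x on [0, 1], the weight factor vanishes to first order at a = b, which cancels the
  -- singularity 1/(b-a).
  have h1 : |√a / √b - 1| ≤ (b - a) / b := by
    rw [abs_sub_comm, abs_of_nonneg (by rw [sub_nonneg, div_le_one hsb]; exact hle)]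
    have : a / b ≤ √a / √b := by
      have h2 : a / b = (√a / √b) * (√a / √b) := by
        rw [div_mul_div_comm, Real.mul_self_sqrt ha.le, Real.mul_self_sqrt hb.le]
      rw [h2]
      exact mul_le_of_le_one_left (by positivity) ((div_le_one hsb).2 hle)
    rw [sub_div, div_self hb.ne']
    linarith
  rw [norm_smul, Real.norm_eq_abs]
  have h2 : 0 < b - a := sub_pos.2 hab
  calc _ ≤ (b - a) / b * (C / (b - a) ^ 1) := by
        gcongr
        exact hC _ h2
    _ = C / b := by field_simp

theorem norm_sub_le_of_lt (hK : ExpFamily K) (n : ℕ) {C : ℝ}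
    (hC : ∀ t, 0 < t → ‖K (n + 1) t‖ ≤ C / t ^ (n + 1)) (hC0 : 0 ≤ C) {x y : ℝ} (hx : 0 < x)
    (hxy : x ≤ y) : ‖K n x - K n y‖ ≤ C / x ^ (n + 1) * (y - x) := by
  have h := (convex_Icc x y).norm_image_sub_le_of_norm_hasDerivWithin_le
    (f := K n) (f' := fun t => -K (n + 1) t) (C := C / x ^ (n + 1)) (x := x) (y := y)
    (fun t ht => (hK.deriv n t (hx.trans_le ht.1)).hasDerivWithinAt) (fun t ht => by
      rw [norm_neg]
      refine (hC t (hx.trans_le ht.1)).trans ?_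
      have := ht.1
      gcongr) (left_mem_Icc.2 hxy) (right_mem_Icc.2 hxy)
  rwa [norm_sub_rev, Real.norm_of_nonneg (sub_nonneg.2 hxy)] at h

/-- `√(b/a) (A e^{-(b-a)A} - A e^{-(b+a)A}) - A e^{-(b-a)A}` is of Hardy type. -/
theorem exists_norm_reflectedKernel_le (hK : ExpFamily K) : ∃ C, 0 ≤ C ∧ ∀ a b : ℝ, 0 < a →
    a < b → ‖(√b / √a) • (K 1 (b - a) - K 1 (b + a)) - K 1 (b - a)‖ ≤ C / b := by
  obtain ⟨C₁, hC₁0, hC₁⟩ := hK.bound 1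
  obtain ⟨C₂, hC₂0, hC₂⟩ := hK.bound 2
  refine ⟨8 * C₂ + 4 * C₁, by positivity, fun a b ha hab => ?_⟩
  have hb : 0 < b := ha.trans hab
  have hsa := Real.sqrt_pos.2 ha
  have hsb := Real.sqrt_pos.2 hb
  have hba : 0 < b - a := sub_pos.2 hab
  have hqa := Real.mul_self_sqrt ha.le
  have hqb := Real.mul_self_sqrt hb.le
  have hle : √a ≤ √b := Real.sqrt_le_sqrt hab.le
  -- For a ≤ b/2 the difference over an interval of length 2a gains a factor a, which absorbs
  -- √(b/a). For a ≥ b/2 the weight differs from 1 by at most (b-a)/a and the reflected term is not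
  -- singular.
  rcases le_total a (b / 2) with h | h
  · have h1 : ‖K 1 (b - a) - K 1 (b + a)‖ ≤ C₂ / (b - a) ^ 2 * (b + a - (b - a)) :=
      hK.norm_sub_le_of_lt 1 hC₂ hC₂0 hba (by linarith)
    have h2 : C₂ / (b - a) ^ 2 * (b + a - (b - a)) ≤ C₂ / (b / 2) ^ 2 * (2 * a) := by
      have : b / 2 ≤ b - a := by linarith
      have : b + a - (b - a) = 2 * a := by ring
      rw [this]
      gcongr
    have h3 : ‖(√b / √a) • (K 1 (b - a) - K 1 (b + a))‖ ≤ 8 * C₂ / b := by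
      rw [norm_smul, Real.norm_of_nonneg (by positivity)]
      calc √b / √a * ‖K 1 (b - a) - K 1 (b + a)‖ ≤ √b / √a * (C₂ / (b / 2) ^ 2 * (2 * a)) := by
            gcongr
            exact h1.trans h2
        _ = 8 * C₂ * (√b * (a / √a)) / b ^ 2 := by field_simp; ring
        _ = 8 * C₂ * (√b * √a) / b ^ 2 := by rw [Real.div_sqrt]
        _ ≤ 8 * C₂ * (√b * √b) / b ^ 2 := by gcongr
        _ = 8 * C₂ / b := by rw [hqb]; field_simp
    have h4 : ‖K 1 (b - a)‖ ≤ 4 * C₁ / b := by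
      refine (hC₁ _ hba).trans ?_
      rw [pow_one, div_le_div_iff₀ hba hb]
      nlinarith
    refine (norm_sub_le _ _).trans ((add_le_add h3 h4).trans (le_of_eq ?_))
    ring
  · have e1 : (√b / √a) • (K 1 (b - a) - K 1 (b + a)) - K 1 (b - a) =
        (√b / √a - 1) • K 1 (b - a) - (√b / √a) • K 1 (b + a) := by
      rw [smul_sub, sub_smul, one_smul]
      abel
    have h1 : √b / √a - 1 ≤ (b - a) / a := by
      have h2 : √b / √a ≤ b / a := by
        have h3 : b / a = (√b / √a) * (√b / √a) := by rw [div_mul_div_comm, hqa, hqb]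
        rw [h3]
        exact le_mul_of_one_le_left (by positivity) ((one_le_div hsa).2 hle)
      rw [sub_div, div_self ha.ne']
      linarith
    have h0 : 0 ≤ √b / √a - 1 := by rw [sub_nonneg, one_le_div hsa]; exact hle
    have h2 : ‖(√b / √a - 1) • K 1 (b - a)‖ ≤ 2 * C₁ / b := by
      rw [norm_smul, Real.norm_of_nonneg h0]
      calc _ ≤ (b - a) / a * (C₁ / (b - a) ^ 1) := by
            gcongr
            exact hC₁ _ hba
        _ = C₁ / a := by field_simp
        _ ≤ C₁ / (b / 2) := by gcongr
        _ = 2 * C₁ / b := by field_simp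
    have h3 : ‖(√b / √a) • K 1 (b + a)‖ ≤ 2 * C₁ / b := by
      rw [norm_smul, Real.norm_of_nonneg (by positivity)]
      have h4 : √b / √a ≤ 2 := by
        rw [div_le_iff₀ hsa]
        exact Real.sqrt_le_iff.2 ⟨by positivity, by nlinarith⟩
      calc _ ≤ 2 * (C₁ / (b + a) ^ 1) := by
            gcongr
            exact hC₁ _ (by linarith)
        _ ≤ 2 * (C₁ / b) := by
            rw [pow_one]
            gcongr
            linarith
        _ = 2 * C₁ / b := by ring
    rw [e1]
    refine (norm_sub_le _ _).trans ((add_le_add h2 h3).trans ?_)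
    rw [← add_div]
    refine div_le_div_of_nonneg_right ?_ hb.le
    linarith

end ExpFamily

/-! ### Local integrability and primitives of improper weak integrals -/

theorem integrableOn_smul_of_memLp {g : ℝ → H} (hg : MemLp g 2 (volume.restrict (Ioi 0)))
    {s : Set ℝ} (hs : MeasurableSet s) (hs0 : s ⊆ Ioi 0) (hfin : volume s ≠ ⊤) {w : ℝ → ℝ}
    (hw : ContinuousOn w s) {B : ℝ} (hB : ∀ t ∈ s, |w t| ≤ B) :
    IntegrableOn (fun t => w t • g t) s := by
  have : IsFiniteMeasure (volume.restrict s) := ⟨by simpa using hfin.lt_top⟩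
  have h1 : IntegrableOn g s := (hg.mono_measure (Measure.restrict_mono hs0 le_rfl)).integrable
    (by norm_num)
  refine (h1.norm.const_mul B).mono' ((hw.aestronglyMeasurable hs).smul h1.1) ?_
  filter_upwards [ae_restrict_mem hs] with t ht
  rw [norm_smul]
  gcongr
  exact hB t ht

theorem integrableOn_Ioc_of_inv_sqrt {f : ℝ → H}
    (hf : MemLp (fun t => (√t)⁻¹ • f t) 2 (volume.restrict (Ioi 0))) (T : ℝ) :
    IntegrableOn f (Ioc 0 T) := by
  refine (integrableOn_smul_of_memLp hf (s := Ioc 0 T) (w := fun t => √t) measurableSet_Ioc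
    Ioc_subset_Ioi_self (by simp) (by fun_prop) (B := √T) fun t ht => ?_).congr_fun
    (fun t ht => ?_) measurableSet_Ioc
  · rw [abs_of_nonneg (Real.sqrt_nonneg _)]
    exact Real.sqrt_le_sqrt ht.2
  · have := Real.sqrt_pos.2 ht.1
    simp only [smul_smul]
    rw [mul_inv_cancel₀ this.ne', one_smul]

theorem integrableOn_Icc_of_inv_sqrt {f : ℝ → H}
    (hf : MemLp (fun t => (√t)⁻¹ • f t) 2 (volume.restrict (Ioi 0))) (a b : ℝ) (ha : 0 < a) :
    IntegrableOn f (Icc a b) :=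
  (integrableOn_Ioc_of_inv_sqrt hf b).mono_set fun _ hx => ⟨ha.trans_le hx.1, hx.2⟩

theorem integrableOn_Icc_of_sqrt {f : ℝ → H}
    (hf : MemLp (fun t => √t • f t) 2 (volume.restrict (Ioi 0))) (a b : ℝ) (ha : 0 < a) :
    IntegrableOn f (Icc a b) := by
  have hpos : ∀ t ∈ Icc a b, 0 < √t := fun t ht => Real.sqrt_pos.2 (ha.trans_le ht.1)
  refine (integrableOn_smul_of_memLp hf (s := Icc a b) (w := fun t => (√t)⁻¹) measurableSet_Icc
    (fun t ht => ha.trans_le ht.1) (by simp) ?_ (B := (√a)⁻¹) fun t ht => ?_).congr_fun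
    (fun t ht => ?_) measurableSet_Icc
  · exact ContinuousOn.inv₀ (by fun_prop) fun t ht => (hpos t ht).ne'
  · rw [abs_of_nonneg (inv_nonneg.2 (Real.sqrt_nonneg _))]
    have := Real.sqrt_pos.2 ha
    gcongr
    exact ht.1
  · simp only [smul_smul]
    rw [inv_mul_cancel₀ (hpos t ht).ne', one_smul]

/-- Splitting an improper weak integral: the partial integrals `J c = ∫₀ᶜ F`. -/
theorem HasImproperWeakIntegral.exists_primitive {F : ℝ → H} {v : H}
    (hF : HasImproperWeakIntegral F v) : ∃ J : ℝ → H,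
      (∀ c, 0 < c → ∀ h, Tendsto (fun a => inner ℂ h (∫ t in a..c, F t)) (𝓝[>] 0)
        (𝓝 (inner ℂ h (J c)))) ∧
      (∀ h, Tendsto (fun c => inner ℂ h (J c)) (𝓝[>] 0) (𝓝 0)) ∧
      (∀ c c', 0 < c → 0 < c' → J c' = J c + ∫ t in c..c', F t) ∧
      ∀ h, Tendsto (fun c => inner ℂ h (J c)) atTop (𝓝 (inner ℂ h v)) := by
  have hii : ∀ {a b : ℝ}, 0 < a → 0 < b → IntervalIntegrable F volume a b :=
    fun ha hb => intervalIntegrable_of_integrableOn_Icc hF.1 ha hb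
  have hnear : ∀ h : H, ∀ ε > 0, ∃ δ > 0, ∃ R₀ : ℝ, ∀ a R, 0 < a → a < δ → R₀ ≤ R →
      dist (inner ℂ h (∫ t in a..R, F t)) (inner ℂ h v) < ε := by
    intro h ε hε
    obtain ⟨pa, hpa, pb, hpb, hp⟩ := eventually_prod_iff.1 (Metric.tendsto_nhds.1 (hF.2 h) ε hε)
    obtain ⟨δ, hδ, hδ'⟩ := mem_nhdsGT_iff_exists_Ioo_subset.1 hpa
    obtain ⟨R₀, hR₀⟩ := eventually_atTop.1 hpb
    exact ⟨δ, hδ, R₀, fun a R ha haδ hR => hp (hδ' ⟨ha, haδ⟩) (hR₀ R hR)⟩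
  -- Two truncations with a common upper end differ only near 0, so the joint limit forces a Cauchy
  -- condition at 0 alone.
  have hlim : ∀ h : H, ∃ c : ℂ, Tendsto (fun a => inner ℂ h (∫ t in a..(1 : ℝ), F t)) (𝓝[>] 0)
      (𝓝 c) := by
    intro h
    refine cauchy_map_iff_exists_tendsto.1 (Metric.cauchy_iff.2 ⟨inferInstance, fun ε hε => ?_⟩)
    obtain ⟨δ, hδ, R₀, hR⟩ := hnear h (ε / 2) (half_pos hε)
    refine ⟨_, image_mem_map (Ioo_mem_nhdsGT hδ), ?_⟩
    rintro _ ⟨a, ha, rfl⟩ _ ⟨b, hb, rfl⟩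
    have h0 : (0 : ℝ) < max R₀ 1 := lt_max_of_lt_right one_pos
    have h1 := hR a (max R₀ 1) ha.1 ha.2 (le_max_left _ _)
    have h2 := hR b (max R₀ 1) hb.1 hb.2 (le_max_left _ _)
    rw [← intervalIntegral.integral_add_adjacent_intervals (hii ha.1 one_pos) (hii one_pos h0),
      inner_add_right] at h1
    rw [← intervalIntegral.integral_add_adjacent_intervals (hii hb.1 one_pos) (hii one_pos h0),
      inner_add_right] at h2
    have h3 := (dist_triangle_right _ _ _).trans_lt (add_lt_add h1 h2)
    rwa [dist_add_right, add_halves] at h3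
  obtain ⟨J₁, hJ₁⟩ := exists_weak_limit hlim
  have hJ1 : ∀ c, 0 < c → ∀ h, Tendsto (fun a => inner ℂ h (∫ t in a..c, F t)) (𝓝[>] 0)
      (𝓝 (inner ℂ h (J₁ + ∫ t in (1 : ℝ)..c, F t))) := by
    intro c hc h
    rw [inner_add_right]
    refine ((hJ₁ h).add_const _).congr' ?_
    filter_upwards [self_mem_nhdsWithin] with a ha
    rw [← inner_add_right,
      intervalIntegral.integral_add_adjacent_intervals (hii ha one_pos) (hii one_pos hc)]
  refine ⟨fun c => J₁ + ∫ t in (1 : ℝ)..c, F t, hJ1, ?_, ?_, ?_⟩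
  · intro h
    have h1 := ((tendsto_const_nhds (x := inner ℂ h J₁)).sub (hJ₁ h))
    rw [sub_self] at h1
    refine h1.congr fun c => ?_
    rw [inner_add_right, intervalIntegral.integral_symm c 1, inner_neg_right, sub_eq_add_neg]
  · intro c c' hc hc'
    rw [add_assoc,
      intervalIntegral.integral_add_adjacent_intervals (hii one_pos hc) (hii hc hc')]
  · intro h
    rw [Metric.tendsto_nhds]
    intro ε hε
    obtain ⟨δ, hδ, R₀, hR⟩ := hnear h (ε / 2) (half_pos hε)
    filter_upwards [eventually_ge_atTop R₀, eventually_gt_atTop 0] with R hRR hR0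
    have h1 : dist (inner ℂ h (J₁ + ∫ t in (1 : ℝ)..R, F t)) (inner ℂ h v) ≤ ε / 2 := by
      refine le_of_tendsto ((hJ1 R hR0 h).dist tendsto_const_nhds) ?_
      filter_upwards [Ioo_mem_nhdsGT hδ] with a ha
      exact (hR a R ha.1 ha.2 hRR).le
    exact h1.trans_lt (half_lt_self hε)

/-! ### Existence of the singular integrals on the weighted spaces -/

/-- `y` is the weak value at `t` of `∫₀ᵗ A e^{-(t-s)A} f(s) ds`. -/
def ForwardValue (K : ℕ → ℝ → H →L[ℂ] H) (f : ℝ → H) (t : ℝ) (y : H) : Prop :=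
  ∀ h : H, Tendsto (fun p : ℝ × ℝ => inner ℂ h (∫ s in p.1..(t - p.2), K 1 (t - s) (f s)))
    (𝓝[>] 0 ×ˢ 𝓝[>] 0) (𝓝 (inner ℂ h y))

/-- `y` is the weak value at `t` of `∫ₜ^∞ A e^{-(s-t)A} f(s) ds`. -/
def BackwardValue (K : ℕ → ℝ → H →L[ℂ] H) (f : ℝ → H) (t : ℝ) (y : H) : Prop :=
  ∀ h : H, Tendsto (fun p : ℝ × ℝ => inner ℂ h (∫ s in (t + p.1)..p.2, K 1 (s - t) (f s)))
    (𝓝[>] 0 ×ˢ atTop) (𝓝 (inner ℂ h y))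

namespace ExpFamily

variable {K : ℕ → ℝ → H →L[ℂ] H}

theorem continuousOn_comp_prod (hK : ExpFamily K) (n : ℕ) {φ : ℝ × ℝ → ℝ} (hφ : Continuous φ)
    {U : Set (ℝ × ℝ)} (hU : ∀ p ∈ U, 0 < φ p) : ContinuousOn (fun p => K n (φ p)) U :=
  (hK.continuousOn n).comp hφ.continuousOn hU

theorem continuousOn_sqrt_ratio {φ ψ : ℝ × ℝ → ℝ} (hφ : Continuous φ) (hψ : Continuous ψ)
    {U : Set (ℝ × ℝ)} (hU : ∀ p ∈ U, 0 < ψ p) : ContinuousOn (fun p => √(φ p) / √(ψ p)) U :=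
  (by fun_prop : Continuous fun p => √(φ p)).continuousOn.div
    (by fun_prop : Continuous fun p => √(ψ p)).continuousOn fun p hp => (Real.sqrt_pos.2 (hU p hp)).ne'

/-- The forward maximal regularity operator is bounded on `L²(dt/t)`. -/
theorem exists_forwardValue_neg_one (hK : ExpFamily K) {f : ℝ → H}
    (hf : MemLp (fun t => (√t)⁻¹ • f t) 2 (volume.restrict (Ioi 0))) :
    ∃ Y : ℝ → H, MemLp (fun t => (√t)⁻¹ • Y t) 2 (volume.restrict (Ioi 0)) ∧
      ∀ᵐ t ∂volume.restrict (Ioi (0 : ℝ)), ForwardValue K f t (Y t) := by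
  obtain ⟨C, hC0, hC⟩ := hK.exists_norm_weightKernel_le
  -- Conjugation by the weight replaces A e^{-(t-s)A} by √(s/t) A e^{-(t-s)A}; the difference of the
  -- two is the perturbation E.
  have hE : ContinuousOn (fun p : ℝ × ℝ => (√p.2 / √p.1 - 1) • K 1 (p.1 - p.2))
      {p | 0 < p.2 ∧ p.2 < p.1} :=
    ((continuousOn_sqrt_ratio continuous_snd continuous_fst fun p hp => hp.1.trans hp.2).sub
      continuousOn_const).smul (hK.continuousOn_comp_prod 1 (by fun_prop) fun p hp => by
        linarith [hp.2])
  obtain ⟨Y, hY, hlim⟩ := hK.exists_forward_perturbed hE hC0 (fun t s hs hst => hC s t hs hst) hf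
  refine ⟨fun t => √t • Y t, ?_, ?_⟩
  · refine hY.ae_eq ?_
    filter_upwards [ae_pos] with t ht
    rw [smul_smul, inv_mul_cancel₀ (Real.sqrt_pos.2 ht).ne', one_smul]
  · filter_upwards [hlim, ae_pos] with t h1 ht h
    have hst := Real.sqrt_pos.2 ht
    refine ((tendsto_const_nhds (x := h)).inner (h1.const_smul (√t))).congr' ?_
    filter_upwards [eventually_forward ht] with p ⟨hp1, hp2, hp3⟩
    rw [← intervalIntegral.integral_smul]
    congr 1
    refine intervalIntegral.integral_congr fun s hs => ?_
    rw [uIcc_of_le hp3.le] at hs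
    have hss := Real.sqrt_pos.2 (hp1.trans_le hs.1)
    simp only [smul_apply, ContinuousLinearMap.map_smul_of_tower]
    rw [sub_smul, one_smul, add_sub_cancel, smul_smul, smul_smul]
    have : √t * (√s / √t) * (√s)⁻¹ = 1 := by field_simp
    rw [this, one_smul]

/-- The backward maximal regularity operator is bounded on `L²(t dt)`. -/
theorem exists_backwardValue_one (hK : ExpFamily K) {f : ℝ → H}
    (hf : MemLp (fun t => √t • f t) 2 (volume.restrict (Ioi 0))) :
    ∃ Y : ℝ → H, MemLp (fun t => √t • Y t) 2 (volume.restrict (Ioi 0)) ∧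
      ∀ᵐ t ∂volume.restrict (Ioi (0 : ℝ)), BackwardValue K f t (Y t) := by
  obtain ⟨C, hC0, hC⟩ := hK.exists_norm_weightKernel_le
  have hE : ContinuousOn (fun p : ℝ × ℝ => (√p.1 / √p.2 - 1) • K 1 (p.2 - p.1))
      {p | 0 < p.1 ∧ p.1 < p.2} :=
    ((continuousOn_sqrt_ratio continuous_fst continuous_snd fun p hp => hp.1.trans hp.2).sub
      continuousOn_const).smul (hK.continuousOn_comp_prod 1 (by fun_prop) fun p hp => by
        linarith [hp.2])
  obtain ⟨Y, hY, hlim⟩ := hK.exists_backward_perturbed hE hC0 (fun t s ht hst => hC t s ht hst) hf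
  refine ⟨fun t => (√t)⁻¹ • Y t, ?_, ?_⟩
  · refine hY.ae_eq ?_
    filter_upwards [ae_pos] with t ht
    rw [smul_smul, mul_inv_cancel₀ (Real.sqrt_pos.2 ht).ne', one_smul]
  · filter_upwards [hlim, ae_pos] with t h1 ht h
    have hst := Real.sqrt_pos.2 ht
    refine ((tendsto_const_nhds (x := h)).inner (h1.const_smul (√t)⁻¹)).congr' ?_
    filter_upwards [eventually_backward t] with p ⟨hp1, hp2, hp3, _⟩
    rw [← intervalIntegral.integral_smul]
    congr 1
    refine intervalIntegral.integral_congr fun s hs => ?_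
    rw [uIcc_of_le hp3.le] at hs
    have hss := Real.sqrt_pos.2 (show 0 < s by linarith [hs.1])
    simp only [smul_apply, ContinuousLinearMap.map_smul_of_tower]
    rw [sub_smul, one_smul, add_sub_cancel, smul_smul, smul_smul]
    have : (√t)⁻¹ * (√t / √s) * √s = 1 := by field_simp
    rw [this, one_smul]

theorem integrableOn_Icc_apply (hK : ExpFamily K) (n : ℕ) {φ : ℝ → ℝ} (hφ : Continuous φ)
    {a b : ℝ} (hpos : ∀ s ∈ Icc a b, 0 < φ s) {f : ℝ → H} (hf : IntegrableOn f (Icc a b)) :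
    IntegrableOn (fun s => K n (φ s) (f s)) (Icc a b) := by
  have hc : ContinuousOn (fun s => K n (φ s)) (Icc a b) :=
    (hK.continuousOn n).comp hφ.continuousOn hpos
  obtain ⟨B, hB⟩ := isCompact_Icc.exists_bound_of_continuousOn hc
  exact integrableOn_clm_apply measurableSet_Icc hc hB hf

/-- The backward maximal regularity operator at the endpoint `L²(dt/t)`, under the cancellation
condition `∫₀^∞ A e^{-sA} f(s) ds = 0`. -/
theorem exists_backwardValue_neg_one (hK : ExpFamily K) {f : ℝ → H}
    (hf : MemLp (fun t => (√t)⁻¹ • f t) 2 (volume.restrict (Ioi 0)))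
    (hf0 : HasImproperWeakIntegral (fun s => K 1 s (f s)) 0) :
    ∃ Y : ℝ → H, MemLp (fun t => (√t)⁻¹ • Y t) 2 (volume.restrict (Ioi 0)) ∧
      ∀ᵐ t ∂volume.restrict (Ioi (0 : ℝ)), BackwardValue K f t (Y t) := by
  obtain ⟨C, hC0, hC⟩ := hK.exists_norm_reflectedKernel_le
  obtain ⟨C₁, hC₁0, hC₁⟩ := hK.bound 1
  have hE : ContinuousOn (fun p : ℝ × ℝ =>
      (√p.2 / √p.1) • (K 1 (p.2 - p.1) - K 1 (p.2 + p.1)) - K 1 (p.2 - p.1))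
      {p | 0 < p.1 ∧ p.1 < p.2} := by
    have h1 := hK.continuousOn_comp_prod 1 (φ := fun p => p.2 - p.1) (by fun_prop)
      (U := {p | 0 < p.1 ∧ p.1 < p.2}) fun p hp => by linarith [hp.2]
    have h2 := hK.continuousOn_comp_prod 1 (φ := fun p => p.2 + p.1) (by fun_prop)
      (U := {p | 0 < p.1 ∧ p.1 < p.2}) fun p hp => by linarith [hp.1, hp.2]
    exact ((continuousOn_sqrt_ratio continuous_snd continuous_fst fun p hp => hp.1).smul
      (h1.sub h2)).sub h1
  obtain ⟨Y, hY, hlim⟩ := hK.exists_backward_perturbed hE hC0 (fun t s ht hst => hC t s ht hst) hf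
  set U : Set (ℝ × ℝ) := {p | 0 < p.2 ∧ p.2 < p.1} with hUdef
  have hU : MeasurableSet U := (measurableSet_lt measurable_const measurable_snd).inter
    (measurableSet_lt measurable_snd measurable_fst)
  have hE' : ContinuousOn (fun p : ℝ × ℝ => (√p.2 / √p.1) • K 1 (p.2 + p.1)) U :=
    (continuousOn_sqrt_ratio continuous_snd continuous_fst fun p hp => hp.1.trans hp.2).smul
      (hK.continuousOn_comp_prod 1 (by fun_prop) fun p hp => by linarith [hp.1, hp.2])
  obtain ⟨-, hL⟩ := memLp_integral_kernel hU (fun p hp => ⟨hp.1.trans hp.2, hp.1⟩) hE' hC₁0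
    (fun p hp => by
      have h1 := Real.sqrt_pos.2 hp.1
      have h2 := Real.sqrt_pos.2 (hp.1.trans hp.2)
      rw [max_eq_left hp.2.le, norm_smul, Real.norm_of_nonneg (by positivity)]
      refine (mul_le_of_le_one_left (norm_nonneg _)
        ((div_le_one h2).2 (Real.sqrt_le_sqrt hp.2.le))).trans
        ((hC₁ _ (by linarith [hp.1, hp.2])).trans ?_)
      have := hp.1.trans hp.2
      have := hp.1
      rw [pow_one]
      gcongr
      linarith) hf
  -- The kernel over (t, ∞) is split into its difference with A e^{-(s+t)A}, handled by the
  -- perturbation result, and A e^{-(s+t)A} itself. The cancellation condition makes the integral of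
  -- the latter over (t, ∞) equal to minus its integral over (0, t), again of Hardy type.
  refine ⟨fun t => √t • Y t - ∫ s in Ioc 0 t, K 1 (s + t) (f s), ?_, ?_⟩
  · refine (hY.sub hL).ae_eq ?_
    filter_upwards [ae_pos] with t ht
    have hst := Real.sqrt_pos.2 ht
    rw [Pi.sub_apply, smul_sub, smul_smul, inv_mul_cancel₀ hst.ne', one_smul]
    congr 1
    rw [← integral_smul]
    have e1 : ∫ s in Ioi (0 : ℝ), U.indicator (fun p =>
        ((√p.2 / √p.1) • K 1 (p.2 + p.1)) ((√p.2)⁻¹ • f p.2)) (t, s) =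
        ∫ s in Ioo (0 : ℝ) t, U.indicator (fun p =>
        ((√p.2 / √p.1) • K 1 (p.2 + p.1)) ((√p.2)⁻¹ • f p.2)) (t, s) :=
      setIntegral_eq_of_subset_of_forall_sdiff_eq_zero measurableSet_Ioi
        Ioo_subset_Ioi_self fun s hs =>
        indicator_of_notMem (s := U) (a := (t, s)) (fun h => hs.2 h) _
    rw [e1, integral_Ioc_eq_integral_Ioo]
    refine setIntegral_congr_fun measurableSet_Ioo fun s hs => ?_
    have hss := Real.sqrt_pos.2 hs.1
    have hmem : (t, s) ∈ U := hs
    simp only [indicator_of_mem hmem, smul_apply, ContinuousLinearMap.map_smul_of_tower, smul_smul]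
    congr 1
    field_simp
  · filter_upwards [hlim, ae_pos] with t h1 ht h
    have hst := Real.sqrt_pos.2 ht
    have hloc : IntegrableOn (fun s => K 1 (s + t) (f s)) (Ioc 0 (t + 1)) := by
      refine integrableOn_clm_apply measurableSet_Ioc (Φ := fun s => K 1 (s + t)) (B := C₁ / t) ?_
        ?_ (integrableOn_Ioc_of_inv_sqrt hf _)
      · exact (hK.continuousOn 1).comp (by fun_prop) fun s hs => by
          simp only [mem_Ioi]; linarith [hs.1]
      · intro s hs
        refine (hC₁ _ (by linarith [hs.1])).trans ?_
        rw [pow_one]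
        have := hs.1
        gcongr
        linarith
    have hfst : Tendsto (fun p : ℝ × ℝ => t + p.1) (𝓝[>] 0 ×ˢ atTop) (𝓝 t) := by
      simpa using (tendsto_const_nhds (x := t)).add tendsto_fst_nhdsGT_atTop
    -- A single parameter cuts off both at 0 and at t, so the integrals over (p.1, p.2) and (t +
    -- p.1, p.2) differ by one over a moving interval.
    have hA : Tendsto (fun p : ℝ × ℝ => ∫ s in p.1..(t + p.1), K 1 (s + t) (f s))
        (𝓝[>] 0 ×ˢ atTop) (𝓝 (∫ s in Ioc 0 t, K 1 (s + t) (f s))) := by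
      have e1 := tendsto_intervalIntegral_Ioc hloc tendsto_fst_nhdsGT_atTop
        (tendsto_const_nhds (x := t + 1)) (by
          filter_upwards [eventually_backward t] with p hp
          exact ⟨hp.1.le, by linarith [hp.2.1], le_rfl⟩)
      have e2 := tendsto_intervalIntegral_Ioc (hloc.mono_set (Ioc_subset_Ioc_left ht.le)) hfst
        (tendsto_const_nhds (x := t + 1)) (by
          filter_upwards [eventually_backward t] with p hp
          exact ⟨by linarith [hp.1], by linarith [hp.2.1], le_rfl⟩)
      have e3 : ∫ s in Ioc 0 (t + 1), K 1 (s + t) (f s) =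
          (∫ s in Ioc 0 t, K 1 (s + t) (f s)) + ∫ s in Ioc t (t + 1), K 1 (s + t) (f s) := by
        rw [← setIntegral_union (Ioc_disjoint_Ioc_of_le le_rfl) measurableSet_Ioc
          (hloc.mono_set (Ioc_subset_Ioc_right (by linarith)))
          (hloc.mono_set (Ioc_subset_Ioc_left ht.le)), Ioc_union_Ioc_eq_Ioc ht.le (by linarith)]
      have e4 := e1.sub e2
      rw [e3, add_sub_cancel_right] at e4
      refine e4.congr' ?_
      filter_upwards [eventually_backward t] with p hp
      have hi : ∀ a b, 0 < a → a ≤ t + 1 → 0 < b → b ≤ t + 1 →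
          IntervalIntegrable (fun s => K 1 (s + t) (f s)) volume a b := fun a b ha ha' hb hb' =>
        intervalIntegrable_iff.2 (hloc.mono_set fun s hs =>
          ⟨(lt_min ha hb).trans hs.1, hs.2.trans (max_le ha' hb')⟩)
      rw [sub_eq_iff_eq_add]
      exact (intervalIntegral.integral_add_adjacent_intervals
        (hi _ _ hp.1 (by linarith [hp.2.1]) (by linarith [hp.1]) (by linarith [hp.2.1]))
        (hi _ _ (by linarith [hp.1]) (by linarith [hp.2.1]) (by linarith) le_rfl)).symm
    -- Testing the cancellation condition on (e^{-tA})* h turns A e^{-sA} into A e^{-(s+t)A}.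
    have hB := hf0.2 (ContinuousLinearMap.adjoint (K 0 t) h)
    rw [inner_zero_right] at hB
    have hlim2 := (((tendsto_const_nhds (x := h)).inner (h1.const_smul (√t))).add hB).sub
      ((tendsto_const_nhds (x := h)).inner hA)
    rw [add_zero, ← inner_sub_right] at hlim2
    refine hlim2.congr' ?_
    filter_upwards [eventually_backward t] with p ⟨hp1, hp2, hp3, hp4⟩
    have hIcc : ∀ a b, 0 < a → IntegrableOn f (Icc a b) := integrableOn_Icc_of_inv_sqrt hf
    have hiK : IntervalIntegrable (fun s => K 1 s (f s)) volume p.1 p.2 :=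
      (intervalIntegrable_iff_integrableOn_Icc_of_le (by linarith)).2
        (hK.integrableOn_Icc_apply 1 continuous_id (fun s hs => hp1.trans_le hs.1) (hIcc _ _ hp1))
    have hi1 : ∀ a b, 0 < a → a ≤ b → IntervalIntegrable (fun s => K 1 (s + t) (f s)) volume a b :=
      fun a b ha hab => (intervalIntegrable_iff_integrableOn_Icc_of_le hab).2
        (hK.integrableOn_Icc_apply 1 (φ := fun s => s + t) (by fun_prop)
          (fun s hs => by linarith [hs.1]) (hIcc _ _ ha))
    have hi2 : IntervalIntegrable (fun s => K 1 (s - t) (f s)) volume (t + p.1) p.2 :=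
      (intervalIntegrable_iff_integrableOn_Icc_of_le hp3.le).2
        (hK.integrableOn_Icc_apply 1 (φ := fun s => s - t) (by fun_prop)
          (fun s hs => by linarith [hs.1]) (hIcc _ _ (by linarith)))
    rw [ContinuousLinearMap.adjoint_inner_left, ← inner_add_right, ← inner_sub_right]
    congr 1
    have e1 : K 0 t (∫ s in p.1..p.2, K 1 s (f s)) = ∫ s in p.1..p.2, K 1 (s + t) (f s) := by
      rw [← ContinuousLinearMap.intervalIntegral_comp_comm _ hiK]
      refine intervalIntegral.integral_congr fun s hs => ?_
      rw [uIcc_of_le (by linarith)] at hs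
      rw [hK.mul_apply 0 1 ht (hp1.trans_le hs.1), zero_add, add_comm t s]
    have e2 : √t • ∫ s in (t + p.1)..p.2, (K 1 (s - t) ((√s)⁻¹ • f s) +
        ((√s / √t) • (K 1 (s - t) - K 1 (s + t)) - K 1 (s - t)) ((√s)⁻¹ • f s)) =
        (∫ s in (t + p.1)..p.2, K 1 (s - t) (f s)) -
          ∫ s in (t + p.1)..p.2, K 1 (s + t) (f s) := by
      rw [← intervalIntegral.integral_sub hi2 (hi1 _ _ (by linarith) hp3.le),
        ← intervalIntegral.integral_smul]
      refine intervalIntegral.integral_congr fun s hs => ?_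
      rw [uIcc_of_le hp3.le] at hs
      have hss := Real.sqrt_pos.2 (show 0 < s by linarith [hs.1])
      simp only [smul_apply, sub_apply, ContinuousLinearMap.map_smul_of_tower]
      rw [add_sub_cancel, smul_smul, ← smul_sub, smul_smul]
      have : √t * (√s / √t) * (√s)⁻¹ = 1 := by field_simp
      rw [this, one_smul]
    rw [e1, e2, ← intervalIntegral.integral_add_adjacent_intervals
      (hi1 p.1 (t + p.1) hp1 (by linarith)) (hi1 (t + p.1) p.2 (by linarith) hp3.le)]
    abel

/-- Almost everywhere convergence of the forward maximal regularity operator at the endpoint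
`L²(t dt)`, when `∫₀^∞ e^{-sA} f(s) ds` converges weakly. -/
theorem exists_forwardValue_one (hK : ExpFamily K) {f : ℝ → H}
    (hf : MemLp (fun t => √t • f t) 2 (volume.restrict (Ioi 0))) {F : H}
    (hF : HasImproperWeakIntegral (fun s => K 0 s (f s)) F) :
    ∃ Y : ℝ → H, (∀ a b, 0 < a → IntegrableOn Y (Icc a b)) ∧
      ∀ᵐ t ∂volume.restrict (Ioi (0 : ℝ)), ForwardValue K f t (Y t) := by
  obtain ⟨C, hC0, hC⟩ := hK.exists_norm_reflectedKernel_le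
  have hE : ContinuousOn (fun p : ℝ × ℝ =>
      (√p.1 / √p.2) • (K 1 (p.1 - p.2) - K 1 (p.1 + p.2)) - K 1 (p.1 - p.2))
      {p | 0 < p.2 ∧ p.2 < p.1} := by
    have h1 := hK.continuousOn_comp_prod 1 (φ := fun p => p.1 - p.2) (by fun_prop)
      (U := {p | 0 < p.2 ∧ p.2 < p.1}) fun p hp => by linarith [hp.2]
    have h2 := hK.continuousOn_comp_prod 1 (φ := fun p => p.1 + p.2) (by fun_prop)
      (U := {p | 0 < p.2 ∧ p.2 < p.1}) fun p hp => by linarith [hp.1, hp.2]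
    exact ((continuousOn_sqrt_ratio continuous_fst continuous_snd fun p hp => hp.1).smul
      (h1.sub h2)).sub h1
  obtain ⟨Y, hY, hlim⟩ := hK.exists_forward_perturbed hE hC0 (fun t s hs hst => hC s t hs hst) hf
  obtain ⟨J, hJ, -, hJadd, -⟩ := hF.exists_primitive
  -- The reflected kernel A e^{-(t+s)A} integrates over (0, t) to A e^{-tA} J(t), where J(t) is the
  -- weak integral of e^{-sA} f(s) over (0, t). Hence the additional term.
  refine ⟨fun t => (√t)⁻¹ • Y t + K 1 t (J t), fun a b ha => ?_, ?_⟩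
  · refine (integrableOn_Icc_of_sqrt (f := fun t => (√t)⁻¹ • Y t) (hY.ae_eq ?_) a b ha).add
      (hK.integrableOn_Icc_apply 1 continuous_id (fun s hs => ha.trans_le hs.1)
        (ContinuousOn.integrableOn_Icc ?_))
    · filter_upwards [ae_pos] with t ht
      rw [smul_smul, mul_inv_cancel₀ (Real.sqrt_pos.2 ht).ne', one_smul]
    · refine ContinuousOn.congr (f := fun c => J a + ∫ t in a..c, K 0 t (f t))
        (continuousOn_const.add ?_) fun c hc => hJadd a c ha (ha.trans_le hc.1)
      have hF1 : IntegrableOn (fun s => K 0 s (f s)) (Icc a b) := by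
        rcases le_or_gt a b with hab | hab
        · exact hF.1 a b ha hab
        · simp [Icc_eq_empty_of_lt hab]
      refine (intervalIntegral.continuousOn_primitive hF1).congr fun c hc => ?_
      exact intervalIntegral.integral_of_le hc.1
  filter_upwards [hlim, ae_pos] with t h1 ht h
  have hst := Real.sqrt_pos.2 ht
  have hIcc : ∀ a b, 0 < a → IntegrableOn f (Icc a b) := integrableOn_Icc_of_sqrt hf
  have hi0 : ∀ a b, 0 < a → a ≤ b → IntervalIntegrable (fun s => K 0 s (f s)) volume a b :=
    fun a b ha hab => intervalIntegrable_of_integrableOn_Icc hF.1 ha (ha.trans_le hab)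
  have hA : Tendsto (fun p : ℝ × ℝ => ∫ s in (t - p.2)..t, K 0 s (f s)) (𝓝[>] 0 ×ˢ 𝓝[>] 0)
      (𝓝 0) := by
    have hsnd : Tendsto (fun p : ℝ × ℝ => t - p.2) (𝓝[>] 0 ×ˢ 𝓝[>] 0) (𝓝 t) := by
      simpa using (tendsto_const_nhds (x := t)).sub
        ((tendsto_snd (f := 𝓝[>] (0 : ℝ)) (g := 𝓝[>] (0 : ℝ))).mono_right nhdsWithin_le_nhds)
    have hI : IntegrableOn (fun s => K 0 s (f s)) (Ioc (t / 2) t) :=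
      (intervalIntegrable_iff_integrableOn_Ioc_of_le (by linarith)).1
        (hi0 _ _ (by linarith) (by linarith))
    have e1 := tendsto_intervalIntegral_Ioc hI (tendsto_const_nhds (x := t / 2)) hsnd (by
      have := (tendsto_snd (f := 𝓝[>] (0 : ℝ)) (g := 𝓝[>] (0 : ℝ))).eventually
        (Ioo_mem_nhdsGT (half_pos ht))
      filter_upwards [this] with p hp
      exact ⟨le_rfl, by linarith [hp.2], by linarith [hp.1]⟩)
    have e2 := (tendsto_const_nhds (x := ∫ s in Ioc (t / 2) t, K 0 s (f s))).sub e1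
    rw [sub_self] at e2
    refine e2.congr' ?_
    have := (tendsto_snd (f := 𝓝[>] (0 : ℝ)) (g := 𝓝[>] (0 : ℝ))).eventually
      (Ioo_mem_nhdsGT (half_pos ht))
    filter_upwards [this] with p hp
    rw [← intervalIntegral.integral_of_le (by linarith), sub_eq_iff_eq_add, add_comm]
    exact (intervalIntegral.integral_add_adjacent_intervals
      (hi0 _ _ (by linarith) (by linarith [hp.2]))
      (hi0 _ _ (by linarith [hp.2]) (by linarith [hp.1]))).symm
  have hB := (hJ t ht (ContinuousLinearMap.adjoint (K 1 t) h)).comp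
    (tendsto_fst (f := 𝓝[>] (0 : ℝ)) (g := 𝓝[>] (0 : ℝ)))
  have hlim2 := (((tendsto_const_nhds (x := h)).inner (h1.const_smul (√t)⁻¹)).add hB).sub
    ((tendsto_const_nhds (x := ContinuousLinearMap.adjoint (K 1 t) h)).inner hA)
  rw [inner_zero_right, sub_zero, ContinuousLinearMap.adjoint_inner_left,
    ← inner_add_right] at hlim2
  refine hlim2.congr' ?_
  filter_upwards [eventually_forward ht] with p ⟨hp1, hp2, hp3⟩
  have hi1 : IntervalIntegrable (fun s => K 1 (t + s) (f s)) volume p.1 (t - p.2) :=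
    (intervalIntegrable_iff_integrableOn_Icc_of_le hp3.le).2
      (hK.integrableOn_Icc_apply 1 (φ := fun s => t + s) (by fun_prop)
        (fun s hs => by linarith [hs.1]) (hIcc _ _ hp1))
  have hi2 : IntervalIntegrable (fun s => K 1 (t - s) (f s)) volume p.1 (t - p.2) :=
    (intervalIntegrable_iff_integrableOn_Icc_of_le hp3.le).2
      (hK.integrableOn_Icc_apply 1 (φ := fun s => t - s) (by fun_prop)
        (fun s hs => by linarith [hs.2]) (hIcc _ _ hp1))
  simp only [Function.comp_apply]
  rw [add_sub_assoc, ← inner_sub_right, ContinuousLinearMap.adjoint_inner_left,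
    ← inner_add_right]
  congr 1
  have e0 : (∫ s in p.1..t, K 0 s (f s)) - ∫ s in (t - p.2)..t, K 0 s (f s) =
      ∫ s in p.1..(t - p.2), K 0 s (f s) := by
    rw [sub_eq_iff_eq_add]
    exact (intervalIntegral.integral_add_adjacent_intervals (hi0 _ _ hp1 hp3.le)
      (hi0 _ _ (by linarith) (by linarith))).symm
  have e1 : K 1 t (∫ s in p.1..(t - p.2), K 0 s (f s)) =
      ∫ s in p.1..(t - p.2), K 1 (t + s) (f s) := by
    rw [← ContinuousLinearMap.intervalIntegral_comp_comm _ (hi0 _ _ hp1 hp3.le)]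
    refine intervalIntegral.integral_congr fun s hs => ?_
    rw [uIcc_of_le hp3.le] at hs
    exact hK.mul_apply 1 0 ht (hp1.trans_le hs.1) _
  have e2 : (√t)⁻¹ • ∫ s in p.1..(t - p.2), (K 1 (t - s) (√s • f s) +
      ((√t / √s) • (K 1 (t - s) - K 1 (t + s)) - K 1 (t - s)) (√s • f s)) =
      (∫ s in p.1..(t - p.2), K 1 (t - s) (f s)) -
        ∫ s in p.1..(t - p.2), K 1 (t + s) (f s) := by
    rw [← intervalIntegral.integral_sub hi2 hi1, ← intervalIntegral.integral_smul]
    refine intervalIntegral.integral_congr fun s hs => ?_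
    rw [uIcc_of_le hp3.le] at hs
    have hss := Real.sqrt_pos.2 (hp1.trans_le hs.1)
    simp only [smul_apply, sub_apply, ContinuousLinearMap.map_smul_of_tower]
    rw [add_sub_cancel, smul_smul, ← smul_sub, smul_smul]
    have : (√t)⁻¹ * (√t / √s) * √s = 1 := by field_simp
    rw [this, one_smul]
  rw [e0, e1, e2]
  abel

end ExpFamily

/-! ### Dilations and Fubini's theorem on a cone -/

theorem memLp_comp_mul_left {E : Type*} [NormedAddCommGroup E] {g : ℝ → E}
    (hg : MemLp g 2 (volume.restrict (Ioi 0))) {c : ℝ} (hc : 0 < c) :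
    MemLp (fun s => g (c * s)) 2 (volume.restrict (Ioi 0)) := by
  have hm : Measurable fun s : ℝ => c * s := measurable_const_mul c
  have hpre : (fun s : ℝ => c * s) ⁻¹' Ioi 0 = Ioi 0 := by
    ext s
    simp [hc]
  have hmap : Measure.map (fun s : ℝ => c * s) (volume.restrict (Ioi 0)) =
      ENNReal.ofReal |c⁻¹| • volume.restrict (Ioi 0) := by
    rw [← Measure.restrict_smul, ← Real.map_volume_mul_left hc.ne',
      Measure.restrict_map hm measurableSet_Ioi, hpre]
  have h1 : MemLp g 2 (Measure.map (fun s : ℝ => c * s) (volume.restrict (Ioi 0))) := by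
    rw [hmap]
    exact hg.smul_measure ENNReal.ofReal_ne_top
  exact h1.comp_of_map hm.aemeasurable

theorem memLp_sqrt_smul_comp_mul {φ : ℝ → H}
    (hφ : MemLp (fun s => √s • φ s) 2 (volume.restrict (Ioi 0))) {c : ℝ} (hc : 0 < c) :
    MemLp (fun s => √s • φ (c * s)) 2 (volume.restrict (Ioi 0)) := by
  refine ((memLp_comp_mul_left hφ hc).const_smul (√c)⁻¹).ae_eq (.of_forall fun s => ?_)
  have := Real.sqrt_pos.2 hc
  simp only [Pi.smul_apply]
  rw [Real.sqrt_mul hc.le, smul_smul, inv_mul_cancel_left₀ this.ne']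

theorem memLp_sqrt_mul_norm_comp_mul {φ : ℝ → H}
    (hφ : MemLp (fun s => √s • φ s) 2 (volume.restrict (Ioi 0))) {c : ℝ} (hc : 0 < c) :
    MemLp (fun s => √s * ‖φ (c * s)‖) 2 (volume.restrict (Ioi 0)) := by
  refine (memLp_sqrt_smul_comp_mul hφ hc).norm.ae_eq (.of_forall fun s => ?_)
  simp only [norm_smul, Real.norm_of_nonneg (Real.sqrt_nonneg s)]

theorem integrableOn_of_norm_le_mul {F : ℝ → ℂ} {p q : ℝ → ℝ}
    (hF : AEStronglyMeasurable F (volume.restrict (Ioi 0)))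
    (hp : MemLp p 2 (volume.restrict (Ioi 0))) (hq : MemLp q 2 (volume.restrict (Ioi 0)))
    (h : ∀ s, 0 < s → ‖F s‖ ≤ p s * q s) : IntegrableOn F (Ioi 0) := by
  refine (hp.integrable_mul hq).mono' hF ?_
  filter_upwards [ae_pos] with s hs
  exact h s hs

theorem aestronglyMeasurable_of_integrableOn_Icc {F : ℝ → H}
    (hF : ∀ a b, 0 < a → IntegrableOn F (Icc a b)) :
    AEStronglyMeasurable F (volume.restrict (Ioi 0)) := by
  have hU : Ioi (0 : ℝ) = ⋃ n : ℕ, Icc (1 / ((n : ℝ) + 1)) (n + 1) := by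
    ext x
    simp only [mem_Ioi, mem_iUnion, mem_Icc]
    refine ⟨fun hx => ?_, fun ⟨n, hn, _⟩ => (by positivity : (0 : ℝ) < 1 / (n + 1)).trans_le hn⟩
    obtain ⟨n, hn⟩ := exists_nat_gt (max x x⁻¹)
    have h1 := (le_max_left x x⁻¹).trans_lt hn
    have h2 := (le_max_right x x⁻¹).trans_lt hn
    refine ⟨n, ?_, by linarith⟩
    rw [one_div]
    exact inv_le_of_inv_le₀ hx (by linarith)
  rw [hU]
  exact AEStronglyMeasurable.iUnion fun n => (hF _ _ (by positivity)).aestronglyMeasurable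

/-- Fubini's theorem on the cone `{0 < t < s}`. -/
theorem integral_pow_mul_integral_Ioi {G : ℝ → ℂ} (hG : IntegrableOn G (Ioi 0)) (m : ℕ) :
    IntegrableOn (fun t : ℝ => (t : ℂ) ^ m * ∫ s in Ioi t, ((s : ℂ) ^ (m + 1))⁻¹ * G s) (Ioi 0) ∧
    ∫ t in Ioi (0 : ℝ), (t : ℂ) ^ m * ∫ s in Ioi t, ((s : ℂ) ^ (m + 1))⁻¹ * G s =
      ((m : ℂ) + 1)⁻¹ * ∫ s in Ioi (0 : ℝ), G s := by
  set U : Set (ℝ × ℝ) := {p | 0 < p.1 ∧ p.1 < p.2} with hUdef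
  have hU : MeasurableSet U := (measurableSet_lt measurable_const measurable_fst).inter
    (measurableSet_lt measurable_fst measurable_snd)
  set Ψ : ℝ × ℝ → ℂ := U.indicator fun p => (p.1 : ℂ) ^ m * (((p.2 : ℂ) ^ (m + 1))⁻¹ * G p.2)
    with hΨ
  have hΨm : AEStronglyMeasurable Ψ
      ((volume.restrict (Ioi 0)).prod (volume.restrict (Ioi 0))) := by
    refine AEStronglyMeasurable.indicator ?_ hU
    refine AEStronglyMeasurable.mul (by fun_prop) (AEStronglyMeasurable.mul
      (Measurable.aestronglyMeasurable (by fun_prop)) hG.1.comp_snd)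
  have hslice : ∀ s, 0 < s → (fun t => Ψ (t, s)) =
      (Ioo 0 s).indicator fun t : ℝ => (t : ℂ) ^ m * (((s : ℂ) ^ (m + 1))⁻¹ * G s) := by
    intro s hs
    ext t
    by_cases ht : t ∈ Ioo 0 s
    · have : (t, s) ∈ U := ht
      rw [indicator_of_mem ht, hΨ, indicator_of_mem this]
    · have : (t, s) ∉ U := ht
      rw [indicator_of_notMem ht, hΨ, indicator_of_notMem this]
  have hslice' : ∀ t, 0 < t → (fun s => Ψ (t, s)) =
      (Ioi t).indicator fun s : ℝ => (t : ℂ) ^ m * (((s : ℂ) ^ (m + 1))⁻¹ * G s) := by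
    intro t ht
    ext s
    by_cases hs : s ∈ Ioi t
    · have : (t, s) ∈ U := ⟨ht, hs⟩
      rw [indicator_of_mem hs, hΨ, indicator_of_mem this]
    · have : (t, s) ∉ U := fun h => hs h.2
      rw [indicator_of_notMem hs, hΨ, indicator_of_notMem this]
  have hpow : ∀ s : ℝ, 0 < s → ∫ t in Ioo 0 s, t ^ m = s ^ (m + 1) / (m + 1) := by
    intro s hs
    rw [← integral_Ioc_eq_integral_Ioo, ← intervalIntegral.integral_of_le hs.le, integral_pow]
    simp
  have hpowc : ∀ s : ℝ, 0 < s → ∫ t in Ioo 0 s, (t : ℂ) ^ m = (s : ℂ) ^ (m + 1) / (m + 1) := by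
    intro s hs
    have : ((∫ t in Ioo 0 s, t ^ m : ℝ) : ℂ) = ((s ^ (m + 1) / (m + 1) : ℝ) : ℂ) := by
      rw [hpow s hs]
    rw [← integral_complex_ofReal] at this
    push_cast at this
    exact this
  have hint : Integrable Ψ ((volume.restrict (Ioi 0)).prod (volume.restrict (Ioi 0))) := by
    rw [integrable_prod_iff' hΨm]
    constructor
    · filter_upwards [ae_pos] with s hs
      rw [hslice s hs, integrable_indicator_iff measurableSet_Ioo]
      refine Integrable.mul_const ?_ _
      refine IntegrableOn.mono_set (t := Icc 0 s) ?_ Ioo_subset_Icc_self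
      rw [IntegrableOn, Measure.restrict_restrict measurableSet_Icc]
      exact (Continuous.integrableOn_Icc (by fun_prop)).mono_set inter_subset_left
    · refine (hG.norm.const_mul ((m : ℝ) + 1)⁻¹).congr ?_
      filter_upwards [ae_pos] with s hs
      have e1 : (fun t => ‖Ψ (t, s)‖) =
          (Ioo 0 s).indicator fun t : ℝ => t ^ m * ((s ^ (m + 1))⁻¹ * ‖G s‖) := by
        ext t
        rw [congrFun (hslice s hs) t, norm_indicator_eq_indicator_norm]
        refine indicator_congr (fun t ht => ?_) |> fun h => congrFun h t
        have := ht.1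
        simp only [norm_mul, norm_pow, norm_inv, Complex.norm_real, Real.norm_of_nonneg ht.1.le,
          Real.norm_of_nonneg hs.le]
      rw [e1, integral_indicator measurableSet_Ioo,
        Measure.restrict_restrict measurableSet_Ioo,
        inter_eq_left.2 Ioo_subset_Ioi_self, integral_mul_const, hpow s hs]
      field_simp
  have hL : ∀ t, 0 < t → ∫ s in Ioi (0 : ℝ), Ψ (t, s) =
      (t : ℂ) ^ m * ∫ s in Ioi t, ((s : ℂ) ^ (m + 1))⁻¹ * G s := by
    intro t ht
    rw [hslice' t ht, integral_indicator measurableSet_Ioi,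
      Measure.restrict_restrict measurableSet_Ioi, inter_eq_left.2 (Ioi_subset_Ioi ht.le),
      integral_const_mul]
  have hR : ∀ s, 0 < s → ∫ t in Ioi (0 : ℝ), Ψ (t, s) = ((m : ℂ) + 1)⁻¹ * G s := by
    intro s hs
    rw [hslice s hs, integral_indicator measurableSet_Ioo,
        Measure.restrict_restrict measurableSet_Ioo,
        inter_eq_left.2 Ioo_subset_Ioi_self, integral_mul_const, hpowc s hs]
    have : (s : ℂ) ≠ 0 := by exact_mod_cast hs.ne'
    have : (m : ℂ) + 1 ≠ 0 := by exact_mod_cast m.succ_ne_zero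
    field_simp
  constructor
  · refine hint.integral_prod_left.congr ?_
    filter_upwards [ae_pos] with t ht
    exact hL t ht
  · rw [← integral_const_mul, ← setIntegral_congr_fun measurableSet_Ioi fun t ht => hL t ht,
      integral_integral_swap (f := fun t s => Ψ (t, s)) hint]
    exact setIntegral_congr_fun measurableSet_Ioi fun s hs => hR s hs

/-! ### Evolution formulae and absolutely convergent balayage -/

namespace ExpFamily

variable {K : ℕ → ℝ → H →L[ℂ] H}

/-- Writing A^{n+1} e^{-sA} as A^n e^{-(s/2)A} A e^{-(s/2)A} reduces every power to the quadratic
estimate at half the time. -/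
theorem exists_norm_succ_apply_le (hK : ExpFamily K) (n : ℕ) : ∃ C, 0 ≤ C ∧
    ∀ s x, 0 < s → ‖K (n + 1) s x‖ ≤ C / s ^ n * ‖K 1 (s / 2) x‖ := by
  obtain ⟨C, hC0, hC⟩ := hK.bound n
  refine ⟨C * 2 ^ n, by positivity, fun s x hs => ?_⟩
  have h1 := hK.mul_apply n 1 (half_pos hs) (half_pos hs) x
  rw [add_halves] at h1
  rw [← h1]
  refine (ContinuousLinearMap.le_opNorm _ _).trans ?_
  gcongr
  refine (hC _ (half_pos hs)).trans_eq ?_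
  rw [div_pow, div_div_eq_mul_div]

theorem exists_norm_adjoint_succ_apply_le (hK : ExpFamily K) (n : ℕ) : ∃ C, 0 ≤ C ∧
    ∀ s x, 0 < s → ‖ContinuousLinearMap.adjoint (K (n + 1) s) x‖ ≤
      C / s ^ n * ‖ContinuousLinearMap.adjoint (K 1 (s / 2)) x‖ := by
  obtain ⟨C, hC0, hC⟩ := hK.bound n
  refine ⟨C * 2 ^ n, by positivity, fun s x hs => ?_⟩
  have h1 := hK.adjoint_apply n 1 (half_pos hs) (half_pos hs) x
  rw [add_halves] at h1
  rw [← h1]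
  refine (ContinuousLinearMap.le_opNorm _ _).trans ?_
  rw [LinearIsometryEquiv.norm_map]
  gcongr
  refine (hC _ (half_pos hs)).trans_eq ?_
  rw [div_pow, div_div_eq_mul_div]

/-- Moving K n τ onto the test vector removes the singularity at s = t, so the weak singular value
becomes an absolutely convergent integral, to which Fubini's theorem applies. -/
theorem inner_apply_of_forwardValue (hK : ExpFamily K) {f : ℝ → H} {t τ : ℝ} (ht : 0 < t)
    (hτ : 0 < τ) (n : ℕ) (hf : IntegrableOn f (Ioc 0 t)) {y : H} (hy : ForwardValue K f t y)
    (h : H) :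
    inner ℂ h (K n τ y) = ∫ s in Ioc 0 t, inner ℂ h (K (n + 1) (τ + (t - s)) (f s)) := by
  have hint : IntegrableOn (fun s => K (n + 1) (τ + (t - s)) (f s)) (Ioc 0 t) := by
    have hc : ContinuousOn (fun s => K (n + 1) (τ + (t - s))) (Icc 0 t) :=
      (hK.continuousOn (n + 1)).comp (by fun_prop) fun s hs => by
        simp only [mem_Ioi]; linarith [hs.2]
    obtain ⟨B, hB⟩ := isCompact_Icc.exists_bound_of_continuousOn hc
    exact integrableOn_clm_apply measurableSet_Ioc (hc.mono Ioc_subset_Icc_self)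
      (fun s hs => hB s (Ioc_subset_Icc_self hs)) hf
  have h1 := hy (ContinuousLinearMap.adjoint (K n τ) h)
  rw [ContinuousLinearMap.adjoint_inner_left] at h1
  have hfst : Tendsto (fun p : ℝ × ℝ => p.1) (𝓝[>] 0 ×ˢ 𝓝[>] 0) (𝓝 0) :=
    (tendsto_fst (f := 𝓝[>] (0 : ℝ)) (g := 𝓝[>] (0 : ℝ))).mono_right nhdsWithin_le_nhds
  have hsnd : Tendsto (fun p : ℝ × ℝ => t - p.2) (𝓝[>] 0 ×ˢ 𝓝[>] 0) (𝓝 t) := by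
    simpa using (tendsto_const_nhds (x := t)).sub
      ((tendsto_snd (f := 𝓝[>] (0 : ℝ)) (g := 𝓝[>] (0 : ℝ))).mono_right nhdsWithin_le_nhds)
  have h2 := tendsto_intervalIntegral_Ioc (hint.const_inner (𝕜 := ℂ) h) hfst hsnd (by
    filter_upwards [eventually_forward ht] with p hp
    exact ⟨hp.1.le, hp.2.2.le, by linarith [hp.2.1]⟩)
  refine tendsto_nhds_unique (h1.congr' ?_) h2
  filter_upwards [eventually_forward ht] with p ⟨hp1, hp2, hp3⟩
  have hi : IntervalIntegrable (fun s => K 1 (t - s) (f s)) volume p.1 (t - p.2) :=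
    (intervalIntegrable_iff_integrableOn_Icc_of_le hp3.le).2
      (hK.integrableOn_Icc_apply 1 (φ := fun s => t - s) (by fun_prop)
        (fun s hs => by linarith [hs.2])
        (hf.mono_set fun s hs => ⟨hp1.trans_le hs.1, by linarith [hs.2]⟩))
  rw [inner_intervalIntegral hi]
  refine intervalIntegral.integral_congr fun s hs => ?_
  rw [uIcc_of_le hp3.le] at hs
  rw [ContinuousLinearMap.adjoint_inner_left, hK.mul_apply n 1 hτ (by linarith [hs.2])]

/-- The product of K n t and K 1 (s-t) no longer depends on t. This is why the backward balayage
formulae reduce to a scalar Fubini theorem on the cone t < s. -/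
theorem inner_apply_of_backwardValue (hK : ExpFamily K) {f : ℝ → H} {t : ℝ} (ht : 0 < t)
    (n : ℕ) (hf : ∀ a b, 0 < a → IntegrableOn f (Icc a b)) {y : H} (hy : BackwardValue K f t y)
    {h : H} (hi : IntegrableOn (fun s => inner ℂ h (K (n + 1) s (f s))) (Ioi t)) :
    inner ℂ h (K n t y) = ∫ s in Ioi t, inner ℂ h (K (n + 1) s (f s)) := by
  have h1 := hy (ContinuousLinearMap.adjoint (K n t) h)
  rw [ContinuousLinearMap.adjoint_inner_left] at h1
  have hfst : Tendsto (fun p : ℝ × ℝ => t + p.1) (𝓝[>] 0 ×ˢ atTop) (𝓝 t) := by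
    simpa using (tendsto_const_nhds (x := t)).add tendsto_fst_nhdsGT_atTop
  have h2 := tendsto_intervalIntegral_Ioi hi hfst
    (tendsto_snd (f := 𝓝[>] (0 : ℝ)) (g := atTop)) (by
      filter_upwards [eventually_backward t] with p hp
      linarith [hp.1])
  refine tendsto_nhds_unique (h1.congr' ?_) h2
  filter_upwards [eventually_backward t] with p ⟨hp1, hp2, hp3, _⟩
  have hi : IntervalIntegrable (fun s => K 1 (s - t) (f s)) volume (t + p.1) p.2 :=
    (intervalIntegrable_iff_integrableOn_Icc_of_le hp3.le).2
      (hK.integrableOn_Icc_apply 1 (φ := fun s => s - t) (by fun_prop)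
        (fun s hs => by linarith [hs.1]) (hf _ _ (by linarith)))
  rw [inner_intervalIntegral hi]
  refine intervalIntegral.integral_congr fun s hs => ?_
  rw [uIcc_of_le hp3.le] at hs
  rw [ContinuousLinearMap.adjoint_inner_left, hK.mul_apply n 1 ht (by linarith [hs.1]),
    add_sub_cancel]

/-- The semigroup law removes s from the operator: the integrand is s^N A^{N+1} e^{-tA} x. -/
theorem forwardValue_pow_smul (hK : ExpFamily K) (N : ℕ) (x : H) {t : ℝ} (ht : 0 < t) :
    ForwardValue K (fun s => (s : ℂ) ^ N • K N s x) t
      (((N : ℂ) + 1)⁻¹ • ((t : ℂ) ^ (N + 1) • K (N + 1) t x)) := by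
  intro h
  have hfst : Tendsto (fun p : ℝ × ℝ => p.1) (𝓝[>] 0 ×ˢ 𝓝[>] 0) (𝓝 0) :=
    (tendsto_fst (f := 𝓝[>] (0 : ℝ)) (g := 𝓝[>] (0 : ℝ))).mono_right nhdsWithin_le_nhds
  have hsnd : Tendsto (fun p : ℝ × ℝ => t - p.2) (𝓝[>] 0 ×ˢ 𝓝[>] 0) (𝓝 t) := by
    simpa using (tendsto_const_nhds (x := t)).sub
      ((tendsto_snd (f := 𝓝[>] (0 : ℝ)) (g := 𝓝[>] (0 : ℝ))).mono_right nhdsWithin_le_nhds)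
  have hd := (((hsnd.pow (N + 1)).sub (hfst.pow (N + 1))).div_const ((N : ℝ) + 1)).smul_const
    (K (N + 1) t x)
  have e0 : ((t ^ (N + 1) - 0 ^ (N + 1)) / ((N : ℝ) + 1)) • K (N + 1) t x =
      ((N : ℂ) + 1)⁻¹ • ((t : ℂ) ^ (N + 1) • K (N + 1) t x) := by
    rw [smul_smul, ← Complex.coe_smul]
    congr 1
    push_cast
    rw [zero_pow N.succ_ne_zero, sub_zero, div_eq_inv_mul]
  rw [e0] at hd
  refine (tendsto_const_nhds (x := h)).inner (hd.congr' ?_)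
  filter_upwards [eventually_forward ht] with p ⟨hp1, hp2, hp3⟩
  rw [← integral_pow, ← intervalIntegral.integral_smul_const]
  refine intervalIntegral.integral_congr fun s hs => ?_
  rw [uIcc_of_le hp3.le] at hs
  rw [map_smul, hK.mul_apply 1 N (by linarith [hs.2]) (hp1.trans_le hs.1), sub_add_cancel,
    add_comm 1 N, ← Complex.coe_smul]
  push_cast
  rfl

theorem hasDerivAt_affine_apply (hK : ExpFamily K) (n : ℕ) {c d t : ℝ} (ht : 0 < c * t + d)
    (x : H) : HasDerivAt (fun t => K n (c * t + d) x) (-(c • K (n + 1) (c * t + d) x)) t := by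
  have h1 := hasDerivAt_clm_apply_const (hK.deriv n _ ht) x
  have h2 : HasDerivAt (fun t : ℝ => c * t + d) c t := by
    simpa using ((hasDerivAt_id t).const_mul c).add_const d
  have h3 := h1.scomp t h2
  rwa [neg_apply, smul_neg] at h3

theorem tendsto_atTop (hK : ExpFamily K) (n : ℕ) : Tendsto (K (n + 1)) atTop (𝓝 0) := by
  obtain ⟨C, hC0, hC⟩ := hK.bound (n + 1)
  refine squeeze_zero_norm' ?_ ((tendsto_const_nhds (x := C)).div_atTop
    (tendsto_pow_atTop n.succ_ne_zero))
  filter_upwards [eventually_gt_atTop 0] with t ht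
  exact hC t ht

/-- The integrand A² e^{-((κ+1)s-t)A} x is an exact derivative; the term at infinity decays and the
one at s = t gives the value. -/
theorem backwardValue_comp_mul (hK : ExpFamily K) {κ : ℝ} (hκ : 0 < κ) (x : H) {t : ℝ}
    (ht : 0 < t) :
    BackwardValue K (fun s => K 1 (κ * s) x) t ((κ + 1)⁻¹ • K 1 (κ * t) x) := by
  intro h
  have hc : 0 < κ + 1 := by linarith
  have hpos : ∀ s, t ≤ s → 0 < (κ + 1) * s + -t := fun s hs => by nlinarith
  have hfst : Tendsto (fun p : ℝ × ℝ => (κ + 1) * (t + p.1) + -t) (𝓝[>] 0 ×ˢ atTop)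
      (𝓝 ((κ + 1) * (t + 0) + -t)) :=
    ((tendsto_const_nhds.add tendsto_fst_nhdsGT_atTop).const_mul _).add_const _
  have e0 : (κ + 1) * (t + 0) + -t = κ * t := by ring
  rw [e0] at hfst
  have hsnd : Tendsto (fun p : ℝ × ℝ => (κ + 1) * p.2 + -t) (𝓝[>] 0 ×ˢ atTop) atTop :=
    tendsto_atTop_add_const_right _ _ (tendsto_snd.const_mul_atTop hc)
  have hcont : Tendsto (K 1) (𝓝 (κ * t)) (𝓝 (K 1 (κ * t))) :=
    (hK.deriv 1 (κ * t) (by positivity)).continuousAt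
  have happ : Continuous fun T : H →L[ℂ] H => T x := by fun_prop
  have h1 := (happ.tendsto _).comp (hcont.comp hfst)
  have h2 := (happ.tendsto _).comp ((hK.tendsto_atTop 0).comp hsnd)
  have h3 := (h1.sub h2).const_smul (κ + 1)⁻¹
  simp only [zero_apply, sub_zero] at h3
  refine (tendsto_const_nhds (x := h)).inner (h3.congr' ?_)
  filter_upwards [eventually_backward t] with p ⟨hp1, hp2, hp3, _⟩
  have hcd : ContinuousOn (fun s => K 2 ((κ + 1) * s + -t) x) (uIcc (t + p.1) p.2) := by
    rw [uIcc_of_le hp3.le]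
    exact fun s hs => (hK.hasDerivAt_affine_apply 2
      (hpos s (by linarith [hs.1])) x).continuousAt.continuousWithinAt
  have hF := intervalIntegral.integral_eq_sub_of_hasDerivAt
    (f := fun s => K 1 ((κ + 1) * s + -t) x)
    (f' := fun s => -((κ + 1) • K 2 ((κ + 1) * s + -t) x)) (a := t + p.1) (b := p.2)
    (fun s hs => by
      rw [uIcc_of_le hp3.le] at hs
      exact hK.hasDerivAt_affine_apply 1 (hpos s (by linarith [hs.1])) x)
    ((hcd.const_smul (κ + 1)).neg.intervalIntegrable)
  rw [intervalIntegral.integral_neg, intervalIntegral.integral_smul, neg_eq_iff_eq_neg,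
    neg_sub] at hF
  simp only [Function.comp_apply]
  rw [← hF, inv_smul_smul₀ hc.ne']
  refine intervalIntegral.integral_congr fun s hs => ?_
  rw [uIcc_of_le hp3.le] at hs
  rw [hK.mul_apply 1 1 (by linarith [hs.1]) (mul_pos hκ (by linarith [hs.1]))]
  congr 2
  ring

/-- Weak integration of `t ^ m A ^ n e^{-tA}` against the backward maximal regularity operator. -/
theorem exists_hasWeakIntegral_backward (hK : ExpFamily K) (m n : ℕ) {f Y : ℝ → H}
    (hf : ∀ a b, 0 < a → IntegrableOn f (Icc a b))
    (hi : ∀ h : H, IntegrableOn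
      (fun s : ℝ => inner ℂ h ((s : ℂ) ^ (m + 1) • K (n + 1) s (f s))) (Ioi 0))
    (hY : ∀ᵐ t ∂volume.restrict (Ioi (0 : ℝ)), BackwardValue K f t (Y t)) :
    ∃ v : H, HasWeakIntegral (fun s : ℝ => (s : ℂ) ^ (m + 1) • K (n + 1) s (f s)) v ∧
      HasWeakIntegral (fun t : ℝ => (t : ℂ) ^ m • K n t (Y t)) (((m : ℂ) + 1)⁻¹ • v) := by
  obtain ⟨v, hv, -⟩ := exists_hasWeakIntegral
    (F := fun s : ℝ => (s : ℂ) ^ (m + 1) • K (n + 1) s (f s)) (fun a b ha _ => by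
      refine IntegrableOn.continuousOn_smul
        (hK.integrableOn_Icc_apply (n + 1) continuous_id (fun s hs => ha.trans_le hs.1)
          (hf a b ha)) (f := fun s : ℝ => (s : ℂ) ^ (m + 1))
        (Continuous.continuousOn (by fun_prop)) isCompact_Icc) hi
  refine ⟨v, hv, fun h => ?_⟩
  -- The cone formula is applied to the integrable function with the weight s^{m+1}, which is
  -- divided out again inside the inner integral.
  obtain ⟨h1, h2⟩ := integral_pow_mul_integral_Ioi (hi h) m
  rw [(hv h).2] at h2
  have key : (fun t : ℝ => (t : ℂ) ^ m * ∫ s in Ioi t,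
      ((s : ℂ) ^ (m + 1))⁻¹ * inner ℂ h ((s : ℂ) ^ (m + 1) • K (n + 1) s (f s)))
      =ᵐ[volume.restrict (Ioi 0)] fun t : ℝ => inner ℂ h ((t : ℂ) ^ m • K n t (Y t)) := by
    filter_upwards [hY, ae_pos] with t hYt ht
    have e : ∀ s ∈ Ioi t, ((s : ℂ) ^ (m + 1))⁻¹ *
        inner ℂ h ((s : ℂ) ^ (m + 1) • K (n + 1) s (f s)) = inner ℂ h (K (n + 1) s (f s)) := by
      intro s hs
      have : (s : ℂ) ≠ 0 := by exact_mod_cast (ht.trans hs).ne'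
      rw [inner_smul_right, inv_mul_cancel_left₀ (pow_ne_zero _ this)]
    rw [setIntegral_congr_fun measurableSet_Ioi e, inner_smul_right (𝕜 := ℂ),
      hK.inner_apply_of_backwardValue ht n hf hYt]
    refine IntegrableOn.congr_fun ?_ e measurableSet_Ioi
    have hit := (hi h).mono_set (Ioi_subset_Ioi ht.le)
    refine (hit.norm.const_mul (t ^ (m + 1))⁻¹).mono' ?_ ?_
    · exact AEStronglyMeasurable.mul (Measurable.aestronglyMeasurable (by fun_prop)) hit.1
    · filter_upwards [ae_restrict_mem measurableSet_Ioi] with s hs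
      have hs' : t < s := hs
      rw [norm_mul, norm_inv, norm_pow, Complex.norm_real, Real.norm_of_nonneg (ht.trans hs').le]
      gcongr
  refine ⟨h1.congr key, ?_⟩
  rw [← integral_congr_ae key, h2, inner_smul_right]

/-- Weak integration of `A e^{-κtA}` against the forward maximal regularity operator. -/
theorem exists_hasWeakIntegral_forward (hK : ExpFamily K)
    (hQ : ∀ h : H, MemLp (fun s => √s • ContinuousLinearMap.adjoint (K 1 s) h) 2
      (volume.restrict (Ioi 0))) {κ : ℝ} (hκ : 0 < κ) {f Y : ℝ → H}
    (hf : MemLp (fun t => (√t)⁻¹ • f t) 2 (volume.restrict (Ioi 0)))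
    (hY : ∀ᵐ t ∂volume.restrict (Ioi (0 : ℝ)), ForwardValue K f t (Y t)) :
    ∃ v : H, HasWeakIntegral (fun s => K 1 (κ * s) (f s)) v ∧
      HasWeakIntegral (fun t => K 1 (κ * t) (Y t)) (((κ : ℂ) + 1)⁻¹ • v) := by
  have hloc : ∀ a b, 0 < a → IntegrableOn (fun s => K 1 (κ * s) (f s)) (Icc a b) :=
    fun a b ha => hK.integrableOn_Icc_apply 1 (by fun_prop)
      (fun s hs => mul_pos hκ (ha.trans_le hs.1)) (integrableOn_Icc_of_inv_sqrt hf a b ha)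
  have hfm : AEStronglyMeasurable f (volume.restrict (Ioi 0)) :=
    aestronglyMeasurable_of_integrableOn_Icc (integrableOn_Icc_of_inv_sqrt hf)
  have hfn : ∀ s, 0 < s → ‖f s‖ = √s * ‖(√s)⁻¹ • f s‖ := by
    intro s hs
    have := Real.sqrt_pos.2 hs
    rw [norm_smul, norm_inv, Real.norm_of_nonneg this.le, mul_inv_cancel_left₀ this.ne']
  obtain ⟨v, hv, -⟩ := exists_hasWeakIntegral (fun a b ha _ => hloc a b ha) fun h => by
    refine integrableOn_of_norm_le_mul
      ((aestronglyMeasurable_of_integrableOn_Icc hloc).const_inner)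
      (memLp_sqrt_mul_norm_comp_mul (hQ h) hκ) hf.norm fun s hs => ?_
    rw [← ContinuousLinearMap.adjoint_inner_left]
    refine (norm_inner_le_norm _ _).trans_eq ?_
    rw [hfn s hs]
    ring
  refine ⟨v, hv, fun h => ?_⟩
  have hc : 0 < κ + 1 := by linarith
  set U : Set (ℝ × ℝ) := {p | 0 < p.2 ∧ p.2 < p.1} with hUdef
  have hU : MeasurableSet U := (measurableSet_lt measurable_const measurable_snd).inter
    (measurableSet_lt measurable_snd measurable_fst)
  set Φ : ℝ × ℝ → H := U.indicator fun p => K 2 (κ * p.1 + (p.1 - p.2)) (f p.2) with hΦ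
  have hpos : ∀ t s, 0 < t → s ≤ t → 0 < κ * t + (t - s) := fun t s ht hst => by
    have := mul_pos hκ ht
    linarith
  have hΦm : AEStronglyMeasurable (fun p => inner ℂ h (Φ p))
      ((volume.restrict (Ioi 0)).prod (volume.restrict (Ioi 0))) :=
    (aestronglyMeasurable_indicator_clm_apply hU (hK.continuousOn_comp_prod 2
      (φ := fun p => κ * p.1 + (p.1 - p.2)) (by fun_prop)
      fun p hp => hpos _ _ (hp.1.trans hp.2) hp.2.le) hfm).const_inner
  obtain ⟨C, hC0, hC⟩ := hK.bound 1
  have hint : Integrable (fun p => inner ℂ h (Φ p))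
      ((volume.restrict (Ioi 0)).prod (volume.restrict (Ioi 0))) := by
    -- The time κt is halved: one half goes to h and feeds the quadratic estimate, the other half
    -- supplies C/(κt/2), and √s ≤ √t converts the weight of f. The outcome is 1/max(t,s) times two
    -- functions in L².
    refine integrable_prod_of_kernel hΦm
      ((memLp_sqrt_mul_norm_comp_mul (hQ h) (half_pos hκ)).const_mul (C / (κ / 2))) hf.norm
      fun t s ht hs => ?_
    by_cases hp : (t, s) ∈ U
    swap
    · rw [hΦ, indicator_of_notMem hp, inner_zero_right, norm_zero]
      positivity
    have hst : s < t := hp.2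
    have hκt : 0 < κ / 2 * t := by positivity
    rw [hΦ, indicator_of_mem hp, max_eq_left hst.le, ← ContinuousLinearMap.adjoint_inner_left]
    refine (norm_inner_le_norm _ _).trans ?_
    have e1 := hK.adjoint_apply 1 1 (s := κ / 2 * t + (t - s)) (by linarith) hκt h
    have e2 : κ / 2 * t + (t - s) + κ / 2 * t = κ * t + (t - s) := by ring
    rw [e2] at e1
    have e3 : ‖ContinuousLinearMap.adjoint (K 2 (κ * t + (t - s))) h‖ ≤
        C / (κ / 2 * t) * ‖ContinuousLinearMap.adjoint (K 1 (κ / 2 * t)) h‖ := by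
      rw [← e1]
      refine (ContinuousLinearMap.le_opNorm _ _).trans ?_
      rw [LinearIsometryEquiv.norm_map]
      gcongr
      refine (hC _ (by linarith)).trans ?_
      rw [pow_one]
      gcongr
      linarith
    have e4 : ‖f s‖ ≤ √t * ‖(√s)⁻¹ • f s‖ := by
      rw [hfn s hs]
      gcongr
    refine (mul_le_mul e3 e4 (norm_nonneg _) (by positivity)).trans_eq ?_
    field_simp
  have hL : ∀ᵐ t ∂volume.restrict (Ioi (0 : ℝ)), ∫ s in Ioi (0 : ℝ), inner ℂ h (Φ (t, s)) =
      inner ℂ h (K 1 (κ * t) (Y t)) := by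
    filter_upwards [hY, ae_pos] with t hYt ht
    rw [hK.inner_apply_of_forwardValue ht (mul_pos hκ ht) 1 (integrableOn_Ioc_of_inv_sqrt hf t)
      hYt h, setIntegral_eq_of_subset_of_forall_sdiff_eq_zero (s := Ioo 0 t) measurableSet_Ioi
      Ioo_subset_Ioi_self fun s hs => by
        rw [hΦ, indicator_of_notMem (s := U) (a := (t, s)) (fun h => hs.2 h), inner_zero_right],
      integral_Ioc_eq_integral_Ioo]
    refine setIntegral_congr_fun measurableSet_Ioo fun s hs => ?_
    have hmem : (t, s) ∈ U := hs
    simp only [hΦ, indicator_of_mem hmem]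
  -- For fixed s the integrand in t is A² e^{-((κ+1)t-s)A}, again an exact derivative; the boundary
  -- term at t = s yields the factor 1/(κ+1).
  have hR : ∀ᵐ s ∂volume.restrict (Ioi (0 : ℝ)), ∫ t in Ioi (0 : ℝ), inner ℂ h (Φ (t, s)) =
      ((κ : ℂ) + 1)⁻¹ * inner ℂ h (K 1 (κ * s) (f s)) := by
    filter_upwards [hint.prod_left_ae, ae_pos] with s his hs
    have e1 : ∀ t ∈ Ioi s, inner ℂ h (Φ (t, s)) =
        inner ℂ h (K 2 ((κ + 1) * t + -s) (f s)) := by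
      intro t ht
      have hmem : (t, s) ∈ U := ⟨hs, ht⟩
      simp only [hΦ, indicator_of_mem hmem]
      rw [show κ * t + (t - s) = (κ + 1) * t + -s by ring]
    rw [setIntegral_eq_of_subset_of_forall_sdiff_eq_zero (s := Ioi s) measurableSet_Ioi
      (Ioi_subset_Ioi hs.le) fun t ht => by
        rw [hΦ, indicator_of_notMem (s := U) (a := (t, s)) (fun h => ht.2 h.2), inner_zero_right],
      setIntegral_congr_fun measurableSet_Ioi e1]
    have hpos' : ∀ t ∈ Ici s, 0 < (κ + 1) * t + -s := fun t ht => by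
      have := hpos t s (hs.trans_le ht) ht
      linarith
    have hd : ∀ t ∈ Ici s, HasDerivAt
        (fun t => inner ℂ h (-((κ + 1)⁻¹ • K 1 ((κ + 1) * t + -s) (f s))))
        (inner ℂ h (K 2 ((κ + 1) * t + -s) (f s))) t := by
      intro t ht
      have h1 := ((hK.hasDerivAt_affine_apply 1 (hpos' t ht) (f s)).const_smul (κ + 1)⁻¹).neg
      rw [smul_neg, neg_neg, inv_smul_smul₀ hc.ne'] at h1
      simpa using (hasDerivAt_const t h).inner ℂ h1
    have hii : IntegrableOn (fun t => inner ℂ h (K 2 ((κ + 1) * t + -s) (f s))) (Ioi s) :=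
      (IntegrableOn.mono_set his (Ioi_subset_Ioi hs.le)).congr_fun e1 measurableSet_Ioi
    have hlim : Tendsto (fun t => inner ℂ h (-((κ + 1)⁻¹ • K 1 ((κ + 1) * t + -s) (f s))))
        atTop (𝓝 0) := by
      have happ : Continuous fun T : H →L[ℂ] H => inner ℂ h (-((κ + 1)⁻¹ • T (f s))) := by fun_prop
      have h1 := (happ.tendsto _).comp ((hK.tendsto_atTop 0).comp
        (tendsto_atTop_add_const_right _ (-s) (tendsto_id.const_mul_atTop hc)))
      simpa [Function.comp_def] using h1
    rw [integral_Ioi_of_hasDerivAt_of_tendsto' hd hii hlim, zero_sub, inner_neg_right, neg_neg,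
      ← Complex.coe_smul, inner_smul_right]
    have e2 : (κ + 1) * s + -s = κ * s := by ring
    rw [e2]
    push_cast
    rfl
  refine ⟨hint.integral_prod_left.congr hL, ?_⟩
  rw [← integral_congr_ae hL,
    integral_integral_swap (f := fun t s => inner ℂ h (Φ (t, s))) hint, integral_congr_ae hR,
    integral_const_mul, (hv h).2, inner_smul_right]

end ExpFamily

/-! ### The endpoint balayage formula for the forward operator -/

theorem setIntegral_Iio_indicator_Ioc (Φ : ℝ → H →L[ℂ] H) (f : ℝ → H) {ρ t R : ℝ} (hρ : ρ ≤ t)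
    (ht : t ≤ R) : ∫ σ in Iio t, Φ σ ((Ioc ρ R).indicator f σ) = ∫ s in ρ..t, Φ s (f s) := by
  have e1 : (fun σ => Φ σ ((Ioc ρ R).indicator f σ)) =
      (Ioc ρ R).indicator fun σ => Φ σ (f σ) := by
    ext σ
    by_cases hσ : σ ∈ Ioc ρ R
    · simp only [indicator_of_mem hσ]
    · simp only [indicator_of_notMem hσ, map_zero]
  have e2 : Iio t ∩ Ioc ρ R = Ioo ρ t := by
    ext σ
    simp only [mem_inter_iff, mem_Iio, mem_Ioc, mem_Ioo]
    exact ⟨fun h => ⟨h.2.1, h.1⟩, fun h => ⟨h.2, h.1, h.2.le.trans ht⟩⟩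
  rw [e1, setIntegral_indicator measurableSet_Ioc, e2, ← integral_Ioc_eq_integral_Ioo,
    intervalIntegral.integral_of_le hρ]

theorem HasImproperWeakIntegral.sub {F G : ℝ → H} {v w : H} (hF : HasImproperWeakIntegral F v)
    (hG : HasImproperWeakIntegral G w) :
    HasImproperWeakIntegral (fun t => F t - G t) (v - w) := by
  refine ⟨fun a b ha hab => (hF.1 a b ha hab).sub (hG.1 a b ha hab), fun h => ?_⟩
  rw [inner_sub_right]
  refine ((hF.2 h).sub (hG.2 h)).congr' ?_
  filter_upwards [eventually_backward 0] with p hp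
  have h2 : 0 < p.2 := by linarith [hp.2.2.2]
  rw [← inner_sub_right, intervalIntegral.integral_sub
    (intervalIntegrable_of_integrableOn_Icc hF.1 hp.1 h2)
    (intervalIntegrable_of_integrableOn_Icc hG.1 hp.1 h2)]

namespace ExpFamily

variable {K : ℕ → ℝ → H →L[ℂ] H}

/-- By the mean value inequality it suffices to bound K (n+1) z for z in [x, y]. A factor K 1 u is
moved onto h to invoke the quadratic estimate later; u ≤ x/2 leaves time at least x/2 for K n. -/
theorem exists_norm_inner_sub_le (hK : ExpFamily K) (n : ℕ) : ∃ C, 0 ≤ C ∧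
    ∀ u x y (h w : H), 0 < u → 2 * u ≤ x → x ≤ y →
      ‖inner ℂ h (K n x w) - inner ℂ h (K n y w)‖ ≤
        C / x ^ n * (y - x) * (‖ContinuousLinearMap.adjoint (K 1 u) h‖ * ‖w‖) := by
  obtain ⟨C, hC0, hC⟩ := hK.bound n
  refine ⟨C * 2 ^ n, by positivity, fun u x y h w hu hux hxy => ?_⟩
  have hx : 0 < x := by linarith
  have hd : ∀ z ∈ Icc x y, HasDerivWithinAt (fun z => inner ℂ h (K n z w))
      (-inner ℂ h (K (n + 1) z w)) (Icc x y) z := by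
    intro z hz
    have h1 := hasDerivAt_clm_apply_const (hK.deriv n z (hx.trans_le hz.1)) w
    have h2 := (hasDerivAt_const z h).inner ℂ h1
    simp only [neg_apply, inner_neg_right, inner_zero_left, add_zero] at h2
    exact h2.hasDerivWithinAt
  have hb : ∀ z ∈ Icc x y, ‖-inner ℂ h (K (n + 1) z w)‖ ≤
      C * 2 ^ n / x ^ n * (‖ContinuousLinearMap.adjoint (K 1 u) h‖ * ‖w‖) := by
    intro z hz
    have hzu : x / 2 ≤ z - u := by linarith [hz.1]
    have e := hK.mul_apply 1 n hu (show 0 < z - u by linarith [hz.1]) w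
    rw [add_sub_cancel, add_comm 1 n] at e
    rw [norm_neg, ← e, ← ContinuousLinearMap.adjoint_inner_left]
    refine (norm_inner_le_norm _ _).trans ?_
    have h1 : ‖K n (z - u) w‖ ≤ C * 2 ^ n / x ^ n * ‖w‖ := by
      refine (ContinuousLinearMap.le_opNorm _ _).trans ?_
      gcongr
      refine (hC _ (by linarith)).trans ?_
      rw [← div_div_eq_mul_div, ← div_pow]
      gcongr
    calc _ ≤ ‖ContinuousLinearMap.adjoint (K 1 u) h‖ * (C * 2 ^ n / x ^ n * ‖w‖) := by gcongr
      _ = _ := by ring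
  have := (convex_Icc x y).norm_image_sub_le_of_norm_hasDerivWithin_le hd hb
    (right_mem_Icc.2 hxy) (left_mem_Icc.2 hxy)
  refine this.trans_eq ?_
  rw [Real.norm_of_nonpos (by linarith)]
  ring

/-- This is the common majorant of the endpoint argument: Cauchy–Schwarz applied to √s (A
e^{-(s/2)A})* h and √s f. -/
theorem integrableOn_mul_norm_adjoint
    (hQ : ∀ h : H, MemLp (fun s => √s • ContinuousLinearMap.adjoint (K 1 s) h) 2
      (volume.restrict (Ioi 0))) {f : ℝ → H}
    (hf : MemLp (fun t => √t • f t) 2 (volume.restrict (Ioi 0))) (h : H) :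
    IntegrableOn (fun s => s * (‖ContinuousLinearMap.adjoint (K 1 (s / 2)) h‖ * ‖f s‖))
      (Ioi 0) := by
  refine Integrable.congr ((memLp_sqrt_mul_norm_comp_mul (hQ h)
    (show (0 : ℝ) < 2⁻¹ by norm_num)).integrable_mul hf.norm) ?_
  filter_upwards [ae_pos] with s hs
  have h1 := Real.mul_self_sqrt hs.le
  rw [Pi.mul_apply, norm_smul, Real.norm_of_nonneg (Real.sqrt_nonneg s), div_eq_inv_mul]
  calc _ = √s * √s * (‖ContinuousLinearMap.adjoint (K 1 (2⁻¹ * s)) h‖ * ‖f s‖) := by ring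
    _ = _ := by rw [h1]

/-- The difference e^{-sA} f(s) - e^{-κsA} f(s) is absolutely weakly integrable, because the mean
value bound supplies the factor s of the majorant. Improper convergence thus passes from one
exponent to the other. -/
theorem exists_hasImproperWeakIntegral_comp_mul (hK : ExpFamily K)
    (hQ : ∀ h : H, MemLp (fun s => √s • ContinuousLinearMap.adjoint (K 1 s) h) 2
      (volume.restrict (Ioi 0))) {κ : ℝ} (hκ : 1 ≤ κ) {f : ℝ → H}
    (hf : MemLp (fun t => √t • f t) 2 (volume.restrict (Ioi 0))) {F : H}
    (hF : HasImproperWeakIntegral (fun s => K 0 s (f s)) F) :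
    ∃ v : H, HasImproperWeakIntegral (fun s => K 0 (κ * s) (f s)) v := by
  have hκ0 : 0 < κ := by linarith
  have hfi := integrableOn_Icc_of_sqrt hf
  have hloc : ∀ a b, 0 < a →
      IntegrableOn (fun s => K 0 s (f s) - K 0 (κ * s) (f s)) (Icc a b) := fun a b ha =>
    (hK.integrableOn_Icc_apply 0 continuous_id (fun s hs => ha.trans_le hs.1) (hfi a b ha)).sub
      (hK.integrableOn_Icc_apply 0 (by fun_prop) (fun s hs => mul_pos hκ0 (ha.trans_le hs.1))
        (hfi a b ha))
  obtain ⟨C, hC0, hC⟩ := hK.exists_norm_inner_sub_le 0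
  obtain ⟨v, -, hv⟩ := exists_hasWeakIntegral (fun a b ha _ => hloc a b ha) fun h => by
    refine ((integrableOn_mul_norm_adjoint hQ hf h).const_mul (C * (κ - 1))).mono'
      (aestronglyMeasurable_of_integrableOn_Icc hloc).const_inner ?_
    filter_upwards [ae_pos] with s hs
    rw [inner_sub_right]
    refine (hC (s / 2) s (κ * s) h (f s) (half_pos hs) (by linarith)
      (le_mul_of_one_le_left hs.le hκ)).trans_eq ?_
    rw [pow_zero]
    ring
  refine ⟨F - v, ?_⟩
  simpa using hF.sub hv

/-- Here f is only integrable away from 0, so smoothing removes the singularity at t alone and a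
limit at the lower end remains. -/
theorem tendsto_inner_of_forwardValue (hK : ExpFamily K) {f : ℝ → H} {t τ : ℝ} (ht : 0 < t)
    (hτ : 0 < τ) (n : ℕ) (hf : ∀ a b, 0 < a → IntegrableOn f (Icc a b)) {y : H}
    (hy : ForwardValue K f t y) (h : H) :
    Tendsto (fun ρ => inner ℂ h (∫ s in ρ..t, K (n + 1) (τ + (t - s)) (f s))) (𝓝[>] 0)
      (𝓝 (inner ℂ h (K n τ y))) := by
  have h1 := hy (ContinuousLinearMap.adjoint (K n τ) h)
  rw [ContinuousLinearMap.adjoint_inner_left] at h1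
  rw [Metric.tendsto_nhds] at h1 ⊢
  intro ε hε
  obtain ⟨pa, hpa, pb, hpb, hp⟩ := eventually_prod_iff.1 (h1 (ε / 2) (half_pos hε))
  filter_upwards [hpa, Ioo_mem_nhdsGT ht] with ρ hρ hρt
  have hint : IntegrableOn (fun s => K (n + 1) (τ + (t - s)) (f s)) (Icc ρ t) :=
    hK.integrableOn_Icc_apply (n + 1) (φ := fun s => τ + (t - s)) (by fun_prop)
      (fun s hs => by linarith [hs.2]) (hf _ _ hρt.1)
  have hsnd : Tendsto (fun ε : ℝ => t - ε) (𝓝[>] 0) (𝓝 t) := by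
    simpa using (tendsto_const_nhds (x := t)).sub
      (tendsto_id.mono_right (nhdsWithin_le_nhds (a := 0) (s := Ioi (0 : ℝ))))
  have h2 := tendsto_intervalIntegral_Ioc (hint.mono_set Ioc_subset_Icc_self)
    (tendsto_const_nhds (x := ρ)) hsnd (by
      filter_upwards [Ioo_mem_nhdsGT (sub_pos.2 hρt.2)] with e he
      exact ⟨le_rfl, by linarith [he.2], by linarith [he.1]⟩)
  rw [← intervalIntegral.integral_of_le hρt.2.le] at h2
  refine lt_of_le_of_lt ?_ (half_lt_self hε)
  refine le_of_tendsto (((tendsto_const_nhds (x := h)).inner h2).dist tendsto_const_nhds) ?_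
  filter_upwards [hpb, Ioo_mem_nhdsGT (sub_pos.2 hρt.2)] with e he he'
  have hle : ρ ≤ t - e := by linarith [he'.2]
  have h3 := (hp hρ he).le
  have hi : IntervalIntegrable (fun s => K 1 (t - s) (f s)) volume ρ (t - e) :=
    (intervalIntegrable_iff_integrableOn_Icc_of_le hle).2
      (hK.integrableOn_Icc_apply 1 (φ := fun s => t - s) (by fun_prop)
        (fun s hs => by linarith [hs.2, he'.1]) (hf _ _ hρt.1))
  rw [ContinuousLinearMap.adjoint_inner_left,
    ← ContinuousLinearMap.intervalIntegral_comp_comm _ hi] at h3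
  convert h3 using 3
  refine intervalIntegral.integral_congr fun s hs => ?_
  rw [uIcc_of_le hle] at hs
  exact (hK.mul_apply n 1 hτ (by linarith [hs.2, he'.1]) _).symm

/-- This is `integral_integral_shift` with c = κ + 1 and e = 0 for f cut off to (ρ, R]. The
integrals from ρ to a and from ρ to R are the boundary terms to be controlled. -/
theorem intervalIntegral_intervalIntegral_shift (hK : ExpFamily K) {κ : ℝ} (hκ : 0 < κ) {f : ℝ → H}
    (hf : ∀ a b, 0 < a → IntegrableOn f (Icc a b)) {ρ a R : ℝ} (hρ : 0 < ρ) (hρa : ρ ≤ a)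
    (haR : a ≤ R) :
    ∫ t in a..R, ∫ s in ρ..t, K 1 (κ * t + (t - s)) (f s) =
      (κ + 1)⁻¹ • ((∫ s in a..R, K 0 (κ * s) (f s)) + (∫ s in ρ..a, K 0 (κ * a + (a - s)) (f s)) -
        ∫ s in ρ..R, K 0 (κ * R + (R - s)) (f s)) := by
  have ha : 0 < a := hρ.trans_le hρa
  have hfi : Integrable ((Ioc ρ R).indicator f) :=
    (integrable_indicator_iff measurableSet_Ioc).2 ((hf ρ R hρ).mono_set Ioc_subset_Icc_self)
  have h1 := hK.integral_integral_shift (c := κ + 1) (e := 0) (r := a) (T := R) (by linarith)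
    (by rw [add_sub_cancel_right, add_zero]; positivity) haR hfi
  have hint : ∀ x y, ρ ≤ x → x ≤ y →
      IntervalIntegrable (fun s => K 0 ((κ + 1) * max a s - s + 0) (f s)) volume x y :=
    fun x y hx hxy => (intervalIntegrable_iff_integrableOn_Icc_of_le hxy).2
      (hK.integrableOn_Icc_apply 0 (φ := fun s => (κ + 1) * max a s - s + 0) (by fun_prop)
        (fun s hs => by
          have h1 := le_max_left a s
          have h2 := le_max_right a s
          have h3 := mul_pos hκ (ha.trans_le h1)
          linarith) (hf _ _ (hρ.trans_le hx)))
  rw [setIntegral_Iio_indicator_Ioc (fun σ => K 0 ((κ + 1) * max a σ - σ + 0)) f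
      (hρa.trans haR) le_rfl,
    setIntegral_Iio_indicator_Ioc (fun σ => K 0 ((κ + 1) * R - σ + 0)) f
      (hρa.trans haR) le_rfl,
    ← intervalIntegral.integral_add_adjacent_intervals (hint ρ a le_rfl hρa) (hint a R hρa haR),
    ← intervalIntegral.integral_of_le haR] at h1
  have e1 : ∫ t in a..R, ∫ σ in Iio t, K 1 ((κ + 1) * t - σ + 0) ((Ioc ρ R).indicator f σ) =
      ∫ t in a..R, ∫ s in ρ..t, K 1 (κ * t + (t - s)) (f s) := by
    refine intervalIntegral.integral_congr fun t ht => ?_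
    rw [uIcc_of_le haR] at ht
    refine (setIntegral_Iio_indicator_Ioc (fun σ => K 1 ((κ + 1) * t - σ + 0)) f
      (hρa.trans ht.1) ht.2).trans ?_
    refine intervalIntegral.integral_congr fun s hs => ?_
    rw [show (κ + 1) * t - s + 0 = κ * t + (t - s) by ring]
  have e2 : ∫ s in a..R, K 0 ((κ + 1) * max a s - s + 0) (f s) =
      ∫ s in a..R, K 0 (κ * s) (f s) := by
    refine intervalIntegral.integral_congr fun s hs => ?_
    rw [uIcc_of_le haR] at hs
    rw [max_eq_right hs.1, show (κ + 1) * s - s + 0 = κ * s by ring]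
  have e3 : ∫ s in ρ..a, K 0 ((κ + 1) * max a s - s + 0) (f s) =
      ∫ s in ρ..a, K 0 (κ * a + (a - s)) (f s) := by
    refine intervalIntegral.integral_congr fun s hs => ?_
    rw [uIcc_of_le hρa] at hs
    rw [max_eq_left hs.2, show (κ + 1) * a - s + 0 = κ * a + (a - s) by ring]
  have e4 : ∫ s in ρ..R, K 0 ((κ + 1) * R - s + 0) (f s) =
      ∫ s in ρ..R, K 0 (κ * R + (R - s)) (f s) := by
    refine intervalIntegral.integral_congr fun s hs => ?_
    rw [show (κ + 1) * R - s + 0 = κ * R + (R - s) by ring]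
  rw [e1, e2, e3, e4] at h1
  rw [h1, add_comm (∫ s in a..R, K 0 (κ * s) (f s))]

end ExpFamily

theorem tendsto_setIntegral_Ioc_nhdsGT {g : ℝ → ℝ} (hg : IntegrableOn g (Ioi 0)) :
    Tendsto (fun a => ∫ s in Ioc 0 a, g s) (𝓝[>] 0) (𝓝 0) := by
  have h1 : IntegrableOn g (Icc 0 1) :=
    (integrableOn_Icc_iff_integrableOn_Ioc (by finiteness)).2
      (hg.mono_set Ioc_subset_Ioi_self)
  have h2 := (intervalIntegral.continuousOn_primitive h1) 0 (left_mem_Icc.2 zero_le_one)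
  have h3 : Tendsto (fun a => ∫ s in Ioc 0 a, g s) (𝓝[Icc 0 1] 0) (𝓝 0) := by
    simpa [ContinuousWithinAt] using h2
  refine h3.mono_left ?_
  rw [← nhdsWithin_Ioc_eq_nhdsGT (zero_lt_one' ℝ)]
  exact nhdsWithin_mono _ Ioc_subset_Icc_self

theorem tendsto_setIntegral_Ioi_atTop {g : ℝ → ℝ} (hg : IntegrableOn g (Ioi 0)) :
    Tendsto (fun R => ∫ s in Ioi R, g s) atTop (𝓝 0) := by
  have h1 := intervalIntegral_tendsto_integral_Ioi 0 hg tendsto_id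
  have h2 := (tendsto_const_nhds (x := ∫ s in Ioi 0, g s)).sub h1
  rw [sub_self] at h2
  refine h2.congr' ?_
  filter_upwards [eventually_ge_atTop 0] with R hR
  rw [sub_eq_iff_eq_add, id, intervalIntegral.integral_of_le hR, add_comm,
    ← setIntegral_union (Ioc_disjoint_Ioi le_rfl) measurableSet_Ioi
      (hg.mono_set Ioc_subset_Ioi_self) (hg.mono_set (Ioi_subset_Ioi hR)), Ioc_union_Ioi_eq_Ioi hR]

/-- The scalar kernel comparing `e^{-(κt+t-s)A}` with its reflection `e^{-(κt+t+s)A}`. -/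
noncomputable def reflectedPairing (K : ℕ → ℝ → H →L[ℂ] H) (κ : ℝ) (f : ℝ → H) (h : H) (n : ℕ)
    (t s : ℝ) : ℂ :=
  inner ℂ h (K n (κ * t + (t - s)) (f s)) - inner ℂ h (K n (κ * t + (t + s)) (f s))

namespace ExpFamily

variable {K : ℕ → ℝ → H →L[ℂ] H}

/-- The two times differ by 2s and are at least t ≥ s, so the mean value bound with u = s/2 yields
exactly the factor s of the majorant. -/
theorem exists_norm_reflectedPairing_le (hK : ExpFamily K) (n : ℕ) : ∃ C, 0 ≤ C ∧
    ∀ (κ : ℝ) (f : ℝ → H) (h : H) (t s : ℝ), 1 ≤ κ → 0 < s → s ≤ t →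
      ‖reflectedPairing K κ f h n t s‖ ≤
        C / t ^ n * (s * (‖ContinuousLinearMap.adjoint (K 1 (s / 2)) h‖ * ‖f s‖)) := by
  obtain ⟨C, hC0, hC⟩ := hK.exists_norm_inner_sub_le n
  refine ⟨2 * C, by positivity, fun κ f h t s hκ hs hst => ?_⟩
  have ht : 0 < t := hs.trans_le hst
  have h1 : t ≤ κ * t + (t - s) := by nlinarith
  refine (hC (s / 2) _ _ h (f s) (half_pos hs) (by linarith) (by linarith)).trans ?_
  calc _ ≤ C / t ^ n * (κ * t + (t + s) - (κ * t + (t - s))) *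
        (‖ContinuousLinearMap.adjoint (K 1 (s / 2)) h‖ * ‖f s‖) := by
        gcongr
        linarith
    _ = _ := by ring

theorem integrableOn_reflectedPairing (hK : ExpFamily K)
    (hQ : ∀ h : H, MemLp (fun s => √s • ContinuousLinearMap.adjoint (K 1 s) h) 2
      (volume.restrict (Ioi 0))) {κ : ℝ} (hκ : 1 ≤ κ) {f : ℝ → H}
    (hf : MemLp (fun t => √t • f t) 2 (volume.restrict (Ioi 0))) (h : H) (n : ℕ) (t : ℝ) :
    IntegrableOn (reflectedPairing K κ f h n t) (Ioc 0 t) := by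
  obtain ⟨C, hC0, hC⟩ := hK.exists_norm_reflectedPairing_le n
  have hfm : AEStronglyMeasurable f (volume.restrict (Ioc 0 t)) :=
    (aestronglyMeasurable_of_integrableOn_Icc (integrableOn_Icc_of_sqrt hf)).mono_measure
      (Measure.restrict_mono Ioc_subset_Ioi_self le_rfl)
  have hm : ∀ φ : ℝ → ℝ, Continuous φ → (∀ s ∈ Ioc 0 t, 0 < φ s) →
      AEStronglyMeasurable (fun s => K n (φ s) (f s)) (volume.restrict (Ioc 0 t)) :=
    fun φ hφ hpos => aestronglyMeasurable_clm_apply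
      (((hK.continuousOn n).comp hφ.continuousOn hpos).aestronglyMeasurable measurableSet_Ioc) hfm
  refine (((integrableOn_mul_norm_adjoint hQ hf h).mono_set
    Ioc_subset_Ioi_self).const_mul (C / t ^ n)).mono' ?_ ?_
  · refine AEStronglyMeasurable.sub
      (hm (fun s => κ * t + (t - s)) (by fun_prop) fun s hs => ?_).const_inner
      (hm (fun s => κ * t + (t + s)) (by fun_prop) fun s hs => ?_).const_inner
    · have := hs.1
      have := hs.2
      nlinarith
    · have := hs.1
      have := hs.2
      nlinarith
  · filter_upwards [ae_restrict_mem measurableSet_Ioc] with s hs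
    exact hC κ f h t s hκ hs.1 hs.2

/-- The reflected kernel factors through the primitive J, and the remaining pairing is absolutely
integrable down to 0. This isolates the conditional convergence as ρ → 0 in J(ρ). -/
theorem inner_integral_shift_eq (hK : ExpFamily K) {κ : ℝ} (hκ : 0 < κ) {f : ℝ → H}
    (hf : ∀ a b, 0 < a → IntegrableOn f (Icc a b)) {J : ℝ → H}
    (hJ : ∀ c c', 0 < c → 0 < c' → J c' = J c + ∫ t in c..c', K 0 t (f t)) (h : H) (n : ℕ)
    {ρ t : ℝ} (hρ : 0 < ρ) (ht : ρ ≤ t) :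
    inner ℂ h (∫ s in ρ..t, K n (κ * t + (t - s)) (f s)) =
      inner ℂ h (K n (κ * t + t) (J t - J ρ)) + ∫ s in ρ..t, reflectedPairing K κ f h n t s := by
  have ht0 : 0 < t := hρ.trans_le ht
  have hκt := mul_pos hκ ht0
  have hi : ∀ (n : ℕ) (φ : ℝ → ℝ), Continuous φ → (∀ s ∈ Icc ρ t, 0 < φ s) →
      IntervalIntegrable (fun s => K n (φ s) (f s)) volume ρ t :=
    fun n φ hφ hpos => (intervalIntegrable_iff_integrableOn_Icc_of_le ht).2
      (hK.integrableOn_Icc_apply n hφ hpos (hf _ _ hρ))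
  have h1 := hi n (fun s => κ * t + (t - s)) (by fun_prop) fun s hs => by linarith [hs.2]
  have h2 := hi n (fun s => κ * t + (t + s)) (by fun_prop) fun s hs => by linarith [hs.1]
  have h3 : IntervalIntegrable (fun s => K 0 s (f s)) volume ρ t := hi 0 id continuous_id fun s hs => hρ.trans_le hs.1
  have e1 : K n (κ * t + t) (J t - J ρ) = ∫ s in ρ..t, K n (κ * t + (t + s)) (f s) := by
    rw [hJ ρ t hρ ht0, add_sub_cancel_left,
      ← ContinuousLinearMap.intervalIntegral_comp_comm _ h3]
    refine intervalIntegral.integral_congr fun s hs => ?_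
    rw [uIcc_of_le ht] at hs
    rw [hK.mul_apply n 0 (by linarith) (hρ.trans_le hs.1), add_zero, add_assoc]
  have hc1 : IntervalIntegrable (fun s => inner ℂ h (K n (κ * t + (t - s)) (f s))) volume ρ t :=
    (intervalIntegrable_iff.2 (Integrable.const_inner h (intervalIntegrable_iff.1 h1)))
  have hc2 : IntervalIntegrable (fun s => inner ℂ h (K n (κ * t + (t + s)) (f s))) volume ρ t :=
    (intervalIntegrable_iff.2 (Integrable.const_inner h (intervalIntegrable_iff.1 h2)))
  simp only [reflectedPairing]
  rw [intervalIntegral.integral_sub hc1 hc2, e1, inner_intervalIntegral h1,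
    inner_intervalIntegral h2, add_sub_cancel]

theorem tendsto_inner_integral_shift (hK : ExpFamily K)
    (hQ : ∀ h : H, MemLp (fun s => √s • ContinuousLinearMap.adjoint (K 1 s) h) 2
      (volume.restrict (Ioi 0))) {κ : ℝ} (hκ : 1 ≤ κ) {f : ℝ → H}
    (hf : MemLp (fun t => √t • f t) 2 (volume.restrict (Ioi 0))) {J : ℝ → H}
    (hJ : ∀ c c', 0 < c → 0 < c' → J c' = J c + ∫ t in c..c', K 0 t (f t))
    (hJ0 : ∀ h, Tendsto (fun c => inner ℂ h (J c)) (𝓝[>] 0) (𝓝 0)) (h : H) (n : ℕ)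
    {t : ℝ} (ht : 0 < t) :
    Tendsto (fun ρ => inner ℂ h (∫ s in ρ..t, K n (κ * t + (t - s)) (f s))) (𝓝[>] 0)
      (𝓝 (inner ℂ h (K n (κ * t + t) (J t)) +
        ∫ s in Ioc 0 t, reflectedPairing K κ f h n t s)) := by
  have h1 := tendsto_intervalIntegral_Ioc (hK.integrableOn_reflectedPairing hQ hκ hf h n t)
    (a := fun ρ => ρ) (l := 𝓝[>] (0 : ℝ)) nhdsWithin_le_nhds (tendsto_const_nhds (x := t)) (by
      filter_upwards [Ioo_mem_nhdsGT ht] with ρ hρ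
      exact ⟨hρ.1.le, hρ.2.le, le_rfl⟩)
  have h2 := (tendsto_const_nhds (x := inner ℂ h (K n (κ * t + t) (J t)))).sub
    (hJ0 (ContinuousLinearMap.adjoint (K n (κ * t + t)) h))
  rw [sub_zero] at h2
  refine (h2.add h1).congr' ?_
  filter_upwards [Ioo_mem_nhdsGT ht] with ρ hρ
  rw [hK.inner_integral_shift_eq (by linarith) (integrableOn_Icc_of_sqrt hf) hJ h n hρ.1 hρ.2.le,
    map_sub, inner_sub_right, ContinuousLinearMap.adjoint_inner_left]

/-- J(a) tends weakly to 0 while the adjoint semigroup converges strongly on h, so their pairing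
vanishes; the other term is bounded by an integral of the majorant over (0, a]. -/
theorem tendsto_boundary_nhdsGT (hK : ExpFamily K)
    (hQ : ∀ h : H, MemLp (fun s => √s • ContinuousLinearMap.adjoint (K 1 s) h) 2
      (volume.restrict (Ioi 0))) {κ : ℝ} (hκ : 1 ≤ κ) {f : ℝ → H}
    (hf : MemLp (fun t => √t • f t) 2 (volume.restrict (Ioi 0))) {J : ℝ → H}
    (hJ0 : ∀ h, Tendsto (fun c => inner ℂ h (J c)) (𝓝[>] 0) (𝓝 0)) (h : H) :
    Tendsto (fun a => inner ℂ h (K 0 (κ * a + a) (J a)) +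
      ∫ s in Ioc 0 a, reflectedPairing K κ f h 0 a s) (𝓝[>] 0) (𝓝 0) := by
  have hlin : Tendsto (fun a : ℝ => κ * a + a) (𝓝[>] 0) (𝓝[>] 0) := by
    refine tendsto_nhdsWithin_iff.2 ⟨?_, ?_⟩
    · have : Continuous fun a : ℝ => κ * a + a := by fun_prop
      have := this.tendsto 0
      simp only [mul_zero, add_zero] at this
      exact this.mono_left nhdsWithin_le_nhds
    · filter_upwards [self_mem_nhdsWithin] with a ha
      have ha : 0 < a := ha
      simp only [mem_Ioi]
      nlinarith
  have h1 := tendsto_inner_of_weak_of_strong (x := J) (v := 0)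
    (fun z => by simpa using hJ0 z) ((hK.tendsto_adjoint_zero h).comp hlin)
  rw [inner_zero_right] at h1
  obtain ⟨C, hC0, hC⟩ := hK.exists_norm_reflectedPairing_le 0
  have hg := integrableOn_mul_norm_adjoint hQ hf h
  have h2 : Tendsto (fun a => ∫ s in Ioc 0 a, reflectedPairing K κ f h 0 a s) (𝓝[>] 0) (𝓝 0) := by
    refine squeeze_zero_norm (fun a => ?_)
      (by simpa using (tendsto_setIntegral_Ioc_nhdsGT hg).const_mul C)
    rw [← integral_const_mul]
    refine norm_integral_le_of_norm_le ((hg.mono_set Ioc_subset_Ioi_self).const_mul C) ?_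
    filter_upwards [ae_restrict_mem measurableSet_Ioc] with s hs
    simpa using hC κ f h a s hκ hs.1 hs.2
  simpa [ContinuousLinearMap.adjoint_inner_left] using h1.add h2

/-- With c = (κ+1)R, the pairing ⟨h, e^{-cA} J(R)⟩ is written as ⟨h, e^{-cA} F⟩ - ⟨h, F - J(R)⟩ +
⟨h, (1 - e^{-cA})(F - J(R))⟩. The first term vanishes by the decay of e^{-tA} F, the second by weak
convergence, the third by the mean value bound. -/
theorem tendsto_boundary_atTop (hK : ExpFamily K)
    (hQ : ∀ h : H, MemLp (fun s => √s • ContinuousLinearMap.adjoint (K 1 s) h) 2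
      (volume.restrict (Ioi 0))) {κ : ℝ} (hκ : 1 ≤ κ) {f : ℝ → H}
    (hf : MemLp (fun t => √t • f t) 2 (volume.restrict (Ioi 0))) {J : ℝ → H}
    (hJ : ∀ c c', 0 < c → 0 < c' → J c' = J c + ∫ t in c..c', K 0 t (f t)) {F : H}
    (hJF : ∀ h, Tendsto (fun c => inner ℂ h (J c)) atTop (𝓝 (inner ℂ h F)))
    (hF : Tendsto (fun t => K 0 t F) atTop (𝓝 0)) (h : H) :
    Tendsto (fun R => inner ℂ h (K 0 (κ * R + R) (J R)) +
      ∫ s in Ioc 0 R, reflectedPairing K κ f h 0 R s) atTop (𝓝 0) := by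
  have hfi := integrableOn_Icc_of_sqrt hf
  have hg := integrableOn_mul_norm_adjoint hQ hf h
  have hlin : Tendsto (fun R : ℝ => κ * R + R) atTop atTop :=
    (tendsto_id.const_mul_atTop (by linarith : (0 : ℝ) < κ)).atTop_add_atTop tendsto_id
  have h1 : Tendsto (fun R => inner ℂ h (K 0 (κ * R + R) F)) atTop (𝓝 0) := by
    simpa using (tendsto_const_nhds (x := h)).inner (𝕜 := ℂ) (hF.comp hlin)
  have h2 : Tendsto (fun R => inner ℂ h (F - J R)) atTop (𝓝 0) := by
    simpa [inner_sub_right] using (tendsto_const_nhds (x := inner ℂ h F)).sub (hJF h)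
  -- F - J(R) is the weak limit of integrals over (R, R']. There s ≥ R, so the time shift (κ+1)R is
  -- at most (κ+1)s and the difference is bounded by a tail of the majorant.
  have h3 : Tendsto (fun R => inner ℂ h (F - J R) - inner ℂ h (K 0 (κ * R + R) (F - J R)))
      atTop (𝓝 0) := by
    obtain ⟨C, hC0, hC⟩ := hK.exists_norm_inner_sub_le 0
    refine squeeze_zero_norm' ?_
      (by simpa using (tendsto_setIntegral_Ioi_atTop hg).const_mul (C * (κ + 1)))
    filter_upwards [eventually_gt_atTop 0] with R hR
    have hc : 0 < κ * R + R := by nlinarith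
    have hlim : Tendsto (fun R' => inner ℂ h (J R' - J R) -
        inner ℂ h (K 0 (κ * R + R) (J R' - J R))) atTop
        (𝓝 (inner ℂ h (F - J R) - inner ℂ h (K 0 (κ * R + R) (F - J R)))) := by
      simp only [map_sub, inner_sub_right, ← ContinuousLinearMap.adjoint_inner_left (K 0 (κ * R + R))]
      exact ((hJF _).sub_const _).sub ((hJF _).sub_const _)
    refine le_of_tendsto hlim.norm ?_
    filter_upwards [eventually_ge_atTop R] with R' hR'
    have hi0 : IntervalIntegrable (fun s => K 0 s (f s)) volume R R' :=
      (intervalIntegrable_iff_integrableOn_Icc_of_le hR').2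
        (hK.integrableOn_Icc_apply 0 continuous_id (fun s hs => hR.trans_le hs.1) (hfi _ _ hR))
    have hi1 : IntervalIntegrable (fun s => K 0 (κ * R + R + s) (f s)) volume R R' :=
      (intervalIntegrable_iff_integrableOn_Icc_of_le hR').2
        (hK.integrableOn_Icc_apply 0 (φ := fun s => κ * R + R + s) (by fun_prop)
          (fun s hs => by linarith [hs.1]) (hfi _ _ hR))
    have hc0 : IntervalIntegrable (fun s => inner ℂ h (K 0 s (f s))) volume R R' :=
      intervalIntegrable_iff.2 (Integrable.const_inner h (intervalIntegrable_iff.1 hi0))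
    have hc1 : IntervalIntegrable (fun s => inner ℂ h (K 0 (κ * R + R + s) (f s))) volume R R' :=
      intervalIntegrable_iff.2 (Integrable.const_inner h (intervalIntegrable_iff.1 hi1))
    have e1 : K 0 (κ * R + R) (∫ s in R..R', K 0 s (f s)) =
        ∫ s in R..R', K 0 (κ * R + R + s) (f s) := by
      rw [← ContinuousLinearMap.intervalIntegral_comp_comm _ hi0]
      refine intervalIntegral.integral_congr fun s hs => ?_
      rw [uIcc_of_le hR'] at hs
      exact hK.mul_apply 0 0 hc (hR.trans_le hs.1) _
    rw [hJ R R' hR (hR.trans_le hR'), add_sub_cancel_left, e1, inner_intervalIntegral hi0,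
      inner_intervalIntegral hi1, ← intervalIntegral.integral_sub hc0 hc1,
      intervalIntegral.integral_of_le hR', ← integral_const_mul]
    have hgR : IntegrableOn (fun s => C * (κ + 1) *
        (s * (‖ContinuousLinearMap.adjoint (K 1 (s / 2)) h‖ * ‖f s‖))) (Ioi R) :=
      (hg.mono_set (Ioi_subset_Ioi hR.le)).const_mul _
    refine (norm_integral_le_of_norm_le (hgR.mono_set Ioc_subset_Ioi_self) ?_).trans
      (setIntegral_mono_set hgR ?_ Ioc_subset_Ioi_self.eventuallyLE)
    · filter_upwards [ae_restrict_mem measurableSet_Ioc] with s hs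
      have hs0 : 0 < s := hR.trans hs.1
      refine (hC (s / 2) s (κ * R + R + s) h (f s) (half_pos hs0) (by linarith)
        (by linarith)).trans ?_
      rw [pow_zero, div_one, add_sub_cancel_right]
      have h5 : κ * R + R ≤ (κ + 1) * s := by nlinarith [hs.1]
      calc _ ≤ C * ((κ + 1) * s) * (‖ContinuousLinearMap.adjoint (K 1 (s / 2)) h‖ * ‖f s‖) := by
            gcongr
        _ = _ := by ring
    · filter_upwards [ae_restrict_mem measurableSet_Ioi] with s hs
      have hs0 : 0 < s := hR.trans hs
      have : 0 ≤ κ + 1 := by linarith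
      simp only [Pi.zero_apply]
      positivity
  -- For fixed s the reflected pairing is O(s/R), and the majorant dominates it uniformly in R.
  have h4 : Tendsto (fun R => ∫ s in Ioc 0 R, reflectedPairing K κ f h 0 R s) atTop (𝓝 0) := by
    obtain ⟨C, hC0, hC⟩ := hK.exists_norm_reflectedPairing_le 0
    obtain ⟨C₁, hC₁0, hC₁⟩ := hK.bound 1
    have h5 := tendsto_integral_filter_of_dominated_convergence (μ := volume.restrict (Ioi (0 : ℝ)))
      (l := atTop) (F := fun R s => (Ioc 0 R).indicator (reflectedPairing K κ f h 0 R) s)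
      (f := fun _ => (0 : ℂ))
      (fun s => C * (s * (‖ContinuousLinearMap.adjoint (K 1 (s / 2)) h‖ * ‖f s‖)))
      (.of_forall fun R => by
        rw [aestronglyMeasurable_indicator_iff measurableSet_Ioc,
          Measure.restrict_restrict measurableSet_Ioc, inter_eq_left.2 Ioc_subset_Ioi_self]
        exact (hK.integrableOn_reflectedPairing hQ hκ hf h 0 R).1)
      (.of_forall fun R => by
        filter_upwards [ae_pos] with s hs
        by_cases hsR : s ∈ Ioc 0 R
        · rw [indicator_of_mem hsR]
          simpa using hC κ f h R s hκ hsR.1 hsR.2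
        · rw [indicator_of_notMem hsR, norm_zero]
          positivity) (hg.const_mul C) (by
        filter_upwards [ae_pos] with s hs
        refine squeeze_zero_norm' (a := fun R => ‖h‖ * (C₁ / R * (2 * s) * ‖f s‖)) ?_ ?_
        · filter_upwards [eventually_ge_atTop s] with R hR
          have hR0 := hs.trans_le hR
          have hx : R ≤ κ * R + (R - s) := by nlinarith
          rw [indicator_of_mem (show s ∈ Ioc 0 R from ⟨hs, hR⟩), reflectedPairing,
            ← inner_sub_right, ← sub_apply]
          refine (norm_inner_le_norm _ _).trans ?_
          gcongr
          refine (ContinuousLinearMap.le_opNorm _ _).trans ?_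
          gcongr
          refine (hK.norm_sub_le_of_lt 0 hC₁ hC₁0 (hR0.trans_le hx) (by linarith)).trans ?_
          rw [zero_add, pow_one]
          have e : κ * R + (R + s) - (κ * R + (R - s)) = 2 * s := by ring
          rw [e]
          gcongr
        · simpa using ((((tendsto_const_nhds (x := C₁)).div_atTop tendsto_id).mul_const
            (2 * s)).mul_const ‖f s‖).const_mul ‖h‖)
    rw [integral_zero] at h5
    refine h5.congr fun R => ?_
    rw [integral_indicator measurableSet_Ioc, Measure.restrict_restrict measurableSet_Ioc,
      inter_eq_left.2 Ioc_subset_Ioi_self]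
  have h5 := ((h1.sub h2).add h3).add h4
  simp only [add_zero, sub_zero] at h5
  refine h5.congr fun R => ?_
  rw [map_sub, inner_sub_right, inner_sub_right]
  ring

theorem integrableOn_integral_shift (hK : ExpFamily K) {κ : ℝ} (hκ : 0 < κ) {f : ℝ → H}
    (hf : ∀ a b, 0 < a → IntegrableOn f (Icc a b)) {ρ a : ℝ} (R : ℝ) (hρ : 0 < ρ) (hρa : ρ ≤ a) :
    IntegrableOn (fun t => ∫ s in ρ..t, K 1 (κ * t + (t - s)) (f s)) (Ioc a R) := by
  set U : Set (ℝ × ℝ) := {p | ρ < p.2 ∧ p.2 < p.1} with hUdef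
  have hU : MeasurableSet U := (measurableSet_lt measurable_const measurable_snd).inter
    (measurableSet_lt measurable_snd measurable_fst)
  obtain ⟨C, hC0, hC⟩ := hK.bound 1
  have ha : 0 < a := hρ.trans_le hρa
  refine Integrable.mono' (g := fun _ => ∫ s in Icc ρ R, C / (κ * a) * ‖f s‖)
    (integrable_const _) ?_ ?_
  · refine (aestronglyMeasurable_integral_indicator (μ := volume.restrict (Ioc a R)) hU
      (hK.continuousOn_comp_prod 1 (φ := fun p => κ * p.1 + (p.1 - p.2)) (by fun_prop)
        fun p hp => ?_)
      (aestronglyMeasurable_of_integrableOn_Icc hf)).congr ?_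
    · have := mul_pos hκ (hρ.trans (hp.1.trans hp.2))
      linarith [hp.2]
    · filter_upwards [ae_restrict_mem measurableSet_Ioc] with t ht
      rw [setIntegral_eq_of_subset_of_forall_sdiff_eq_zero (s := Ioo ρ t) measurableSet_Ioi
        (Ioo_subset_Ioi_self.trans (Ioi_subset_Ioi hρ.le)) fun s hs =>
          indicator_of_notMem (s := U) (a := (t, s)) (fun h => hs.2 h) _,
        intervalIntegral.integral_of_le (hρa.trans ht.1.le), integral_Ioc_eq_integral_Ioo]
      refine setIntegral_congr_fun measurableSet_Ioo fun s hs => ?_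
      have hmem : (t, s) ∈ U := hs
      simp only [indicator_of_mem hmem]
  · filter_upwards [ae_restrict_mem measurableSet_Ioc] with t ht
    have ht0 : 0 < t := ha.trans ht.1
    have hfi : IntegrableOn (fun s => C / (κ * a) * ‖f s‖) (Icc ρ R) := (hf ρ R hρ).norm.const_mul _
    rw [intervalIntegral.integral_of_le (hρa.trans ht.1.le)]
    have hsub : Ioc ρ t ⊆ Icc ρ R := fun s hs => ⟨hs.1.le, hs.2.trans ht.2⟩
    refine (norm_integral_le_of_norm_le (hfi.mono_set hsub) ?_).trans
      (setIntegral_mono_set hfi (.of_forall fun s => ?_) hsub.eventuallyLE)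
    · filter_upwards [ae_restrict_mem measurableSet_Ioc] with s hs
      refine (ContinuousLinearMap.le_opNorm _ _).trans ?_
      gcongr
      have h1 : κ * a ≤ κ * t + (t - s) := by nlinarith [hs.2, ht.1]
      refine (hC _ (lt_of_lt_of_le (by positivity) h1)).trans ?_
      rw [pow_one]
      gcongr
    · simp only [Pi.zero_apply]
      positivity

/-- The identity holds exactly by Fubini's theorem once f is cut off at ρ > 0. As ρ → 0 the boundary
terms converge by `tendsto_inner_integral_shift` and the left side by dominated convergence in t. -/
theorem integral_inner_zero_forwardValue (hK : ExpFamily K)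
    (hQ : ∀ h : H, MemLp (fun s => √s • ContinuousLinearMap.adjoint (K 1 s) h) 2
      (volume.restrict (Ioi 0))) {κ : ℝ} (hκ : 1 ≤ κ) {f Y : ℝ → H}
    (hf : MemLp (fun t => √t • f t) 2 (volume.restrict (Ioi 0)))
    (hY : ∀ᵐ t ∂volume.restrict (Ioi (0 : ℝ)), ForwardValue K f t (Y t)) {J : ℝ → H}
    (hJ : ∀ c c', 0 < c → 0 < c' → J c' = J c + ∫ t in c..c', K 0 t (f t))
    (hJ0 : ∀ h, Tendsto (fun c => inner ℂ h (J c)) (𝓝[>] 0) (𝓝 0)) (h : H) {a R : ℝ} (ha : 0 < a)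
    (haR : a ≤ R) :
    ∫ t in a..R, inner ℂ h (K 0 (κ * t) (Y t)) =
      ((κ : ℂ) + 1)⁻¹ * (inner ℂ h (∫ s in a..R, K 0 (κ * s) (f s)) +
        (inner ℂ h (K 0 (κ * a + a) (J a)) + ∫ s in Ioc 0 a, reflectedPairing K κ f h 0 a s) -
        (inner ℂ h (K 0 (κ * R + R) (J R)) +
          ∫ s in Ioc 0 R, reflectedPairing K κ f h 0 R s)) := by
  have hκ0 : 0 < κ := by linarith
  have hR : 0 < R := ha.trans_le haR
  have hfi := integrableOn_Icc_of_sqrt hf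
  set ρ : ℕ → ℝ := fun n => a / (n + 1) with hρdef
  have hρ0 : ∀ n, 0 < ρ n := fun n => by positivity
  have hρa : ∀ n, ρ n ≤ a := fun n => div_le_self ha.le (by simp)
  have hρlim : Tendsto ρ atTop (𝓝[>] 0) := by
    refine tendsto_nhdsWithin_iff.2 ⟨?_, .of_forall hρ0⟩
    simpa [hρdef, div_eq_mul_inv] using (tendsto_one_div_add_atTop_nhds_zero_nat (𝕜 := ℝ)).const_mul a
  have hR1 := (hK.tendsto_inner_integral_shift hQ hκ hf hJ hJ0 h 0 ha).comp hρlim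
  have hR2 := (hK.tendsto_inner_integral_shift hQ hκ hf hJ hJ0 h 0 hR).comp hρlim
  have hRHS := (((tendsto_const_nhds (x := inner ℂ h (∫ s in a..R, K 0 (κ * s) (f s)))).add
    hR1).sub hR2).const_mul ((κ : ℂ) + 1)⁻¹
  -- Weak convergence to 0 bounds the vectors J(ρ n) uniformly, which provides a constant dominating
  -- function on (a, R].
  obtain ⟨B₁, hB₁⟩ := exists_norm_le_of_weak_tendsto (x := fun n => J (ρ n)) (v := 0)
    fun y => by simpa [Function.comp_def] using (hJ0 y).comp hρlim
  obtain ⟨B₂, hB₂⟩ : ∃ B, ∀ t ∈ Ioc a R, ‖J t‖ ≤ B := by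
    have hi : IntegrableOn (fun s => K 0 s (f s)) (Icc a R) :=
      hK.integrableOn_Icc_apply 0 continuous_id (fun s hs => ha.trans_le hs.1) (hfi _ _ ha)
    refine ⟨‖J a‖ + ∫ s in Icc a R, ‖K 0 s (f s)‖, fun t ht => ?_⟩
    have hsub : Ioc a t ⊆ Icc a R := fun s hs => ⟨hs.1.le, hs.2.trans ht.2⟩
    rw [hJ a t ha (ha.trans ht.1), intervalIntegral.integral_of_le ht.1.le]
    refine (norm_add_le _ _).trans (add_le_add_right ((norm_integral_le_integral_norm _).trans
      (setIntegral_mono_set hi.norm (.of_forall fun s => norm_nonneg _) hsub.eventuallyLE)) _)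
  obtain ⟨C₁, hC₁0, hC₁⟩ := hK.bound 1
  obtain ⟨C, hC0, hC⟩ := hK.exists_norm_reflectedPairing_le 1
  have hg := integrableOn_mul_norm_adjoint hQ hf h
  have hLHS := intervalIntegral.tendsto_integral_filter_of_dominated_convergence (μ := volume)
    (a := a) (b := R) (l := atTop)
    (F := fun n t => inner ℂ h (∫ s in (ρ n)..t, K 1 (κ * t + (t - s)) (f s)))
    (f := fun t => inner ℂ h (K 0 (κ * t) (Y t)))
    (fun _ => ‖h‖ * (C₁ / a * (B₂ + B₁)) + C / a *
      ∫ s in Ioi 0, s * (‖ContinuousLinearMap.adjoint (K 1 (s / 2)) h‖ * ‖f s‖))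
    (.of_forall fun n => by
      rw [uIoc_of_le haR]
      exact (hK.integrableOn_integral_shift hκ0 hfi R (hρ0 n) (hρa n)).1.const_inner)
    (.of_forall fun n => .of_forall fun t ht => by
      rw [uIoc_of_le haR] at ht
      have ht0 : 0 < t := ha.trans ht.1
      rw [hK.inner_integral_shift_eq hκ0 hfi hJ h 1 (hρ0 n) ((hρa n).trans ht.1.le)]
      refine (norm_add_le _ _).trans (add_le_add ?_ ?_)
      · refine (norm_inner_le_norm _ _).trans ?_
        gcongr
        refine (ContinuousLinearMap.le_opNorm _ _).trans ?_
        have h1 : a ≤ κ * t + t := by nlinarith [ht.1]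
        refine mul_le_mul ?_ ((norm_sub_le _ _).trans (add_le_add (hB₂ t ht) (hB₁ n)))
          (norm_nonneg _) (by positivity)
        refine (hC₁ _ (ha.trans_le h1)).trans ?_
        rw [pow_one]
        gcongr
      · rw [intervalIntegral.integral_of_le ((hρa n).trans ht.1.le), ← integral_const_mul]
        have hsub : Ioc (ρ n) t ⊆ Ioi 0 := fun s hs => (hρ0 n).trans hs.1
        refine (norm_integral_le_of_norm_le (IntegrableOn.mono_set (hg.const_mul (C / a)) hsub) ?_).trans
          (setIntegral_mono_set (hg.const_mul _) ?_ hsub.eventuallyLE)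
        · filter_upwards [ae_restrict_mem measurableSet_Ioc] with s hs
          have hs0 := hsub hs
          have hs0' : 0 < s := hs0
          refine (hC κ f h t s hκ hs0 hs.2).trans ?_
          rw [pow_one]
          have := ht.1.le
          gcongr
        · filter_upwards [ae_pos] with s hs
          simp only [Pi.zero_apply]
          positivity)
    intervalIntegrable_const (by
      have hY' := (ae_restrict_iff' measurableSet_Ioi).1 hY
      filter_upwards [hY'] with t hYt ht
      rw [uIoc_of_le haR] at ht
      have ht0 : 0 < t := ha.trans ht.1
      exact (hK.tendsto_inner_of_forwardValue ht0 (mul_pos hκ0 ht0) 0 hfi (hYt ht0) h).comp hρlim)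
  refine tendsto_nhds_unique hLHS (hRHS.congr fun n => ?_)
  have hI : IntervalIntegrable (fun t => ∫ s in (ρ n)..t, K 1 (κ * t + (t - s)) (f s)) volume a R :=
    (intervalIntegrable_iff_integrableOn_Ioc_of_le haR).2
      (hK.integrableOn_integral_shift hκ0 hfi R (hρ0 n) (hρa n))
  rw [← inner_intervalIntegral hI, hK.intervalIntegral_intervalIntegral_shift hκ0 hfi (hρ0 n)
    (hρa n) haR, ← Complex.coe_smul, inner_smul_right, inner_sub_right, inner_add_right]
  push_cast
  rfl

/-- Improper weak integration of `e^{-κtA}` against the forward maximal regularity operator. -/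
theorem exists_hasImproperWeakIntegral_forward (hK : ExpFamily K)
    (hQ : ∀ h : H, MemLp (fun s => √s • ContinuousLinearMap.adjoint (K 1 s) h) 2
      (volume.restrict (Ioi 0))) {κ : ℝ} (hκ : 1 ≤ κ) {f Y : ℝ → H}
    (hf : MemLp (fun t => √t • f t) 2 (volume.restrict (Ioi 0))) {F : H}
    (hF : HasImproperWeakIntegral (fun s => K 0 s (f s)) F)
    (hF0 : Tendsto (fun t => K 0 t F) atTop (𝓝 0))
    (hYi : ∀ a b, 0 < a → IntegrableOn Y (Icc a b))
    (hY : ∀ᵐ t ∂volume.restrict (Ioi (0 : ℝ)), ForwardValue K f t (Y t)) :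
    ∃ v : H, HasImproperWeakIntegral (fun s => K 0 (κ * s) (f s)) v ∧
      HasImproperWeakIntegral (fun t => K 0 (κ * t) (Y t)) (((κ : ℂ) + 1)⁻¹ • v) := by
  have hκ0 : 0 < κ := by linarith
  obtain ⟨v, hv⟩ := hK.exists_hasImproperWeakIntegral_comp_mul hQ hκ hf hF
  obtain ⟨J, -, hJ0, hJ, hJF⟩ := hF.exists_primitive
  have hYK : ∀ a b, 0 < a → a ≤ b → IntegrableOn (fun t => K 0 (κ * t) (Y t)) (Icc a b) :=
    fun a b ha _ => hK.integrableOn_Icc_apply 0 (by fun_prop)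
      (fun s hs => mul_pos hκ0 (ha.trans_le hs.1)) (hYi a b ha)
  refine ⟨v, hv, hYK, fun h => ?_⟩
  have h1 := (hK.tendsto_boundary_nhdsGT hQ hκ hf hJ0 h).comp
    (tendsto_fst (f := 𝓝[>] (0 : ℝ)) (g := atTop (α := ℝ)))
  have h2 := (hK.tendsto_boundary_atTop hQ hκ hf hJ hJF hF0 h).comp
    (tendsto_snd (f := 𝓝[>] (0 : ℝ)) (g := atTop (α := ℝ)))
  have h3 := (((hv.2 h).add h1).sub h2).const_mul ((κ : ℂ) + 1)⁻¹
  rw [add_zero, sub_zero, ← inner_smul_right] at h3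
  refine h3.congr' ?_
  filter_upwards [eventually_backward 0] with p ⟨hp1, hp2, hp3, _⟩
  rw [zero_add] at hp3
  rw [inner_intervalIntegral (intervalIntegrable_of_integrableOn_Icc hYK hp1 (hp1.trans hp3)),
    hK.integral_inner_zero_forwardValue hQ hκ hf hY hJ hJ0 h hp1 hp3.le]
  rfl

end ExpFamily

/-! ### Return to the operators of the statement -/

theorem HasWeakIntegral.congr {F G : ℝ → H} {v : H} (hF : HasWeakIntegral F v)
    (h : ∀ᵐ t ∂volume.restrict (Ioi (0 : ℝ)), F t = G t) : HasWeakIntegral G v := by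
  intro y
  have e : (fun t => inner ℂ y (F t)) =ᵐ[volume.restrict (Ioi 0)] fun t => inner ℂ y (G t) := by
    filter_upwards [h] with t ht
    rw [ht]
  exact ⟨(hF y).1.congr e, (integral_congr_ae e).symm.trans (hF y).2⟩

theorem HasImproperWeakIntegral.congr {F G : ℝ → H} {v : H} (hF : HasImproperWeakIntegral F v)
    (h : ∀ᵐ t ∂volume.restrict (Ioi (0 : ℝ)), F t = G t) : HasImproperWeakIntegral G v := by
  have h' := (ae_restrict_iff' measurableSet_Ioi).1 h
  refine ⟨fun a b ha hab => (hF.1 a b ha hab).congr (ae_restrict_of_ae_restrict_of_subset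
    (fun t ht => ha.trans_le ht.1) h), fun y => (hF.2 y).congr' ?_⟩
  filter_upwards [eventually_backward 0] with p hp
  congr 1
  refine intervalIntegral.integral_congr_ae ?_
  filter_upwards [h'] with t ht hmem
  exact ht ((lt_min hp.1 (by linarith [hp.2.2.2])).trans hmem.1)

theorem isForwardValue_iff {A : H →ₗ.[ℂ] H} {δ : ℝ} (hδ₀ : 0 < δ) (hδ₁ : δ < Real.pi / 2)
    {S : ℂ → H →L[ℂ] H} (hS : IsBoundedAnalyticSemigroup A δ S) {f : ℝ → H} {t : ℝ} (ht : 0 < t)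
    {y : H} : IsForwardValue A S f t y ↔ ForwardValue (powOp S) f t y := by
  refine forall_congr' fun h => tendsto_congr' ?_
  filter_upwards [eventually_forward ht] with p ⟨_, hp2, hp3⟩
  congr 1
  refine intervalIntegral.integral_congr fun s hs => ?_
  rw [uIcc_of_le hp3.le] at hs
  exact powExp_eq_powOp hδ₀ hδ₁ hS 1 (by linarith [hs.2]) _

theorem isBackwardValue_iff {A : H →ₗ.[ℂ] H} {δ : ℝ} (hδ₀ : 0 < δ) (hδ₁ : δ < Real.pi / 2)
    {S : ℂ → H →L[ℂ] H} (hS : IsBoundedAnalyticSemigroup A δ S) {f : ℝ → H} {t : ℝ} {y : H} :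
    IsBackwardValue A S f t y ↔ BackwardValue (powOp S) f t y := by
  refine forall_congr' fun h => tendsto_congr' ?_
  filter_upwards [eventually_backward t] with p ⟨hp1, _, hp3, _⟩
  congr 1
  refine intervalIntegral.integral_congr fun s hs => ?_
  rw [uIcc_of_le hp3.le] at hs
  exact powExp_eq_powOp hδ₀ hδ₁ hS 1 (by linarith [hs.1]) _

theorem IsForwardValue.forwardMR_eq {A : H →ₗ.[ℂ] H} {S : ℂ → H →L[ℂ] H} {f : ℝ → H} {t : ℝ}
    {y : H} (hy : IsForwardValue A S f t y) : forwardMR A S f t = y := by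
  have hc : ForwardConverges A S f t := ⟨y, hy⟩
  rw [forwardMR, dif_pos hc]
  exact ext_inner_left ℂ fun h => tendsto_nhds_unique (hc.choose_spec h) (hy h)

theorem IsBackwardValue.backwardMR_eq {A : H →ₗ.[ℂ] H} {S : ℂ → H →L[ℂ] H} {f : ℝ → H} {t : ℝ}
    {y : H} (hy : IsBackwardValue A S f t y) : backwardMR A S f t = y := by
  have hc : BackwardConverges A S f t := ⟨y, hy⟩
  rw [backwardMR, dif_pos hc]
  exact ext_inner_left ℂ fun h => tendsto_nhds_unique (hc.choose_spec h) (hy h)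

/-- The quadratic estimate bounds only a seminorm; measurability comes from continuity of T. The
weights combine as s² ds/s = s ds. -/
theorem QuadraticEstimate.memLp {A : H →ₗ.[ℂ] H} {S : ℂ → H →L[ℂ] H} (hQ : QuadraticEstimate A S)
    {T : ℝ → H} {h : H} (hT : ContinuousOn T (Ioi 0))
    (hAT : ∀ s, 0 < s → powExp A S 1 s h = T s) :
    MemLp (fun s => √s • T s) 2 (volume.restrict (Ioi 0)) := by
  obtain ⟨C, hC⟩ := hQ
  have hae : (fun s : ℝ => (s : ℂ) • T s) =ᵐ[volume.restrict (Ioi 0)]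
      fun s : ℝ => (s : ℂ) • powExp A S 1 s h := by
    filter_upwards [ae_pos] with s hs
    rw [hAT s hs]
  have hm : AEStronglyMeasurable (fun s : ℝ => (s : ℂ) • T s) (volume.restrict (Ioi 0)) :=
    ContinuousOn.aestronglyMeasurable
      ((Continuous.continuousOn (by fun_prop : Continuous fun s : ℝ => (s : ℂ))).smul hT)
      measurableSet_Ioi
  have hW : MemW (-1) fun s : ℝ => (s : ℂ) • powExp A S 1 s h :=
    ⟨(hm.congr hae).mono_ac (withDensity_absolutelyContinuous _ _),
      (hC h).trans_lt (ENNReal.mul_lt_top ENNReal.coe_lt_top enorm_lt_top)⟩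
  refine (memW_neg_one_iff.1 hW).ae_eq ?_
  filter_upwards [ae_pos] with s hs
  have := Real.sqrt_pos.2 hs
  rw [hAT s hs, Complex.coe_smul, smul_smul]
  congr 1
  rw [inv_mul_eq_div, Real.div_sqrt]

/-! ### Square function consequences of the quadratic estimates -/

namespace ExpFamily

variable {K : ℕ → ℝ → H →L[ℂ] H}

theorem continuousOn_apply (hK : ExpFamily K) (n : ℕ) (x : H) :
    ContinuousOn (fun s => K n s x) (Ioi 0) :=
  fun s hs => (hasDerivAt_clm_apply_const (hK.deriv n s hs) x).continuousAt.continuousWithinAt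

theorem memLp_pow_smul_apply (hK : ExpFamily K)
    {x : H} (hQ : MemLp (fun s => √s • K 1 s x) 2 (volume.restrict (Ioi 0))) (n : ℕ) :
    MemLp (fun s : ℝ => (√s)⁻¹ • ((s : ℂ) ^ (n + 1) • K (n + 1) s x)) 2
      (volume.restrict (Ioi 0)) := by
  obtain ⟨C, hC0, hC⟩ := hK.exists_norm_succ_apply_le n
  have hsqrt : ContinuousOn (fun s : ℝ => (√s)⁻¹) (Ioi 0) :=
    ContinuousOn.inv₀ (by fun_prop) fun s hs => (Real.sqrt_pos.2 hs).ne'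
  have hpow : ContinuousOn (fun s : ℝ => (s : ℂ) ^ (n + 1)) (Ioi 0) :=
    Continuous.continuousOn (by fun_prop)
  refine ((memLp_sqrt_mul_norm_comp_mul hQ (show (0 : ℝ) < 2⁻¹ by norm_num)).const_mul C).mono
    ((hsqrt.smul (hpow.smul (hK.continuousOn_apply _ x))).aestronglyMeasurable
      measurableSet_Ioi) ?_
  · filter_upwards [ae_pos] with s hs
    have hss := Real.sqrt_pos.2 hs
    have h1 := Real.mul_self_sqrt hs.le
    rw [norm_smul, norm_smul, norm_inv, norm_pow, Complex.norm_real, Real.norm_of_nonneg hs.le,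
      Real.norm_of_nonneg hss.le, Real.norm_of_nonneg (by positivity), ← div_eq_inv_mul s 2]
    calc _ ≤ (√s)⁻¹ * (s ^ (n + 1) * (C / s ^ n * ‖K 1 (s / 2) x‖)) := by
          gcongr
          exact hC s x hs
      _ = C * ((√s)⁻¹ * s * ‖K 1 (s / 2) x‖) := by
          field_simp
          ring
      _ = _ := by rw [inv_mul_eq_div, Real.div_sqrt]

theorem integrableOn_Icc_pow_smul (hK : ExpFamily K) (m n : ℕ) {f : ℝ → H}
    (hf : ∀ a b, 0 < a → IntegrableOn f (Icc a b)) (a b : ℝ) (ha : 0 < a) :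
    IntegrableOn (fun s : ℝ => (s : ℂ) ^ m • K n s (f s)) (Icc a b) :=
  IntegrableOn.continuousOn_smul
    (hK.integrableOn_Icc_apply n continuous_id (fun s hs => ha.trans_le hs.1) (hf a b ha))
    (f := fun s : ℝ => (s : ℂ) ^ m) (Continuous.continuousOn (by fun_prop)) isCompact_Icc

/-- Half of the time is spent on h. The values m = 1 and m = 0 match f in the weighted spaces with
weight t and 1/t respectively. -/
theorem exists_norm_inner_pow_smul_le (hK : ExpFamily K) (n : ℕ) : ∃ C, 0 ≤ C ∧
    ∀ (m : ℕ) (s : ℝ) (h x : H), 0 < s → ‖inner ℂ h ((s : ℂ) ^ (n + m) • K (n + 1) s x)‖ ≤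
      C * (s ^ m * (‖ContinuousLinearMap.adjoint (K 1 (s / 2)) h‖ * ‖x‖)) := by
  obtain ⟨C, hC0, hC⟩ := hK.exists_norm_adjoint_succ_apply_le n
  refine ⟨C, hC0, fun m s h x hs => ?_⟩
  rw [inner_smul_right, norm_mul, norm_pow, Complex.norm_real, Real.norm_of_nonneg hs.le,
    ← ContinuousLinearMap.adjoint_inner_left]
  calc _ ≤ s ^ (n + m) * (C / s ^ n * ‖ContinuousLinearMap.adjoint (K 1 (s / 2)) h‖ * ‖x‖) := by
        gcongr
        refine (norm_inner_le_norm _ _).trans ?_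
        gcongr
        exact hC s h hs
    _ = _ := by
        rw [pow_add]
        field_simp

theorem integrableOn_inner_pow_succ_smul (hK : ExpFamily K)
    (hQ : ∀ h : H, MemLp (fun s => √s • ContinuousLinearMap.adjoint (K 1 s) h) 2
      (volume.restrict (Ioi 0))) {f : ℝ → H}
    (hf : MemLp (fun t => √t • f t) 2 (volume.restrict (Ioi 0))) (n : ℕ) (h : H) :
    IntegrableOn (fun s : ℝ => inner ℂ h ((s : ℂ) ^ (n + 1) • K (n + 1) s (f s))) (Ioi 0) := by
  obtain ⟨C, hC0, hC⟩ := hK.exists_norm_inner_pow_smul_le n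
  refine ((integrableOn_mul_norm_adjoint hQ hf h).const_mul C).mono'
    (aestronglyMeasurable_of_integrableOn_Icc
      (hK.integrableOn_Icc_pow_smul _ _ (integrableOn_Icc_of_sqrt hf))).const_inner ?_
  filter_upwards [ae_pos] with s hs
  simpa using hC 1 s h (f s) hs

theorem integrableOn_inner_pow_smul (hK : ExpFamily K)
    (hQ : ∀ h : H, MemLp (fun s => √s • ContinuousLinearMap.adjoint (K 1 s) h) 2
      (volume.restrict (Ioi 0))) {f : ℝ → H}
    (hf : MemLp (fun t => (√t)⁻¹ • f t) 2 (volume.restrict (Ioi 0))) (n : ℕ) (h : H) :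
    IntegrableOn (fun s : ℝ => inner ℂ h ((s : ℂ) ^ n • K (n + 1) s (f s))) (Ioi 0) := by
  obtain ⟨C, hC0, hC⟩ := hK.exists_norm_inner_pow_smul_le n
  refine integrableOn_of_norm_le_mul (aestronglyMeasurable_of_integrableOn_Icc
      (hK.integrableOn_Icc_pow_smul _ _ (integrableOn_Icc_of_inv_sqrt hf))).const_inner
    ((memLp_sqrt_mul_norm_comp_mul (hQ h) (show (0 : ℝ) < 2⁻¹ by norm_num)).const_mul C) hf.norm
    fun s hs => ?_
  have hss := Real.sqrt_pos.2 hs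
  refine (by simpa using hC 0 s h (f s) hs :
    _ ≤ C * (‖ContinuousLinearMap.adjoint (K 1 (s / 2)) h‖ * ‖f s‖)).trans_eq ?_
  rw [norm_smul, norm_inv, Real.norm_of_nonneg hss.le, ← div_eq_inv_mul s 2]
  field_simp

end ExpFamily

end MaxReg


/-! ### The theorem -/

open MaxReg

theorem theorem2p1 {H : Type*} [NormedAddCommGroup H] [InnerProductSpace ℂ H] [CompleteSpace H]
    (A : H →ₗ.[ℂ] H) (hdense : Dense (A.domain : Set H)) (hclosed : A.IsClosed)
    (δ : ℝ) (hδ₀ : 0 < δ) (hδ₁ : δ < Real.pi / 2)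
    (S : ℂ → H →L[ℂ] H) (hS : MaxReg.IsBoundedAnalyticSemigroup A δ S)
    (N : ℕ) (hN : 1 ≤ N) :
    -- evolution formulae
    (MaxReg.QuadraticEstimate A S → ∀ f₀ : H,
      (MaxReg.MemW (-1) (fun s : ℝ => (s : ℂ) ^ N • MaxReg.powExp A S N s f₀) ∧
        MaxReg.MemW (-1)
          (MaxReg.forwardMR A S (fun s : ℝ => (s : ℂ) ^ N • MaxReg.powExp A S N s f₀)) ∧
        ∀ t : ℝ, 0 < t →
          MaxReg.ForwardConverges A S (fun s : ℝ => (s : ℂ) ^ N • MaxReg.powExp A S N s f₀) t ∧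
          MaxReg.forwardMR A S (fun s : ℝ => (s : ℂ) ^ N • MaxReg.powExp A S N s f₀) t =
            (1 / ((N : ℂ) + 1)) • ((t : ℂ) ^ (N + 1) • MaxReg.powExp A S (N + 1) t f₀)) ∧
      (MaxReg.MemW 1 (fun s : ℝ => MaxReg.powExp A S 1 (N * s) f₀) ∧
        MaxReg.MemW 1
          (MaxReg.backwardMR A S (fun s : ℝ => MaxReg.powExp A S 1 (N * s) f₀)) ∧
        ∀ t : ℝ, 0 < t →
          MaxReg.BackwardConverges A S (fun s : ℝ => MaxReg.powExp A S 1 (N * s) f₀) t ∧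
          MaxReg.backwardMR A S (fun s : ℝ => MaxReg.powExp A S 1 (N * s) f₀) t =
            (1 / ((N : ℂ) + 1)) • MaxReg.powExp A S 1 (N * t) f₀)) ∧
    (MaxReg.QuadraticEstimate A.adjoint (MaxReg.adjSemigroup S) →
      -- balayage formulae
      (∀ f : ℝ → H, MaxReg.MemW (-1) f →
        (∀ᵐ t ∂(volume.restrict (Ioi (0 : ℝ))), MaxReg.ForwardConverges A S f t) ∧
        MaxReg.MemW (-1) (MaxReg.forwardMR A S f) ∧
        ∃ v : H,
          MaxReg.HasWeakIntegral (fun s => MaxReg.powExp A S 1 (N * s) (f s)) v ∧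
          MaxReg.HasWeakIntegral
            (fun t => MaxReg.powExp A S 1 (N * t) (MaxReg.forwardMR A S f t))
            ((1 / ((N : ℂ) + 1)) • v)) ∧
      (∀ f : ℝ → H, MaxReg.MemW 1 f →
        (∀ᵐ t ∂(volume.restrict (Ioi (0 : ℝ))), MaxReg.BackwardConverges A S f t) ∧
        MaxReg.MemW 1 (MaxReg.backwardMR A S f) ∧
        ∃ v : H,
          MaxReg.HasWeakIntegral
            (fun s : ℝ => (s : ℂ) ^ (N + 1) • MaxReg.powExp A S (N + 1) s (f s)) v ∧
          MaxReg.HasWeakIntegral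
            (fun t : ℝ => (t : ℂ) ^ N • MaxReg.powExp A S N t (MaxReg.backwardMR A S f t))
            ((1 / ((N : ℂ) + 1)) • v)) ∧
      -- endpoint balayage formulae
      (∀ f : ℝ → H, MaxReg.MemW 1 f →
        ∀ F : H, MaxReg.HasImproperWeakIntegral (fun s : ℝ => S (s : ℂ) (f s)) F →
        F ∈ closure (Set.range (fun x : A.domain => A x)) →
        (∀ᵐ t ∂(volume.restrict (Ioi (0 : ℝ))), MaxReg.ForwardConverges A S f t) ∧
        ∃ v : H,
          MaxReg.HasImproperWeakIntegral (fun s : ℝ => S ((N * s : ℝ) : ℂ) (f s)) v ∧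
          MaxReg.HasImproperWeakIntegral
            (fun t : ℝ => S ((N * t : ℝ) : ℂ) (MaxReg.forwardMR A S f t))
            ((1 / ((N : ℂ) + 1)) • v)) ∧
      (∀ f : ℝ → H, MaxReg.MemW (-1) f →
        MaxReg.HasImproperWeakIntegral (fun s : ℝ => MaxReg.powExp A S 1 s (f s)) 0 →
        (∀ᵐ t ∂(volume.restrict (Ioi (0 : ℝ))), MaxReg.BackwardConverges A S f t) ∧
        MaxReg.MemW (-1) (MaxReg.backwardMR A S f) ∧
        ∃ v : H,
          MaxReg.HasWeakIntegral
            (fun s : ℝ => (s : ℂ) ^ N • MaxReg.powExp A S (N + 1) s (f s)) v ∧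
          MaxReg.HasWeakIntegral
            (fun t : ℝ =>
              (t : ℂ) ^ (N - 1) • MaxReg.powExp A S N t (MaxReg.backwardMR A S f t))
            ((1 / (N : ℂ)) • v))) := by
  have hK := expFamily_powOp hδ₀ hδ₁ hS
  have hE : ∀ (n : ℕ) {t : ℝ}, 0 < t → ∀ x, powExp A S n t x = powOp S n t x :=
    fun n t ht x => powExp_eq_powOp hδ₀ hδ₁ hS n ht x
  have hN0 : (0 : ℝ) < N := by exact_mod_cast hN
  have hN1 : (1 : ℝ) ≤ N := by exact_mod_cast hN
  have hcoef : 1 / ((N : ℂ) + 1) = (((N : ℝ) : ℂ) + 1)⁻¹ := by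
    rw [one_div]
    norm_num
  -- Writing N = m + 1 removes the truncated subtraction in the power t^{N-1}.
  obtain ⟨m, rfl⟩ : ∃ m, N = m + 1 := ⟨N - 1, by omega⟩
  refine ⟨fun hQA f₀ => ?_, fun hQA => ?_⟩
  · have hQ : MemLp (fun s => √s • powOp S 1 s f₀) 2 (volume.restrict (Ioi 0)) :=
      hQA.memLp (hK.continuousOn_apply 1 f₀) fun s hs => hE 1 hs f₀
    constructor
    · have hval : ∀ t : ℝ, 0 < t → IsForwardValue A S
          (fun s : ℝ => (s : ℂ) ^ (m + 1) • powExp A S (m + 1) s f₀) t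
          ((1 / (((m + 1 : ℕ) : ℂ) + 1)) •
            ((t : ℂ) ^ (m + 1 + 1) • powExp A S (m + 1 + 1) t f₀)) := by
        intro t ht
        rw [hE _ ht, one_div, isForwardValue_iff hδ₀ hδ₁ hS ht]
        intro h
        refine (hK.forwardValue_pow_smul (m + 1) f₀ ht h).congr' ?_
        filter_upwards [eventually_forward ht] with p ⟨hp1, _, hp3⟩
        congr 1
        refine intervalIntegral.integral_congr fun s hs => ?_
        rw [uIcc_of_le hp3.le] at hs
        simp only [hE _ (hp1.trans_le hs.1)]
      refine ⟨?_, ?_, fun t ht => ⟨⟨_, hval t ht⟩, (hval t ht).forwardMR_eq⟩⟩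
      · refine memW_congr ?_ (memW_neg_one_iff.2 (hK.memLp_pow_smul_apply hQ m))
        filter_upwards [ae_pos] with s hs
        rw [hE _ hs]
      · refine memW_congr ?_ ((memW_neg_one_iff (f := fun t : ℝ =>
          (1 / (((m + 1 : ℕ) : ℂ) + 1)) •
            ((t : ℂ) ^ (m + 1 + 1) • powOp S (m + 1 + 1) t f₀))).2 ?_)
        · filter_upwards [ae_pos] with t ht
          rw [(hval t ht).forwardMR_eq, hE _ ht]
        · refine ((hK.memLp_pow_smul_apply hQ (m + 1)).const_smul
            (1 / (((m + 1 : ℕ) : ℂ) + 1))).ae_eq (.of_forall fun s => ?_)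
          exact smul_comm _ _ _
    · have hval : ∀ t : ℝ, 0 < t → IsBackwardValue A S
          (fun s : ℝ => powExp A S 1 ((m + 1 : ℕ) * s) f₀) t
          ((1 / (((m + 1 : ℕ) : ℂ) + 1)) • powExp A S 1 ((m + 1 : ℕ) * t) f₀) := by
        intro t ht
        rw [hE _ (mul_pos hN0 ht), hcoef, isBackwardValue_iff hδ₀ hδ₁ hS]
        intro h
        have h1 := hK.backwardValue_comp_mul hN0 f₀ ht h
        rw [← Complex.coe_smul] at h1
        push_cast at h1 ⊢
        refine h1.congr' ?_
        filter_upwards [eventually_backward t] with p ⟨hp1, _, hp3, _⟩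
        congr 1
        refine intervalIntegral.integral_congr fun s hs => ?_
        rw [uIcc_of_le hp3.le] at hs
        have h2 := hE 1 (mul_pos hN0 (show 0 < s by linarith [hs.1])) f₀
        push_cast at h2
        simp only [h2]
      have hW : MemW 1 fun s : ℝ => powOp S 1 ((m + 1 : ℕ) * s) f₀ :=
        memW_one_iff.2 (memLp_sqrt_smul_comp_mul hQ hN0)
      have hWE : ∀ s : ℝ, 0 < s → powOp S 1 ((m + 1 : ℕ) * s) f₀ =
          powExp A S 1 ((m + 1 : ℕ) * s) f₀ := fun s hs => (hE 1 (mul_pos hN0 hs) f₀).symm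
      refine ⟨memW_congr (ae_pos.mono hWE) hW, ?_,
        fun t ht => ⟨⟨_, hval t ht⟩, (hval t ht).backwardMR_eq⟩⟩
      refine memW_congr ?_ (MemLp.const_smul hW (1 / (((m + 1 : ℕ) : ℂ) + 1)))
      filter_upwards [ae_pos] with t ht
      rw [(hval t ht).backwardMR_eq, Pi.smul_apply, hWE t ht]
  · have hQ : ∀ h : H, MemLp (fun s => √s • ContinuousLinearMap.adjoint (powOp S 1 s) h) 2
        (volume.restrict (Ioi 0)) := by
      intro h
      refine hQA.memLp ?_ fun s hs => powExp_adjoint hdense hδ₀ hδ₁ hS hs h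
      exact ((ContinuousLinearMap.adjoint (𝕜 := ℂ) (E := H) (F := H)).continuous.comp_continuousOn
        (hK.continuousOn 1)).clm_apply continuousOn_const
    have hfwd : ∀ {f Y : ℝ → H}, (∀ᵐ t ∂volume.restrict (Ioi (0 : ℝ)),
        ForwardValue (powOp S) f t (Y t)) → ∀ᵐ t ∂volume.restrict (Ioi (0 : ℝ)),
        IsForwardValue A S f t (Y t) := fun hY => by
      filter_upwards [hY, ae_pos] with t hYt ht
      exact (isForwardValue_iff hδ₀ hδ₁ hS ht).2 hYt
    have hbwd : ∀ {f Y : ℝ → H}, (∀ᵐ t ∂volume.restrict (Ioi (0 : ℝ)),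
        BackwardValue (powOp S) f t (Y t)) → ∀ᵐ t ∂volume.restrict (Ioi (0 : ℝ)),
        IsBackwardValue A S f t (Y t) := fun hY => by
      filter_upwards [hY] with t hYt
      exact (isBackwardValue_iff hδ₀ hδ₁ hS).2 hYt
    refine ⟨fun f hf => ?_, fun f hf => ?_, fun f hf F hF hFR => ?_, fun f hf hf0 => ?_⟩
    · rw [memW_neg_one_iff] at hf
      obtain ⟨Y, hY2, hY⟩ := hK.exists_forwardValue_neg_one hf
      have hYA := hfwd hY
      obtain ⟨v, hv, hv'⟩ := hK.exists_hasWeakIntegral_forward hQ hN0 hf hY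
      refine ⟨hYA.mono fun t ht => ⟨_, ht⟩,
        memW_congr (hYA.mono fun t ht => ht.forwardMR_eq.symm) (memW_neg_one_iff.2 hY2), v,
        hv.congr ?_, ?_⟩
      · filter_upwards [ae_pos] with s hs
        rw [hE _ (mul_pos hN0 hs)]
      · rw [hcoef]
        refine hv'.congr ?_
        filter_upwards [hYA, ae_pos] with t ht ht0
        rw [hE _ (mul_pos hN0 ht0), ht.forwardMR_eq]
    · rw [memW_one_iff] at hf
      obtain ⟨Y, hY2, hY⟩ := hK.exists_backwardValue_one hf
      have hYA := hbwd hY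
      obtain ⟨v, hv, hv'⟩ := hK.exists_hasWeakIntegral_backward (m + 1) (m + 1)
        (integrableOn_Icc_of_sqrt hf)
        (hK.integrableOn_inner_pow_succ_smul hQ hf (m + 1)) hY
      refine ⟨hYA.mono fun t ht => ⟨_, ht⟩,
        memW_congr (hYA.mono fun t ht => ht.backwardMR_eq.symm) (memW_one_iff.2 hY2), v,
        hv.congr ?_, ?_⟩
      · filter_upwards [ae_pos] with s hs
        rw [hE _ hs]
      · rw [one_div]
        refine hv'.congr ?_
        filter_upwards [hYA, ae_pos] with t ht ht0
        rw [hE _ ht0, ht.backwardMR_eq]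
    · rw [memW_one_iff] at hf
      have hF' : HasImproperWeakIntegral (fun s => powOp S 0 s (f s)) F := by
        simpa only [powOp_zero] using hF
      obtain ⟨Y, hYi, hY⟩ := hK.exists_forwardValue_one hf hF'
      have hYA := hfwd hY
      -- The closure condition on F enters only through the decay of e^{-tA} F.
      obtain ⟨v, hv, hv'⟩ := hK.exists_hasImproperWeakIntegral_forward hQ hN1 hf hF'
        (tendsto_powOp_zero_atTop hδ₀ hδ₁ hS hFR) hYi hY
      simp only [powOp_zero] at hv hv'
      refine ⟨hYA.mono fun t ht => ⟨_, ht⟩, v, hv, ?_⟩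
      rw [hcoef]
      refine hv'.congr ?_
      filter_upwards [hYA] with t ht
      rw [ht.forwardMR_eq]
    · rw [memW_neg_one_iff] at hf
      have hf0' : HasImproperWeakIntegral (fun s => powOp S 1 s (f s)) 0 :=
        hf0.congr (ae_pos.mono fun s hs => hE 1 hs (f s))
      obtain ⟨Y, hY2, hY⟩ := hK.exists_backwardValue_neg_one hf hf0'
      have hYA := hbwd hY
      -- The power of t is m = N - 1, one less than the power of A, so the cone formula gives 1/(m +
      -- 1) = 1/N in place of 1/(N + 1).
      obtain ⟨v, hv, hv'⟩ := hK.exists_hasWeakIntegral_backward m (m + 1)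
        (integrableOn_Icc_of_inv_sqrt hf)
        (hK.integrableOn_inner_pow_smul hQ hf (m + 1)) hY
      refine ⟨hYA.mono fun t ht => ⟨_, ht⟩,
        memW_congr (hYA.mono fun t ht => ht.backwardMR_eq.symm) (memW_neg_one_iff.2 hY2), v,
        hv.congr ?_, ?_⟩
      · filter_upwards [ae_pos] with s hs
        rw [hE _ hs]
      · rw [one_div, Nat.cast_add, Nat.cast_one, Nat.add_sub_cancel]
        refine hv'.congr ?_
        filter_upwards [hYA, ae_pos] with t ht ht0
        rw [hE _ ht0, ht.backwardMR_eq]
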